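/- Let $a\in\mathbb C\setminus\{-1,1\}$, $p_a(z)=(z-a)(z^2-1)$, $\theta\in[0,\pi/2)$, and for $r>0$ let $\lambda=re^{i\theta}$. Consider the cubic oscillator $$-y''(z)+\lambda^2p_a(z)\,y(z)=0 ,\qquad z\in\mathbb C. \tag{1}$$ Let $D\subset\mathbb C$ be a canonical domain: a domain with a holomorphic function $h$ on $D$ such that $(h')^2=e^{2i\theta}p_a$ and $h$ maps $D$ conformally (injectively) onto the plane with finitely many vertical cuts, a vertical cut being a closed vertical half-line directed upwards or downwards. Let $H\subset D$ satisfy $h(H)=\{\operatorname{Re}\zeta>0\}$, let $z_0\in\{-1,1,a\}$ be a turning point with $z_0\in\partial H$, and let $h(z)\to0$ as $z\to z_0$ in $H$, i.e. $h(z)=e^{i\theta}\int_{z_0}^z\sqrt{p_a(t)}\,dt$; write $h(\lambda,z_0,z)=r\,h(z)$. Fix a holomorphic branch of $p_a^{1/4}$ on $D$. For $\varepsilon>0$ let $D_\varepsilon$ be the set of all $z\in D$ such that $h(z)$ has distance at least $\varepsilon$ from the cuts and $z$ has distance at least $\varepsilon$ from $-1,1,a$. An infinite canonical path in $D_\varepsilon$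 is a locally rectifiable path $\gamma:[0,\infty)\to D_\varepsilon$ with $\gamma(t)\to\infty$ along which $\operatorname{Re}h$ is non-decreasing and tends to $+\infty$. For a set $\Gamma$ of infinite canonical paths in $D_\varepsilon$ put $$r_\varepsilon(\Gamma)=\sup_{\gamma\in\Gamma}\int_{\gamma}\left|\frac{5}{16}\frac{p_a'(t)^2}{p_a(t)^3}-\frac{p_a''(t)}{4p_a(t)^2}\right|\sqrt{|p_a(t)|}\,|dt|\in[0,\infty].$$ There is an absolute constant $c_2>0$ (in particular independent of $\lambda$) such that in every situation as above the following holds. (i) For all sufficiently small $\varepsilon>0$ there is a set $\Gamma$ of infinite canonical paths in $D_\varepsilon$ with $r_\varepsilon(\Gamma)<\infty$ such that every point of $D_\varepsilon$ is the starting point of some $\gamma\in\Gamma$. (ii) For every $r>0$, equation (1) with $\lambda=re^{i\theta}$ has an entire solution $y_2(\cdot,\lambda)\not\equiv0$ and there is a holomorphic function $\phi_2(\cdot,\lambda)$ on $D$ such that $$y_2(z,\lambda)=p_a(z)^{-1/4}\exp(-h(\lambda,z_0,z))\,[1+\phi_2(z,\lambda)]\qquad(z\in D),$$ and, for every $\varepsilon>0$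 and every set $\Gamma$ of infinite canonical paths in $D_\varepsilon$ with $r_\varepsilon=r_\varepsilon(\Gamma)<r$, $$|\phi_2(z,\lambda)|\le c_2\,\frac{r_\varepsilon}{r-r_\varepsilon}\qquad\text{for all points } z \text{ on the paths } \gamma\in\Gamma .$$ The solution is unique up to a constant multiple: every entire solution of (1) that on $D$ has the form $p_a^{-1/4}\exp(-h(\lambda,z_0,\cdot))[1+\phi]$ with $\phi$ bounded on some infinite canonical path in some $D_\varepsilon$, $\varepsilon>0$, is a constant multiple of $y_2(\cdot,\lambda)$. -/

import Mathlib

namespace CubicWKB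

/-- The cubic `p_a(z) = (z - a)(z² - 1)`, as a polynomial. -/
noncomputable def cubic (a : ℂ) : Polynomial ℂ :=
  (Polynomial.X - Polynomial.C a) * (Polynomial.X ^ 2 - 1)

/-- The turning points, i.e. the zeros of `p_a`. -/
def turningPoints (a : ℂ) : Set ℂ := {-1, 1, a}

/-- Entire solutions of the cubic oscillator `-y'' + μ² p_a y = 0`. -/
def IsSolution (a μ : ℂ) (y : ℂ → ℂ) : Prop :=
  Differentiable ℂ y ∧
    ∀ z, -(deriv (deriv y) z) + μ ^ 2 * (cubic a).eval z * y z = 0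

/-- The vertical cut with tip `b`: the closed vertical ray issuing from `b`, directed upwards if
`up = true` and downwards if `up = false`. -/
def verticalCut (b : ℂ) (up : Bool) : Set ℂ :=
  {w | w.re = b.re ∧ if up then b.im ≤ w.im else w.im ≤ b.im}

/-- `D` is a canonical domain for the direction `θ`, as witnessed by the function `h`: `D` is a
domain, `h` is a holomorphic branch on `D` of a primitive of `e^{iθ} √p_a`, and `h` maps `D`
conformally onto the plane with finitely many vertical cuts. -/
structure IsCanonicalBranch (a : ℂ) (θ : ℝ) (D : Set ℂ) (h : ℂ → ℂ) : Prop where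
  isOpen : IsOpen D
  isConnected : IsConnected D
  differentiableOn : DifferentiableOn ℂ h D
  deriv_sq : ∀ z ∈ D,
    deriv h z ^ 2 = Complex.exp (Complex.I * θ) ^ 2 * (cubic a).eval z
  injOn : Set.InjOn h D
  image_eq : ∃ cuts : Finset (ℂ × Bool), h '' D = (⋃ c ∈ cuts, verticalCut c.1 c.2)ᶜ

/-- `H ⊆ D` is a half-plane domain whose boundary contains the turning point `z₀`, and the
primitive `h` is based at `z₀` (so that `h(z) = e^{iθ} ∫_{z₀}^z √p_a`) and maps `H` onto the right
half-plane. -/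
structure IsBasedHalfPlane (a : ℂ) (D : Set ℂ) (h : ℂ → ℂ) (H : Set ℂ) (z₀ : ℂ) : Prop where
  subset : H ⊆ D
  image_eq : h '' H = {w | 0 < w.re}
  turning : z₀ ∈ turningPoints a
  mem_frontier : z₀ ∈ frontier H
  tendsto_zero : Filter.Tendsto h (nhdsWithin z₀ H) (nhds 0)

/-- The domain `D_ε`: the points of `D` whose image under `h` is outside the `ε`-neighbourhoods of
the cuts (the cuts make up the complement of `h(D)`) and which are outside the
`ε`-neighbourhoods of the turning points. -/
def trimmed (a : ℂ) (D : Set ℂ) (h : ℂ → ℂ) (ε : ℝ) : Set ℂ :=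
  {z | z ∈ D ∧ (∀ w, w ∉ h '' D → ε ≤ dist (h z) w) ∧ ∀ t ∈ turningPoints a, ε ≤ dist z t}

/-- Infinite canonical paths `γ : [0, ∞) → D_ε`: locally rectifiable paths (parametrised so as to
be Lipschitz on bounded intervals) going to `∞`, along which `Re h` is non-decreasing and tends to
`+∞`. Only the values of `γ` on `[0, ∞)` matter. -/
structure IsInfiniteCanonicalPath (a : ℂ) (D : Set ℂ) (h : ℂ → ℂ) (ε : ℝ) (γ : ℝ → ℂ) :
    Prop where
  lipschitz : ∀ T : ℝ, ∃ K : NNReal, LipschitzOnWith K γ (Set.Icc 0 T)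
  mem : ∀ t, 0 ≤ t → γ t ∈ trimmed a D h ε
  monotone : MonotoneOn (fun t => (h (γ t)).re) (Set.Ici 0)
  tendsto_re : Filter.Tendsto (fun t => (h (γ t)).re) Filter.atTop Filter.atTop
  tendsto_infty : Filter.Tendsto (fun t => ‖γ t‖) Filter.atTop Filter.atTop

/-- The error-control integrand
`|5/16 · p_a'² / p_a³ - p_a'' / (4 p_a²)| · √|p_a|`. -/
noncomputable def errorDensity (a z : ℂ) : ℝ :=
  ‖(5 / 16 : ℂ) * ((cubic a).derivative.eval z ^ 2 / (cubic a).eval z ^ 3)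
      - (cubic a).derivative.derivative.eval z / (4 * (cubic a).eval z ^ 2)‖
    * Real.sqrt ‖(cubic a).eval z‖

/-- The integral of the error-control integrand along the path `γ : [0, ∞) → ℂ` with respect to
arc length, as an element of `[0, ∞]`. -/
noncomputable def errorIntegral (a : ℂ) (γ : ℝ → ℂ) : ENNReal :=
  ∫⁻ t in Set.Ioi (0 : ℝ), ENNReal.ofReal (errorDensity a (γ t) * ‖deriv γ t‖)

/-- The supremum `r_ε ∈ [0, ∞]` of the error-control integrals over a set of paths. -/
noncomputable def errorSup (a : ℂ) (Γ : Set (ℝ → ℂ)) : ENNReal :=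
  ⨆ γ ∈ Γ, errorIntegral a γ

end CubicWKB

open MeasureTheory Filter Topology Set

namespace CubicWKB

/-! The Liouville transformation drives the whole argument. Take `ζ = h(z)` as independent variable
and `W = p_a^{1/4} e^{r h} y` as unknown. Equation (1) becomes `W'' - 2 r W' = V W`, where `|V|` is
the modulus of the error-control coefficient. Since `|h'| = √|p_a|`, the error-control integral of a
path is the integral of `|V| |dζ|` over its image, and `φ₂ = W - 1`.

Existence: the image of `D` contains the right half-plane. There `|V|` is `O(|z|⁻⁵)`, and `|z|⁵`
grows at least like `|ζ|²`, so `V = O(|ζ|⁻²)`. A Neumann series (`exists_recessive`) gives a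
solution with `W → 1` as `Re ζ → ∞`. Matching Cauchy data at one point of an entire solution, built
from its power series, carries it to the whole plane (`exists_recessive_solution`).

Estimate: along a canonical path, variation of constants has the kernel `(1 - e^{2r(h(γ t) - h(γ
s))}) / (2r)`. For `s ≥ t` its modulus is at most `1/r`, because `Re h` does not decrease. If `ρ` is
the error integral and `M` the supremum of `|W - 1|` on the path, then `M ≤ (1 + M) ρ / r`, hence `M
≤ ρ / (r - ρ)` (`norm_sub_one_le_of_path`). Thus `c₂ = 1` suffices.

Uniqueness: the Wronskian of two transformed solutions is `c e^{2 r ζ}`. If `c ≠ 0`, the second one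
grows exponentially, uniformly in `Im ζ` (`exists_lt_norm_of_wronskian_ne_zero`), which no bounded
`φ` allows. If `c = 0`, the solutions are proportional.

Paths: the image of `D` is connected, so every column of vertical cuts has a gap. A polygon with
axis-parallel sides, never moving left and ending in a horizontal ray, threads these gaps with a
bounded number of sides (`columns_induction`). Each side costs a uniformly bounded amount
(`exists_lintegral_line_le`). Where the inverse `g` of `h` is large, `|g|⁵ - (5/2) s²` is convex
along a line, which makes `|g|⁻⁵` integrable with an absolute bound. Elsewhere `ζ` stays bounded, by
a weak Koebe theorem. The same theorem shows that, for small `ε`, distance `ε` from the cuts already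
forces distance `ε` from the turning points. -/

/-! ### Increments along Lipschitz paths -/

/-- The increment of a Lipschitz function is bounded by the integral of the norm of its
derivative. -/
theorem enorm_sub_le_lintegral_deriv {f : ℝ → ℂ} {a b : ℝ} {K : NNReal} (hab : a ≤ b)
    (hf : LipschitzOnWith K f (Icc a b)) :
    ‖f b - f a‖ₑ ≤ ∫⁻ t in Ioo a b, ‖deriv f t‖ₑ := by
  -- A unimodular factor makes the increment real and nonnegative, so the fundamental theorem for
  -- real absolutely continuous functions, applied to `Re (c f)`, is enough.
  obtain ⟨c, hc, hcv⟩ : ∃ c : ℂ, ‖c‖ = 1 ∧ c * (f b - f a) = ‖f b - f a‖ := by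
    by_cases h0 : f b - f a = 0
    · exact ⟨1, by simp, by simp [h0]⟩
    · have : ((‖f b - f a‖ : ℝ) : ℂ) ≠ 0 := by simpa using h0
      refine ⟨‖f b - f a‖ / (f b - f a), ?_, by field_simp⟩
      rw [norm_div, Complex.norm_real, norm_norm, div_self (by simpa using h0)]
  set u : ℝ → ℝ := fun t => (c * f t).re with hu
  have hul : LipschitzOnWith K u (Icc a b) := by
    refine LipschitzOnWith.of_dist_le_mul fun x hx y hy => ?_
    refine le_trans ?_ (hf.dist_le_mul x hx y hy)
    simp only [hu, dist_eq_norm]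
    rw [← Complex.sub_re, ← mul_sub]
    refine (Complex.abs_re_le_norm _).trans ?_
    rw [norm_mul, hc, one_mul]
  have hac : AbsolutelyContinuousOnInterval u a b := by
    apply LipschitzOnWith.absolutelyContinuousOnInterval (K := K)
    rwa [uIcc_of_le hab]
  have hftc := hac.integral_deriv_eq_sub
  have hval : u b - u a = ‖f b - f a‖ := by
    simp only [hu]
    rw [← Complex.sub_re, ← mul_sub, hcv, Complex.ofReal_re]
  have hae : ∀ᵐ t ∂(volume.restrict (Ioo a b)), DifferentiableAt ℝ f t := by
    have := hf.ae_differentiableWithinAt_of_mem (μ := volume)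
    rw [ae_restrict_iff' measurableSet_Ioo]
    filter_upwards [this] with t ht htm
    exact (ht (Ioo_subset_Icc_self htm)).differentiableAt (Icc_mem_nhds htm.1 htm.2)
  calc ‖f b - f a‖ₑ = ‖∫ t in a..b, deriv u t‖ₑ := by
        rw [hftc, hval, ← ofReal_norm, ← ofReal_norm]; simp
    _ = ‖∫ t in Ioo a b, deriv u t‖ₑ := by
        rw [intervalIntegral.integral_of_le hab, integral_Ioc_eq_integral_Ioo]
    _ ≤ ∫⁻ t in Ioo a b, ‖deriv u t‖ₑ := enorm_integral_le_lintegral_enorm _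
    _ ≤ ∫⁻ t in Ioo a b, ‖deriv f t‖ₑ := by
        refine lintegral_mono_ae ?_
        filter_upwards [hae] with t ht
        have h1 : HasDerivAt u (c * deriv f t).re t := by
          have h2 := (ht.hasDerivAt.const_mul c)
          exact (Complex.reCLM.hasFDerivAt.comp_hasDerivAt t h2)
        rw [h1.deriv, ← ofReal_norm, ← ofReal_norm]
        refine ENNReal.ofReal_le_ofReal ((Complex.abs_re_le_norm _).trans ?_)
        rw [norm_mul, hc, one_mul]

/-- The increment of a holomorphic function along a Lipschitz path. -/
theorem enorm_sub_le_lintegral_comp {F F' : ℂ → ℂ} {γ : ℝ → ℂ} {U : Set ℂ} {a b : ℝ} {K : NNReal}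
    (hU : IsOpen U) (hF : ∀ z ∈ U, HasDerivAt F (F' z) z) (hab : a ≤ b)
    (hγ : LipschitzOnWith K γ (Icc a b)) (hmem : ∀ t ∈ Icc a b, γ t ∈ U) :
    ‖F (γ b) - F (γ a)‖ₑ ≤ ∫⁻ t in Ioo a b, ‖F' (γ t) * deriv γ t‖ₑ := by
  have hFd : DifferentiableOn ℂ F U := fun z hz => (hF z hz).differentiableAt.differentiableWithinAt
  have hFc : ContDiffOn ℂ 1 F U := hFd.contDiffOn hU
  -- `F` need not be Lipschitz on `U`; compactness of the path gives one constant on its image.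
  have hloc : LocallyLipschitzOn (γ '' Icc a b) F := by
    intro z hz
    obtain ⟨t, ht, rfl⟩ := hz
    have hz := hmem t ht
    obtain ⟨K', s, hs, hK'⟩ := ((hFc.contDiffAt (hU.mem_nhds hz))).exists_lipschitzOnWith
    exact ⟨K', s, mem_nhdsWithin_of_mem_nhds hs, hK'⟩
  obtain ⟨K', hK'⟩ := hloc.exists_lipschitzOnWith_of_compact
    (isCompact_Icc.image_of_continuousOn hγ.continuousOn)
  have hcomp : LipschitzOnWith (K' * K) (F ∘ γ) (Icc a b) :=
    hK'.comp hγ (mapsTo_image _ _)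
  refine (enorm_sub_le_lintegral_deriv hab hcomp).trans (lintegral_mono_ae ?_)
  have := hγ.ae_differentiableWithinAt_of_mem (μ := volume)
  filter_upwards [ae_restrict_of_ae this, ae_restrict_mem measurableSet_Ioo] with t ht htm
  have hd := (ht (Ioo_subset_Icc_self htm)).differentiableAt (Icc_mem_nhds htm.1 htm.2)
  have := (hF _ (hmem t (Ioo_subset_Icc_self htm))).comp_of_eq t hd.hasDerivAt rfl
  rw [HasDerivAt.deriv this]


/-! ### Entire solutions by power series -/

/-- Sequences decaying faster than every geometric sequence: the Taylor coefficients of entire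
functions. -/
def RapidlyDecaying (c : ℕ → ℂ) : Prop := ∀ ρ : ℝ, 1 ≤ ρ → ∃ B : ℝ, ∀ n, ‖c n‖ * ρ ^ n ≤ B

theorem RapidlyDecaying.derivCoeff {c : ℕ → ℂ} (hc : RapidlyDecaying c) :
    RapidlyDecaying fun n => (n + 1) * c (n + 1) := by
  intro ρ hρ
  -- The spare factor `2 ^ (n + 1)` at radius `2 * ρ` absorbs the factor `n + 1`.
  obtain ⟨B, hB⟩ := hc (2 * ρ) (by linarith)
  refine ⟨B, fun n => le_trans ?_ (hB (n + 1))⟩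
  have h1 : ((n : ℝ) + 1) ≤ 2 ^ (n + 1) := by
    have := (Nat.lt_two_pow_self (n := n + 1)).le
    exact_mod_cast this
  have h2 : ρ ^ n ≤ ρ ^ (n + 1) := pow_le_pow_right₀ hρ (Nat.le_succ n)
  have h3 : ‖((n : ℂ) + 1)‖ = n + 1 := by
    have : ((n : ℂ) + 1) = ((n + 1 : ℕ) : ℂ) := by push_cast; ring
    rw [this, Complex.norm_natCast]; push_cast; ring
  rw [norm_mul, h3, mul_pow]
  calc ((n : ℝ) + 1) * ‖c (n + 1)‖ * ρ ^ n = ‖c (n + 1)‖ * ((n + 1) * ρ ^ n) := by ring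
    _ ≤ _ := by gcongr

theorem RapidlyDecaying.norm_le {c : ℕ → ℂ} (hc : RapidlyDecaying c) (R : ℝ) :
    ∃ u : ℕ → ℝ, Summable u ∧ ∀ n, ∀ z ∈ Metric.ball (0 : ℂ) R, ‖c n * z ^ n‖ ≤ u n := by
  set ρ := max R 1
  obtain ⟨B, hB⟩ := hc (2 * ρ) (by linarith [le_max_right R 1])
  refine ⟨fun n => B * (1 / 2) ^ n, summable_geometric_two.mul_left B, fun n z hz => ?_⟩
  have hz' : ‖z‖ ≤ ρ := by
    rw [Metric.mem_ball, dist_zero_right] at hz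
    exact hz.le.trans (le_max_left _ _)
  have h0 : (0 : ℝ) ≤ ρ := zero_le_one.trans (le_max_right _ _)
  rw [norm_mul, norm_pow]
  calc ‖c n‖ * ‖z‖ ^ n ≤ ‖c n‖ * ρ ^ n := by gcongr
    _ = ‖c n‖ * (2 * ρ) ^ n * (1 / 2) ^ n := by
      rw [mul_pow, mul_assoc, mul_right_comm (2 ^ n : ℝ), ← mul_pow]; norm_num
    _ ≤ _ := mul_le_mul_of_nonneg_right (hB n) (by positivity)

theorem RapidlyDecaying.summable {c : ℕ → ℂ} (hc : RapidlyDecaying c) (z : ℂ) :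
    Summable fun n => c n * z ^ n := by
  obtain ⟨u, hu, h⟩ := hc.norm_le (‖z‖ + 1)
  exact Summable.of_norm_bounded hu fun n => h n z (by simp)

theorem RapidlyDecaying.hasDerivAt {c : ℕ → ℂ} (hc : RapidlyDecaying c) (z : ℂ) :
    HasDerivAt (fun z => ∑' n, c n * z ^ n) (∑' n : ℕ, (n + 1) * c (n + 1) * z ^ n) z := by
  obtain ⟨u, hu, h⟩ := hc.norm_le (‖z‖ + 1)
  have hz : z ∈ Metric.ball (0 : ℂ) (‖z‖ + 1) := by simp
  have hd : ∀ n : ℕ, DifferentiableOn ℂ (fun z => c n * z ^ n) (Metric.ball (0 : ℂ) (‖z‖ + 1)) :=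
    fun n => by fun_prop
  have h1 := Complex.hasSum_deriv_of_summable_norm hu hd Metric.isOpen_ball h hz
  have h2 := Complex.differentiableOn_tsum_of_summable_norm hu hd Metric.isOpen_ball h
  have h3 := (h2.differentiableAt (Metric.isOpen_ball.mem_nhds hz)).hasDerivAt
  refine h3.congr_deriv ?_
  have h4 := h1.tsum_eq
  rw [← h4, h1.summable.tsum_eq_zero_add]
  simp only [pow_zero, mul_one, deriv_const, zero_add]
  refine tsum_congr fun n => ?_
  have : HasDerivAt (fun z : ℂ => c (n + 1) * z ^ (n + 1))
      (c (n + 1) * (((n + 1 : ℕ) : ℂ) * z ^ n)) z := by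
    simpa using (hasDerivAt_pow (n + 1) z).const_mul (c (n + 1))
  rw [this.deriv]; push_cast; ring

/-- The Taylor coefficients, shifted by three places, of the solution of `y'' = Q y` with
`Q = q₀ + q₁ z + q₂ z² + q₃ z³`. -/
noncomputable def odeCoeff (q₀ q₁ q₂ q₃ y₀ y₁ : ℂ) : ℕ → ℂ
  | 0 => 0
  | 1 => 0
  | 2 => 0
  | 3 => y₀
  | 4 => y₁
  | n + 5 => (q₀ * odeCoeff q₀ q₁ q₂ q₃ y₀ y₁ (n + 3) + q₁ * odeCoeff q₀ q₁ q₂ q₃ y₀ y₁ (n + 2)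
      + q₂ * odeCoeff q₀ q₁ q₂ q₃ y₀ y₁ (n + 1) + q₃ * odeCoeff q₀ q₁ q₂ q₃ y₀ y₁ n)
        / ((n + 2) * (n + 1))

theorem rapidlyDecaying_odeCoeff (q₀ q₁ q₂ q₃ y₀ y₁ : ℂ) :
    RapidlyDecaying (odeCoeff q₀ q₁ q₂ q₃ y₀ y₁) := by
  intro ρ hρ
  set d := odeCoeff q₀ q₁ q₂ q₃ y₀ y₁ with hd
  set A : ℝ := ‖q₀‖ + ‖q₁‖ + ‖q₂‖ + ‖q₃‖ with hA
  -- From index `N + 5` on, the denominator `(m + 2) * (m + 1)` beats `A * ρ ^ 5`, so a bound valid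
  -- for the earlier terms reproduces itself.
  obtain ⟨N, hN⟩ := exists_nat_ge (A * ρ ^ 5)
  have hρ0 : 0 < ρ := by linarith
  set B : ℝ := ∑ j ∈ Finset.range (N + 5), ‖d j‖ * ρ ^ j with hB
  have hB0 : 0 ≤ B := Finset.sum_nonneg fun j _ => by positivity
  refine ⟨B, fun n => ?_⟩
  induction n using Nat.strong_induction_on with
  | _ n ih =>
    by_cases hn : n < N + 5
    · exact Finset.single_le_sum (f := fun j => ‖d j‖ * ρ ^ j) (fun j _ => by positivity)
        (Finset.mem_range.2 hn)
    · obtain ⟨m, rfl⟩ : ∃ m, n = m + 5 := ⟨n - 5, by omega⟩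
      have hm : N ≤ m := by omega
      have hrec : d (m + 5) = (q₀ * d (m + 3) + q₁ * d (m + 2) + q₂ * d (m + 1) + q₃ * d m)
          / ((m + 2) * (m + 1)) := by rw [hd, odeCoeff]
      have hb : ∀ k, k ≤ 3 → ‖d (m + k)‖ * ρ ^ m ≤ B := fun k hk => by
        refine le_trans ?_ (ih (m + k) (by omega))
        gcongr
        omega
      have hden : ‖(((m : ℂ) + 2) * (m + 1))‖ = (m + 2) * (m + 1) := by
        have : (((m : ℂ) + 2) * (m + 1)) = (((m + 2) * (m + 1) : ℕ) : ℂ) := by push_cast; ring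
        rw [this, Complex.norm_natCast]; push_cast; ring
      have hden0 : (0 : ℝ) < (m + 2) * (m + 1) := by positivity
      have hmA : A * ρ ^ 5 ≤ (m + 2) * (m + 1) := by
        have : (N : ℝ) ≤ m := by exact_mod_cast hm
        nlinarith
      rw [hrec, norm_div, hden, div_mul_eq_mul_div, div_le_iff₀ hden0]
      have hnum : ‖q₀ * d (m + 3) + q₁ * d (m + 2) + q₂ * d (m + 1) + q₃ * d m‖ ≤
          ‖q₀‖ * ‖d (m + 3)‖ + ‖q₁‖ * ‖d (m + 2)‖ + ‖q₂‖ * ‖d (m + 1)‖ + ‖q₃‖ * ‖d m‖ := by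
        refine (norm_add_le _ _).trans (add_le_add ((norm_add_le _ _).trans (add_le_add
          ((norm_add_le _ _).trans (add_le_add ?_ ?_)) ?_)) ?_) <;> rw [norm_mul]
      calc _ ≤ (‖q₀‖ * ‖d (m + 3)‖ + ‖q₁‖ * ‖d (m + 2)‖ + ‖q₂‖ * ‖d (m + 1)‖ + ‖q₃‖ * ‖d m‖)
            * ρ ^ (m + 5) := by gcongr
        _ = (‖q₀‖ * (‖d (m + 3)‖ * ρ ^ m) + ‖q₁‖ * (‖d (m + 2)‖ * ρ ^ m)
            + ‖q₂‖ * (‖d (m + 1)‖ * ρ ^ m) + ‖q₃‖ * (‖d m‖ * ρ ^ m)) * ρ ^ 5 := by ring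
        _ ≤ (‖q₀‖ * B + ‖q₁‖ * B + ‖q₂‖ * B + ‖q₃‖ * B) * ρ ^ 5 := by
          gcongr
          exacts [hb 3 le_rfl, hb 2 (by norm_num), hb 1 (by norm_num), hb 0 (by norm_num)]
        _ = B * (A * ρ ^ 5) := by rw [hA]; ring
        _ ≤ _ := by gcongr

/-- The Cauchy problem at the origin for `y'' = Q y` with `Q` a cubic polynomial. -/
theorem exists_entire_solution_zero (q₀ q₁ q₂ q₃ y₀ y₁ : ℂ) :
    ∃ y y' : ℂ → ℂ, (∀ z, HasDerivAt y (y' z) z) ∧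
      (∀ z, HasDerivAt y' ((q₀ + q₁ * z + q₂ * z ^ 2 + q₃ * z ^ 3) * y z) z) ∧
      y 0 = y₀ ∧ y' 0 = y₁ := by
  set d := odeCoeff q₀ q₁ q₂ q₃ y₀ y₁ with hd
  have hdd : RapidlyDecaying d := rapidlyDecaying_odeCoeff _ _ _ _ _ _
  have shift : ∀ c : ℕ → ℂ, RapidlyDecaying c → RapidlyDecaying fun n => c (n + 1) := by
    intro c hc ρ hρ
    obtain ⟨B, hB⟩ := hc ρ hρ
    refine ⟨B, fun n => le_trans ?_ (hB (n + 1))⟩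
    gcongr
    omega
  have d1 := shift _ hdd
  have d2 := shift _ d1
  have d3 := shift _ d2
  have d3' := d3.derivCoeff
  refine ⟨_, _, fun z => d3.hasDerivAt z, fun z => ?_, ?_, ?_⟩
  · convert d3'.hasDerivAt z using 1
    -- The three leading zeros of `d` stand for coefficients of negative index, so lowering the
    -- shift by one is multiplication by `z`.
    have e2 : ∑' n, d (n + 2) * z ^ n = z * ∑' n, d (n + 3) * z ^ n := by
      rw [(d2.summable z).tsum_eq_zero_add, ← tsum_mul_left]
      have : d 2 = 0 := by rw [hd, odeCoeff]
      simp only [zero_add, this, zero_mul]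
      exact tsum_congr fun n => by ring_nf
    have e1 : ∑' n, d (n + 1) * z ^ n = z ^ 2 * ∑' n, d (n + 3) * z ^ n := by
      rw [(d1.summable z).tsum_eq_zero_add]
      have : d 1 = 0 := by rw [hd, odeCoeff]
      simp only [zero_add, this, zero_mul]
      rw [pow_two, mul_assoc, ← e2, ← tsum_mul_left]
      exact tsum_congr fun n => by ring_nf
    have e0 : ∑' n, d n * z ^ n = z ^ 3 * ∑' n, d (n + 3) * z ^ n := by
      rw [(hdd.summable z).tsum_eq_zero_add]
      have : d 0 = 0 := by rw [hd, odeCoeff]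
      simp only [this, zero_mul, zero_add]
      rw [pow_succ', mul_assoc, ← e1, ← tsum_mul_left]
      exact tsum_congr fun n => by ring_nf
    change (q₀ + q₁ * z + q₂ * z ^ 2 + q₃ * z ^ 3) * ∑' n, d (n + 3) * z ^ n = _
    have e : (q₀ + q₁ * z + q₂ * z ^ 2 + q₃ * z ^ 3) * ∑' n, d (n + 3) * z ^ n
        = q₀ * ∑' n, d (n + 3) * z ^ n + q₁ * ∑' n, d (n + 2) * z ^ n
          + q₂ * ∑' n, d (n + 1) * z ^ n + q₃ * ∑' n, d n * z ^ n := by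
      rw [e2, e1, e0]; ring
    rw [e, ← tsum_mul_left, ← tsum_mul_left, ← tsum_mul_left, ← tsum_mul_left,
      ← ((d3.summable z).mul_left q₀).tsum_add ((d2.summable z).mul_left q₁),
      ← (((d3.summable z).mul_left q₀).add ((d2.summable z).mul_left q₁)).tsum_add
        ((d1.summable z).mul_left q₂),
      ← ((((d3.summable z).mul_left q₀).add ((d2.summable z).mul_left q₁)).add
        ((d1.summable z).mul_left q₂)).tsum_add ((hdd.summable z).mul_left q₃)]
    refine tsum_congr fun n => ?_
    have hrec : d (n + 5) = (q₀ * d (n + 3) + q₁ * d (n + 2) + q₂ * d (n + 1) + q₃ * d n)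
          / ((n + 2) * (n + 1)) := by rw [hd, odeCoeff]
    have h1 : (n : ℂ) + 1 ≠ 0 := by exact_mod_cast Nat.succ_ne_zero n
    have h2 : (n : ℂ) + 2 ≠ 0 := by exact_mod_cast Nat.succ_ne_zero (n + 1)
    have hrec' : ((n : ℂ) + 2) * (n + 1) * d (n + 5)
        = q₀ * d (n + 3) + q₁ * d (n + 2) + q₂ * d (n + 1) + q₃ * d n := by
      rw [hrec]; field_simp
    have h5 : d (n + 1 + 1 + 1 + 1 + 1) = d (n + 5) := rfl
    have h6 : ((n : ℂ) + 1) * (((n + 1 : ℕ) + 1) * d (n + 1 + 1 + 1 + 1 + 1)) * z ^ n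
        = (((n : ℂ) + 2) * (n + 1) * d (n + 5)) * z ^ n := by
      rw [h5]; push_cast; ring
    rw [h6, hrec']; ring
  · change ∑' n, d (n + 3) * 0 ^ n = y₀
    rw [tsum_eq_single 0 (fun n hn => by simp [hn])]
    simp [hd, odeCoeff]
  · change ∑' n : ℕ, ((n : ℂ) + 1) * d (n + 4) * 0 ^ n = y₁
    rw [tsum_eq_single 0 (fun n hn => by simp [hn])]
    simp [hd, odeCoeff]

/-- The Cauchy problem for `y'' = μ² p_a y` has an entire solution. -/
theorem exists_entire_solution (a μ z₁ y₀ y₁ : ℂ) :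
    ∃ y y' : ℂ → ℂ, (∀ z, HasDerivAt y (y' z) z) ∧
      (∀ z, HasDerivAt y' (μ ^ 2 * (cubic a).eval z * y z) z) ∧ y z₁ = y₀ ∧ y' z₁ = y₁ := by
  -- The four coefficients are those of `μ ^ 2 * p_a` expanded in powers of `z - z₁`.
  obtain ⟨y, y', h1, h2, h3, h4⟩ := exists_entire_solution_zero
    (μ ^ 2 * ((z₁ - a) * (z₁ ^ 2 - 1))) (μ ^ 2 * ((z₁ ^ 2 - 1) + 2 * z₁ * (z₁ - a)))
    (μ ^ 2 * (2 * z₁ + (z₁ - a))) (μ ^ 2) y₀ y₁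
  refine ⟨fun z => y (z - z₁), fun z => y' (z - z₁), fun z => (h1 _).comp_sub_const z z₁,
    fun z => ?_, by simpa, by simpa⟩
  refine ((h2 _).comp_sub_const z z₁).congr_deriv ?_
  simp only [cubic, Polynomial.eval_mul, Polynomial.eval_sub, Polynomial.eval_X,
    Polynomial.eval_C, Polynomial.eval_pow, Polynomial.eval_one]
  ring


/-! ### Tail integrals in a right half-plane -/

/-- The right half-plane `Re ζ > x`. -/
def rightHalfPlane (x : ℝ) : Set ℂ := {ζ | x < ζ.re}

theorem isOpen_rightHalfPlane (x : ℝ) : IsOpen (rightHalfPlane x) :=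
  isOpen_lt continuous_const Complex.continuous_re

theorem convex_rightHalfPlane (x : ℝ) : Convex ℝ (rightHalfPlane x) :=
  convex_halfSpace_re_gt x

theorem integral_inv_add_sq {x : ℝ} (hx : 0 < x) :
    IntegrableOn (fun s : ℝ => 1 / (x + s) ^ 2) (Ioi 0) ∧
      ∫ s in Ioi (0 : ℝ), 1 / (x + s) ^ 2 = 1 / x := by
  have hd : ∀ s ∈ Ici (0 : ℝ), HasDerivAt (fun s : ℝ => -(x + s)⁻¹) (1 / (x + s) ^ 2) s := by
    intro s hs
    have h0 : x + s ≠ 0 := by have : 0 ≤ s := hs; positivity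
    have := (((hasDerivAt_id s).const_add x).inv h0).neg
    refine this.congr_deriv ?_
    simp; field_simp
  have ht : Tendsto (fun s : ℝ => -(x + s)⁻¹) atTop (𝓝 0) := by
    rw [← neg_zero]
    exact (tendsto_inv_atTop_zero.comp (tendsto_atTop_add_const_left _ x tendsto_id)).neg
  have hnn : ∀ s ∈ Ioi (0 : ℝ), 0 ≤ 1 / (x + s) ^ 2 := fun s _ => by positivity
  refine ⟨integrableOn_Ioi_deriv_of_nonneg' hd hnn ht, ?_⟩
  rw [integral_Ioi_of_hasDerivAt_of_nonneg' hd hnn ht]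
  simp

/-- The operator `f ↦ -∫₀^∞ e^{-κ s} f(ζ + s) ds`, a right inverse of `d/dζ - κ`. -/
noncomputable def tailIntegral (κ : ℝ) (f : ℂ → ℂ) (ζ : ℂ) : ℂ :=
  -∫ s in Ioi (0 : ℝ), (Real.exp (-(κ * s)) : ℂ) * f (ζ + s)

theorem sq_le_norm_add_sq {ζ : ℂ} (hζ : 0 < ζ.re) {s : ℝ} (hs : 0 ≤ s) :
    (ζ.re + s) ^ 2 ≤ ‖ζ + s‖ ^ 2 := by
  have : ζ.re + s ≤ ‖ζ + s‖ := by
    have := Complex.re_le_norm (ζ + s)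
    simpa using this
  gcongr

theorem norm_le_norm_add {ζ : ℂ} (hζ : 0 < ζ.re) {s : ℝ} (hs : 0 ≤ s) :
    ‖ζ‖ ^ 2 ≤ ‖ζ + s‖ ^ 2 := by
  rw [Complex.sq_norm, Complex.sq_norm, Complex.normSq_apply, Complex.normSq_apply]
  simp
  nlinarith

section tail

variable {κ M x₀ : ℝ} {f : ℂ → ℂ}

theorem norm_shift_le (hx₀ : 0 < x₀) (hM : ∀ ζ ∈ rightHalfPlane x₀, ‖f ζ‖ ≤ M / ‖ζ‖ ^ 2)
    (hM0 : 0 ≤ M) {ζ : ℂ} (hζ : ζ ∈ rightHalfPlane x₀) {s : ℝ} (hs : 0 ≤ s) :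
    ‖f (ζ + s)‖ ≤ M * (1 / (ζ.re + s) ^ 2) := by
  have hζ' : x₀ < ζ.re := hζ
  have h1 : ζ + s ∈ rightHalfPlane x₀ := by
    change x₀ < (ζ + s).re
    simp; linarith
  refine (hM _ h1).trans ?_
  rw [mul_one_div]
  have := sq_le_norm_add_sq (hx₀.trans hζ') hs
  have : 0 < ζ.re + s := by linarith
  gcongr

theorem continuousOn_shift (hf : DifferentiableOn ℂ f (rightHalfPlane x₀)) {ζ : ℂ}
    (hζ : ζ ∈ rightHalfPlane x₀) : ContinuousOn (fun s : ℝ => f (ζ + s)) (Ici 0) := by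
  refine hf.continuousOn.comp (by fun_prop) fun s hs => ?_
  have hs' : (0 : ℝ) ≤ s := hs
  have hζ' : x₀ < ζ.re := hζ
  change x₀ < (ζ + s).re
  simp; linarith

theorem exp_neg_le_one (hκ : 0 ≤ κ) {s : ℝ} (hs : 0 ≤ s) : Real.exp (-(κ * s)) ≤ 1 := by
  rw [Real.exp_le_one_iff]; nlinarith [mul_nonneg hκ hs]

theorem integrableOn_tail (hκ : 0 ≤ κ) (hx₀ : 0 < x₀)
    (hf : DifferentiableOn ℂ f (rightHalfPlane x₀))
    (hM : ∀ ζ ∈ rightHalfPlane x₀, ‖f ζ‖ ≤ M / ‖ζ‖ ^ 2) (hM0 : 0 ≤ M) {ζ : ℂ}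
    (hζ : ζ ∈ rightHalfPlane x₀) :
    IntegrableOn (fun s : ℝ => (Real.exp (-(κ * s)) : ℂ) * f (ζ + s)) (Ioi 0) := by
  have hζ' : x₀ < ζ.re := hζ
  refine Integrable.mono' ((integral_inv_add_sq (hx₀.trans hζ')).1.const_mul M) ?_ ?_
  · refine ContinuousOn.aestronglyMeasurable ?_ measurableSet_Ioi
    refine ContinuousOn.mul (by fun_prop) ((continuousOn_shift hf hζ).mono Ioi_subset_Ici_self)
  · filter_upwards [ae_restrict_mem measurableSet_Ioi] with s hs
    have hs' : (0 : ℝ) ≤ s := le_of_lt hs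
    rw [norm_mul, Complex.norm_real, Real.norm_of_nonneg (Real.exp_nonneg _)]
    calc _ ≤ 1 * ‖f (ζ + s)‖ := by gcongr; exact exp_neg_le_one hκ hs'
      _ ≤ _ := by rw [one_mul]; exact norm_shift_le hx₀ hM hM0 hζ hs'

/-- Without an exponential factor, convergence comes from the decay of `f` along the ray, at the
price of one power. For `κ > 0` the exponential is integrated instead, and the quadratic decay
survives. -/
theorem norm_tailIntegral_zero_le (hx₀ : 0 < x₀)
    (hM : ∀ ζ ∈ rightHalfPlane x₀, ‖f ζ‖ ≤ M / ‖ζ‖ ^ 2) (hM0 : 0 ≤ M) {ζ : ℂ}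
    (hζ : ζ ∈ rightHalfPlane x₀) : ‖tailIntegral 0 f ζ‖ ≤ M / ζ.re := by
  have hζ' : x₀ < ζ.re := hζ
  obtain ⟨h1, h2⟩ := integral_inv_add_sq (hx₀.trans hζ')
  rw [tailIntegral, norm_neg, div_eq_mul_one_div, ← h2, ← integral_const_mul]
  refine norm_integral_le_of_norm_le (h1.const_mul M) ?_
  filter_upwards [ae_restrict_mem measurableSet_Ioi] with s hs
  simpa using norm_shift_le hx₀ hM hM0 hζ (le_of_lt hs)

theorem norm_tailIntegral_le (hκ : 0 < κ) (hx₀ : 0 < x₀)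
    (hM : ∀ ζ ∈ rightHalfPlane x₀, ‖f ζ‖ ≤ M / ‖ζ‖ ^ 2) (hM0 : 0 ≤ M) {ζ : ℂ}
    (hζ : ζ ∈ rightHalfPlane x₀) : ‖tailIntegral κ f ζ‖ ≤ M / κ / ‖ζ‖ ^ 2 := by
  have hζ' : x₀ < ζ.re := hζ
  have h1 : IntegrableOn (fun s : ℝ => Real.exp (-κ * s)) (Ioi 0) :=
    exp_neg_integrableOn_Ioi 0 hκ
  have h2 : ∫ s in Ioi (0 : ℝ), Real.exp (-κ * s) = 1 / κ := by
    rw [integral_exp_mul_Ioi (by linarith)]; simp [neg_div, div_neg]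
  have : M / κ / ‖ζ‖ ^ 2 = M / ‖ζ‖ ^ 2 * (1 / κ) := by ring
  rw [tailIntegral, norm_neg, this, ← h2, ← integral_const_mul]
  refine norm_integral_le_of_norm_le (h1.const_mul _) ?_
  filter_upwards [ae_restrict_mem measurableSet_Ioi] with s hs
  have hs' : (0 : ℝ) ≤ s := le_of_lt hs
  rw [norm_mul, Complex.norm_real, Real.norm_of_nonneg (Real.exp_nonneg _), mul_comm, neg_mul]
  gcongr
  have h1 : ζ + s ∈ rightHalfPlane x₀ := by
    change x₀ < (ζ + s).re
    simp; linarith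
  refine (hM _ h1).trans ?_
  have h3 : 0 < ‖ζ‖ := (hx₀.trans hζ').trans_le (Complex.re_le_norm ζ)
  have := norm_le_norm_add (hx₀.trans hζ') hs'
  gcongr

/-- Cauchy's estimate turns the bound on `f` into an integrable majorant for `f'`, which permits
differentiation under the integral. Integrating the `s`-derivative of `e^{-κ s} f(ζ + s)` over the
ray then trades `f'` for `κ f` and the boundary value `f ζ`. -/
theorem hasDerivAt_tailIntegral (hκ : 0 ≤ κ) (hx₀ : 0 < x₀)
    (hf : DifferentiableOn ℂ f (rightHalfPlane x₀))
    (hM : ∀ ζ ∈ rightHalfPlane x₀, ‖f ζ‖ ≤ M / ‖ζ‖ ^ 2) (hM0 : 0 ≤ M) {ζ : ℂ}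
    (hζ : ζ ∈ rightHalfPlane x₀) :
    HasDerivAt (tailIntegral κ f) (κ * tailIntegral κ f ζ + f ζ) ζ := by
  have hζ' : x₀ < ζ.re := hζ
  -- Half the distance to the boundary: discs of radius `δ` about points of `ball ζ δ` still lie in
  -- the half-plane.
  set δ : ℝ := (ζ.re - x₀) / 2 with hδ
  have hδ0 : 0 < δ := by rw [hδ]; linarith
  have hsub : ∀ w ∈ Metric.ball ζ δ, x₀ + δ < w.re := by
    intro w hw
    have h1 := (Complex.abs_re_le_norm (w - ζ)).trans_lt (by simpa [dist_eq_norm] using hw)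
    rw [Complex.sub_re, abs_lt] at h1
    linarith [h1.1]
  have hmem : ∀ w ∈ Metric.ball ζ δ, ∀ s : ℝ, 0 ≤ s → w + s ∈ rightHalfPlane x₀ := by
    intro w hw s hs
    have := hsub w hw
    change x₀ < (w + s).re
    simp; linarith
  have hdf : ∀ w ∈ rightHalfPlane x₀, HasDerivAt f (deriv f w) w := fun w hw =>
    (hf.differentiableAt ((isOpen_rightHalfPlane x₀).mem_nhds hw)).hasDerivAt
  have hder : ∀ w ∈ Metric.ball ζ δ, ∀ s : ℝ, 0 ≤ s →
      ‖deriv f (w + s)‖ ≤ M * (1 / (x₀ + s) ^ 2) / δ := by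
    intro w hw s hs
    have hcb : ∀ u ∈ Metric.closedBall (w + s) δ, x₀ + s < u.re := by
      intro u hu
      have h1 := (Complex.abs_re_le_norm (u - (w + s))).trans (by simpa [dist_eq_norm] using hu)
      have h2 := hsub w hw
      rw [abs_le] at h1
      simp at h1
      linarith [h1.1]
    refine Complex.norm_deriv_le_of_forall_mem_sphere_norm_le hδ0 ?_ ?_
    · refine DifferentiableOn.diffContOnCl (hf.mono ?_)
      rw [closure_ball _ hδ0.ne']
      exact fun u hu => (by linarith [hcb u hu] : x₀ < u.re)
    · intro u hu
      have hu' := hcb u (Metric.sphere_subset_closedBall hu)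
      refine (hM u (by change x₀ < u.re; linarith)).trans ?_
      rw [mul_one_div]
      have : x₀ + s ≤ ‖u‖ := hu'.le.trans (Complex.re_le_norm u)
      gcongr
  have hbi : IntegrableOn (fun s : ℝ => M * (1 / (x₀ + s) ^ 2) / δ) (Ioi 0) :=
    ((integral_inv_add_sq hx₀).1.const_mul M).div_const δ
  have hcexp : Continuous fun s : ℝ => (Real.exp (-(κ * s)) : ℂ) := by fun_prop
  have hdf' : DifferentiableOn ℂ (deriv f) (rightHalfPlane x₀) :=
    hf.deriv (isOpen_rightHalfPlane x₀)
  have hbound : ∀ᵐ s ∂(volume.restrict (Ioi (0 : ℝ))), ∀ w ∈ Metric.ball ζ δ,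
      ‖(Real.exp (-(κ * s)) : ℂ) * deriv f (w + s)‖ ≤ M * (1 / (x₀ + s) ^ 2) / δ := by
    filter_upwards [ae_restrict_mem measurableSet_Ioi] with s hs w hw
    have hs' : (0 : ℝ) ≤ s := le_of_lt hs
    rw [norm_mul, Complex.norm_real, Real.norm_of_nonneg (Real.exp_nonneg _)]
    calc _ ≤ 1 * ‖deriv f (w + s)‖ := by gcongr; exact exp_neg_le_one hκ hs'
      _ ≤ _ := by rw [one_mul]; exact hder w hw s hs'
  have hζb : ζ ∈ Metric.ball ζ δ := Metric.mem_ball_self hδ0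
  have hmeas' : AEStronglyMeasurable (fun s : ℝ => (Real.exp (-(κ * s)) : ℂ) * deriv f (ζ + s))
      (volume.restrict (Ioi (0 : ℝ))) :=
    ContinuousOn.aestronglyMeasurable (hcexp.continuousOn.mul
        ((continuousOn_shift hdf' hζ).mono Ioi_subset_Ici_self)) measurableSet_Ioi
  have key := hasDerivAt_integral_of_dominated_loc_of_deriv_le (μ := volume.restrict (Ioi (0 : ℝ)))
    (F := fun w s => (Real.exp (-(κ * s)) : ℂ) * f (w + s))
    (F' := fun w s => (Real.exp (-(κ * s)) : ℂ) * deriv f (w + s)) (x₀ := ζ)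
    (Metric.ball_mem_nhds ζ hδ0) ?_ (integrableOn_tail hκ hx₀ hf hM hM0 hζ) hmeas' hbound hbi ?_
  · have hI := integrableOn_tail (κ := κ) hκ hx₀ hf hM hM0 hζ
    have hftc := integral_Ioi_of_hasDerivAt_of_tendsto (a := (0 : ℝ)) (m := (0 : ℂ))
      (f := fun s : ℝ => (Real.exp (-(κ * s)) : ℂ) * f (ζ + s))
      (f' := fun s : ℝ => (Real.exp (-(κ * s)) : ℂ) * deriv f (ζ + s)
        - κ * ((Real.exp (-(κ * s)) : ℂ) * f (ζ + s))) ?_ ?_ ?_ ?_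
    · rw [integral_sub key.1 (hI.const_mul _), integral_const_mul] at hftc
      refine (key.2.neg).congr_deriv ?_
      simp only [tailIntegral]
      simp at hftc
      push_cast at hftc ⊢
      linear_combination -hftc
    · exact (hcexp.continuousOn.mul (continuousOn_shift hf hζ)) 0 self_mem_Ici
    · intro s hs
      have h1 : HasDerivAt (fun s : ℝ => (Real.exp (-(κ * s)) : ℂ))
          ((Real.exp (-(κ * s)) * -κ : ℝ) : ℂ) s := by
        refine HasDerivAt.ofReal_comp ?_
        have := ((hasDerivAt_id s).const_mul κ).neg.exp
        simpa using this
      have h2 : HasDerivAt (fun s : ℝ => f (ζ + s)) (deriv f (ζ + s)) s := by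
        have h3 := (hdf (ζ + s) (hmem ζ hζb s (le_of_lt hs))).comp_const_add ζ (s : ℂ)
        exact h3.comp_ofReal
      refine (h1.mul h2).congr_deriv ?_
      push_cast
      ring
    · exact key.1.sub (hI.const_mul _)
    · have hlim : Tendsto (fun s : ℝ => M * (1 / (ζ.re + s) ^ 2)) atTop (𝓝 0) := by
        rw [← mul_zero M]
        refine Tendsto.const_mul M ?_
        simp only [one_div]
        refine tendsto_inv_atTop_zero.comp ?_
        exact (tendsto_pow_atTop two_ne_zero).comp
          (tendsto_atTop_add_const_left _ _ tendsto_id)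
      refine squeeze_zero_norm' ?_ hlim
      filter_upwards [eventually_ge_atTop 0] with s hs
      rw [norm_mul, Complex.norm_real, Real.norm_of_nonneg (Real.exp_nonneg _)]
      calc _ ≤ 1 * ‖f (ζ + s)‖ := by gcongr; exact exp_neg_le_one hκ hs
        _ ≤ _ := by rw [one_mul]; exact norm_shift_le hx₀ hM hM0 hζ hs
  · filter_upwards [Metric.ball_mem_nhds ζ hδ0] with w hw
    refine ContinuousOn.aestronglyMeasurable (hcexp.continuousOn.mul
        ((continuousOn_shift hf ?_).mono Ioi_subset_Ici_self)) measurableSet_Ioi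
    simpa using hmem w hw 0 le_rfl
  · filter_upwards [ae_restrict_mem measurableSet_Ioi] with s hs w hw
    exact ((hdf (w + s) (hmem w hw s (le_of_lt hs))).comp_add_const w (s : ℂ)).const_mul _

end tail


/-! ### The recessive solution by a Neumann series -/

/-- The terms of the Neumann series for the recessive solution of `W'' - 2 r W' = V W`. -/
noncomputable def neumannTerm (V : ℂ → ℂ) (r : ℝ) : ℕ → ℂ → ℂ
  | 0 => fun _ => 1
  | n + 1 => tailIntegral 0 (tailIntegral (2 * r) fun ζ => V ζ * neumannTerm V r n ζ)

/-- The left side of the equation is `(d/dζ - 2r)` applied to `W'`, so one step inverts `d/dζ - 2r`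
and then `d/dζ`. It costs a factor `C₀ / (2 r Re ζ)`, which is at most `1/4` because `Re ζ > x₁ ≥ 2
C₀ / r`. Regularity and size of a term are both needed to form the next one, hence the joint
induction. -/
theorem neumannTerm_spec {V : ℂ → ℂ} {r x₀ C₀ x₁ : ℝ} (hr : 0 < r) (hx₀ : 0 < x₀) (hC₀ : 0 ≤ C₀)
    (hV : DifferentiableOn ℂ V (rightHalfPlane x₀))
    (hVb : ∀ ζ ∈ rightHalfPlane x₀, ‖V ζ‖ ≤ C₀ / ‖ζ‖ ^ 2) (hx₁ : x₁ = x₀ + 2 * C₀ / r) (n : ℕ) :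
    DifferentiableOn ℂ (neumannTerm V r n) (rightHalfPlane x₁) ∧
    (∀ ζ ∈ rightHalfPlane x₁, ‖neumannTerm V r n ζ‖ ≤ (1 / 4) ^ n) ∧
    (∀ ζ ∈ rightHalfPlane x₁, HasDerivAt (neumannTerm V r (n + 1))
      (tailIntegral (2 * r) (fun ζ => V ζ * neumannTerm V r n ζ) ζ) ζ) ∧
    (∀ ζ ∈ rightHalfPlane x₁, HasDerivAt (tailIntegral (2 * r) fun ζ => V ζ * neumannTerm V r n ζ)
      (2 * r * tailIntegral (2 * r) (fun ζ => V ζ * neumannTerm V r n ζ) ζ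
        + V ζ * neumannTerm V r n ζ) ζ) ∧
    (∀ ζ ∈ rightHalfPlane x₁, ‖tailIntegral (2 * r) (fun ζ => V ζ * neumannTerm V r n ζ) ζ‖
      ≤ C₀ / (2 * r) * (1 / 4) ^ n / ‖ζ‖ ^ 2) ∧
    (∀ ζ ∈ rightHalfPlane x₁, ‖neumannTerm V r (n + 1) ζ‖ ≤ C₀ / (2 * r) * (1 / 4) ^ n / ζ.re) := by
  have hx₀₁ : x₀ ≤ x₁ := by rw [hx₁]; have : 0 ≤ 2 * C₀ / r := by positivity
                            linarith
  have hx₁0 : 0 < x₁ := hx₀.trans_le hx₀₁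
  have hsub : rightHalfPlane x₁ ⊆ rightHalfPlane x₀ := fun ζ hζ => hx₀₁.trans_lt hζ
  have step : ∀ n, DifferentiableOn ℂ (neumannTerm V r n) (rightHalfPlane x₁) →
      (∀ ζ ∈ rightHalfPlane x₁, ‖neumannTerm V r n ζ‖ ≤ (1 / 4) ^ n) →
      (∀ ζ ∈ rightHalfPlane x₁, HasDerivAt (neumannTerm V r (n + 1))
        (tailIntegral (2 * r) (fun ζ => V ζ * neumannTerm V r n ζ) ζ) ζ) ∧
      (∀ ζ ∈ rightHalfPlane x₁,
        HasDerivAt (tailIntegral (2 * r) fun ζ => V ζ * neumannTerm V r n ζ)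
        (2 * r * tailIntegral (2 * r) (fun ζ => V ζ * neumannTerm V r n ζ) ζ
          + V ζ * neumannTerm V r n ζ) ζ) ∧
      (∀ ζ ∈ rightHalfPlane x₁, ‖tailIntegral (2 * r) (fun ζ => V ζ * neumannTerm V r n ζ) ζ‖
        ≤ C₀ / (2 * r) * (1 / 4) ^ n / ‖ζ‖ ^ 2) ∧
      (∀ ζ ∈ rightHalfPlane x₁,
        ‖neumannTerm V r (n + 1) ζ‖ ≤ C₀ / (2 * r) * (1 / 4) ^ n / ζ.re) := by
    intro n hd hb
    have hfd : DifferentiableOn ℂ (fun ζ => V ζ * neumannTerm V r n ζ) (rightHalfPlane x₁) :=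
      (hV.mono hsub).mul hd
    have hfb : ∀ ζ ∈ rightHalfPlane x₁, ‖V ζ * neumannTerm V r n ζ‖
        ≤ C₀ * (1 / 4) ^ n / ‖ζ‖ ^ 2 := by
      intro ζ hζ
      rw [norm_mul, mul_div_right_comm]
      exact mul_le_mul (hVb ζ (hsub hζ)) (hb ζ hζ) (norm_nonneg _) (by positivity)
    have hM0 : 0 ≤ C₀ * (1 / 4 : ℝ) ^ n := by positivity
    have hX : ∀ ζ ∈ rightHalfPlane x₁,
        HasDerivAt (tailIntegral (2 * r) fun ζ => V ζ * neumannTerm V r n ζ)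
        (2 * r * tailIntegral (2 * r) (fun ζ => V ζ * neumannTerm V r n ζ) ζ
          + V ζ * neumannTerm V r n ζ) ζ := by
      intro ζ hζ
      have := hasDerivAt_tailIntegral (κ := 2 * r) (by positivity) hx₁0 hfd hfb hM0 hζ
      push_cast at this
      exact this
    have hXb : ∀ ζ ∈ rightHalfPlane x₁,
        ‖tailIntegral (2 * r) (fun ζ => V ζ * neumannTerm V r n ζ) ζ‖
        ≤ C₀ / (2 * r) * (1 / 4) ^ n / ‖ζ‖ ^ 2 := by
      intro ζ hζ
      refine (norm_tailIntegral_le (by positivity) hx₁0 hfb hM0 hζ).trans_eq ?_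
      ring
    have hXd : DifferentiableOn ℂ (tailIntegral (2 * r) fun ζ => V ζ * neumannTerm V r n ζ)
        (rightHalfPlane x₁) := fun ζ hζ => (hX ζ hζ).differentiableAt.differentiableWithinAt
    have hK0 : 0 ≤ C₀ / (2 * r) * (1 / 4) ^ n := by positivity
    refine ⟨fun ζ hζ => ?_, hX, hXb, fun ζ hζ => ?_⟩
    · have := hasDerivAt_tailIntegral (κ := 0) le_rfl hx₁0 hXd hXb hK0 hζ
      simpa [neumannTerm] using this
    · exact norm_tailIntegral_zero_le hx₁0 hXb hK0 hζ
  suffices h : DifferentiableOn ℂ (neumannTerm V r n) (rightHalfPlane x₁) ∧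
      ∀ ζ ∈ rightHalfPlane x₁, ‖neumannTerm V r n ζ‖ ≤ (1 / 4) ^ n from
    ⟨h.1, h.2, step n h.1 h.2⟩
  induction n with
  | zero => exact ⟨by simp only [neumannTerm]; fun_prop, fun ζ _ => by simp [neumannTerm]⟩
  | succ n ih =>
    obtain ⟨h1, -, -, h4⟩ := step n ih.1 ih.2
    refine ⟨fun ζ hζ => (h1 ζ hζ).differentiableAt.differentiableWithinAt, fun ζ hζ => ?_⟩
    refine (h4 ζ hζ).trans ?_
    have hre : x₁ < ζ.re := hζ
    rw [div_le_iff₀ (hx₁0.trans hre), pow_succ]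
    have h5 : C₀ / (2 * r) ≤ 1 / 4 * ζ.re := by
      have : 2 * C₀ / r ≤ ζ.re := by rw [hx₁] at hre; linarith
      calc C₀ / (2 * r) = 1 / 4 * (2 * C₀ / r) := by field_simp; norm_num
        _ ≤ _ := by gcongr
    calc _ ≤ 1 / 4 * ζ.re * (1 / 4) ^ n := by gcongr
      _ = _ := by ring

/-- The recessive solution in a right half-plane: if `V` is holomorphic and `O(|ζ|⁻²)`, then
`W'' - 2 r W' = V W` has a solution tending to `1` as `Re ζ → ∞`. -/
theorem exists_recessive {V : ℂ → ℂ} {r x₀ C₀ : ℝ} (hr : 0 < r) (hx₀ : 0 < x₀) (hC₀ : 0 ≤ C₀)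
    (hV : DifferentiableOn ℂ V (rightHalfPlane x₀))
    (hVb : ∀ ζ ∈ rightHalfPlane x₀, ‖V ζ‖ ≤ C₀ / ‖ζ‖ ^ 2) :
    ∃ (x₁ C : ℝ) (W X : ℂ → ℂ), x₀ ≤ x₁ ∧ 0 ≤ C ∧
      (∀ ζ ∈ rightHalfPlane x₁, HasDerivAt W (X ζ) ζ) ∧
      (∀ ζ ∈ rightHalfPlane x₁, HasDerivAt X (2 * r * X ζ + V ζ * W ζ) ζ) ∧
      (∀ ζ ∈ rightHalfPlane x₁, ‖W ζ - 1‖ ≤ 1 / 2) ∧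
      (∀ ζ ∈ rightHalfPlane x₁, ‖W ζ - 1‖ ≤ C / ζ.re) ∧
      (∀ ζ ∈ rightHalfPlane x₁, ‖X ζ‖ ≤ C / ‖ζ‖ ^ 2) := by
  set x₁ := x₀ + 2 * C₀ / r with hx₁
  have hx₀₁ : x₀ ≤ x₁ := by
    have : 0 ≤ 2 * C₀ / r := by positivity
    linarith
  have hx₁0 : 0 < x₁ := hx₀.trans_le hx₀₁
  have hspec := neumannTerm_spec hr hx₀ hC₀ hV hVb hx₁
  set w := neumannTerm V r
  set X : ℕ → ℂ → ℂ := fun n => tailIntegral (2 * r) fun ζ => V ζ * w n ζ with hXdef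
  have hgeo : Summable fun n : ℕ => (1 / 4 : ℝ) ^ n :=
    summable_geometric_of_lt_one (by norm_num) (by norm_num)
  have hgeo' : ∑' n : ℕ, (1 / 4 : ℝ) ^ n = 4 / 3 := by
    rw [tsum_geometric_of_lt_one (by norm_num) (by norm_num)]; norm_num
  have hgeo1 : ∑' n : ℕ, (1 / 4 : ℝ) ^ (n + 1) ≤ 1 / 2 := by
    simp only [pow_succ]; rw [tsum_mul_right, hgeo']; norm_num
  set K := C₀ / (2 * r) with hK
  have hK0 : 0 ≤ K := by positivity
  have hopen := isOpen_rightHalfPlane x₁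
  have hwd := fun n => (hspec n).1
  have hwb : ∀ n, ∀ ζ ∈ rightHalfPlane x₁, ‖w n ζ‖ ≤ (1 / 4) ^ n := fun n => (hspec n).2.1
  have hXd : ∀ n, DifferentiableOn ℂ (X n) (rightHalfPlane x₁) := fun n ζ hζ =>
    ((hspec n).2.2.2.1 ζ hζ).differentiableAt.differentiableWithinAt
  have hXb : ∀ n, ∀ ζ ∈ rightHalfPlane x₁, ‖X n ζ‖ ≤ K * (1 / 4) ^ n / ‖ζ‖ ^ 2 :=
    fun n => (hspec n).2.2.2.2.1
  have hXb' : ∀ n, ∀ ζ ∈ rightHalfPlane x₁, ‖X n ζ‖ ≤ K / x₁ ^ 2 * (1 / 4) ^ n := fun n ζ hζ => by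
    have h1 : x₁ ≤ ‖ζ‖ := (le_of_lt hζ).trans (Complex.re_le_norm ζ)
    calc ‖X n ζ‖ ≤ K * (1 / 4) ^ n / ‖ζ‖ ^ 2 := hXb n ζ hζ
      _ ≤ K * (1 / 4) ^ n / x₁ ^ 2 := by gcongr
      _ = K / x₁ ^ 2 * (1 / 4) ^ n := by ring
  have hwsum : ∀ ζ ∈ rightHalfPlane x₁, Summable fun n => w n ζ := fun ζ hζ =>
    Summable.of_norm_bounded hgeo fun n => hwb n ζ hζ
  have hXsum : ∀ ζ ∈ rightHalfPlane x₁, Summable fun n => X n ζ := fun ζ hζ =>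
    Summable.of_norm_bounded (hgeo.mul_left (K / x₁ ^ 2)) fun n => hXb' n ζ hζ
  have hW1 : ∀ ζ ∈ rightHalfPlane x₁, ∑' n, w n ζ - 1 = ∑' n, w (n + 1) ζ := fun ζ hζ => by
    rw [(hwsum ζ hζ).tsum_eq_zero_add]
    simp [w, neumannTerm]
  refine ⟨x₁, K * (4 / 3), fun ζ => ∑' n, w n ζ, fun ζ => ∑' n, X n ζ, hx₀₁, by positivity,
    fun ζ hζ => ?_, fun ζ hζ => ?_, fun ζ hζ => ?_, fun ζ hζ => ?_, fun ζ hζ => ?_⟩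
  · have h1 := Complex.hasSum_deriv_of_summable_norm hgeo hwd hopen hwb hζ
    have h2 := Complex.differentiableOn_tsum_of_summable_norm hgeo hwd hopen hwb
    refine (h2.differentiableAt (hopen.mem_nhds hζ)).hasDerivAt.congr_deriv ?_
    -- The constant zeroth term drops out, and the derivative of term `n + 1` is `X n`.
    rw [← h1.tsum_eq, h1.summable.tsum_eq_zero_add]
    have h0 : deriv (w 0) ζ = 0 := by
      simp only [w, neumannTerm]; exact deriv_const ζ 1
    rw [h0, zero_add]
    exact tsum_congr fun n => ((hspec n).2.2.1 ζ hζ).deriv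
  · have hu := hgeo.mul_left (K / x₁ ^ 2)
    have h1 := Complex.hasSum_deriv_of_summable_norm hu hXd hopen hXb' hζ
    have h2 := Complex.differentiableOn_tsum_of_summable_norm hu hXd hopen hXb'
    refine (h2.differentiableAt (hopen.mem_nhds hζ)).hasDerivAt.congr_deriv ?_
    rw [← h1.tsum_eq, ← tsum_mul_left, ← tsum_mul_left,
      ← ((hXsum ζ hζ).mul_left _).tsum_add ((hwsum ζ hζ).mul_left _)]
    exact tsum_congr fun n => ((hspec n).2.2.2.1 ζ hζ).deriv
  · rw [hW1 ζ hζ]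
    refine (tsum_of_norm_bounded (hgeo.comp_injective (add_left_injective 1)).hasSum
      fun n => hwb (n + 1) ζ hζ).trans hgeo1
  · rw [hW1 ζ hζ, mul_div_right_comm, ← hgeo', ← tsum_mul_left]
    refine tsum_of_norm_bounded (hgeo.mul_left _).hasSum fun n => ?_
    refine ((hspec n).2.2.2.2.2 ζ hζ).trans_eq ?_
    ring
  · rw [mul_div_right_comm, ← hgeo', ← tsum_mul_left]
    refine tsum_of_norm_bounded (hgeo.mul_left _).hasSum fun n => ?_
    refine (hXb n ζ hζ).trans_eq ?_
    ring


/-! ### Holomorphic inverses and a weak Koebe theorem -/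

section Inverse

variable {f : ℂ → ℂ} {U : Set ℂ}

theorem map_nhds_of_deriv_ne_zero (hU : IsOpen U) (hf : DifferentiableOn ℂ f U) {z : ℂ}
    (hz : z ∈ U) (h0 : deriv f z ≠ 0) : map f (𝓝 z) = 𝓝 (f z) := by
  have := (hf.analyticAt (hU.mem_nhds hz)).hasStrictDerivAt
  exact this.map_nhds_eq h0

theorem isOpen_image_of_deriv_ne_zero (hU : IsOpen U) (hf : DifferentiableOn ℂ f U)
    (h0 : ∀ z ∈ U, deriv f z ≠ 0) : IsOpen (f '' U) := by
  rw [isOpen_iff_mem_nhds]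
  rintro _ ⟨z, hz, rfl⟩
  rw [← map_nhds_of_deriv_ne_zero hU hf hz (h0 z hz)]
  exact image_mem_map (hU.mem_nhds hz)

theorem invFunOn_apply_image (hinj : InjOn f U) {z : ℂ} (hz : z ∈ U) :
    Function.invFunOn f U (f z) = z := hinj.leftInvOn_invFunOn hz

theorem hasDerivAt_invFunOn (hU : IsOpen U) (hf : DifferentiableOn ℂ f U)
    (h0 : ∀ z ∈ U, deriv f z ≠ 0) (hinj : InjOn f U) {ζ : ℂ} (hζ : ζ ∈ f '' U) :
    HasDerivAt (Function.invFunOn f U) (deriv f (Function.invFunOn f U ζ))⁻¹ ζ := by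
  obtain ⟨z, hz, rfl⟩ := hζ
  have hgz := invFunOn_apply_image hinj hz
  refine HasDerivAt.of_local_left_inverse (f := f) ?_ ?_ (h0 _ (by rwa [hgz])) ?_
  · rw [ContinuousAt, hgz, ← map_nhds_of_deriv_ne_zero hU hf hz (h0 z hz), tendsto_map'_iff]
    refine tendsto_id.congr' ?_
    filter_upwards [hU.mem_nhds hz] with w hw
    exact (invFunOn_apply_image hinj hw).symm
  · rw [hgz]
    exact (hf.differentiableAt (hU.mem_nhds hz)).hasDerivAt
  · filter_upwards [(isOpen_image_of_deriv_ne_zero hU hf h0).mem_nhds (mem_image_of_mem f hz)]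
      with w hw
    exact Function.invFunOn_eq hw

end Inverse

/-- A nonvanishing holomorphic function on a disc has a holomorphic square root. -/
theorem exists_sqrt_on_ball {S : ℂ → ℂ} {c : ℂ} {ρ : ℝ} (hρ : 0 < ρ)
    (hS : DifferentiableOn ℂ S (Metric.ball c ρ)) (h0 : ∀ z ∈ Metric.ball c ρ, S z ≠ 0)
    (hc : S c = 1) :
    ∃ F : ℂ → ℂ, (∀ z ∈ Metric.ball c ρ, F z ^ 2 = S z) ∧ F c = 1 ∧
      (∀ z ∈ Metric.ball c ρ, HasDerivAt F (F z * (deriv S z / S z / 2)) z) := by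
  have hball : IsOpen (Metric.ball c ρ) := Metric.isOpen_ball
  have hcm : c ∈ Metric.ball c ρ := Metric.mem_ball_self hρ
  have hSd : ∀ z ∈ Metric.ball c ρ, HasDerivAt S (deriv S z) z := fun z hz =>
    (hS.differentiableAt (hball.mem_nhds hz)).hasDerivAt
  -- `L` is a logarithm of `S`: a primitive of `S' / S` vanishing at `c`.
  obtain ⟨L, hLc, hL⟩ := ((hS.deriv hball).div hS h0).isExactOn_ball.with_val_at c 0
  have hconst : ∀ z ∈ Metric.ball c ρ, S z * Complex.exp (-L z) = 1 := by
    have hd : ∀ z ∈ Metric.ball c ρ, HasDerivAt (fun z => S z * Complex.exp (-L z)) 0 z := by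
      intro z hz
      refine ((hSd z hz).mul (hL z hz).neg.cexp).congr_deriv ?_
      have := h0 z hz
      simp only [Pi.div_apply, Pi.neg_apply]
      field_simp
      ring
    intro z hz
    have hpc : IsPreconnected (Metric.ball c ρ) := (convex_ball c ρ).isPreconnected
    have h1 := hball.is_const_of_deriv_eq_zero hpc
      (fun z hz => (hd z hz).differentiableAt.differentiableWithinAt)
      (fun z hz => (hd z hz).deriv) hz hcm
    simpa [hc, hLc] using h1
  refine ⟨fun z => Complex.exp (L z / 2), fun z hz => ?_, by simp [hLc], fun z hz => ?_⟩
  · have h1 := hconst z hz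
    rw [Complex.exp_neg, mul_inv_eq_one₀ (Complex.exp_ne_zero _)] at h1
    rw [h1, ← Complex.exp_nat_mul]
    congr 1
    push_cast
    ring
  · exact ((hL z hz).div_const 2).cexp

/-- A weak form of Koebe's one-quarter theorem: a value omitted by an injective holomorphic
function on a disc is not close to the value at the centre. -/
theorem koebe_weak {f : ℂ → ℂ} {c w : ℂ} {ρ : ℝ} (hρ : 0 < ρ)
    (hf : DifferentiableOn ℂ f (Metric.ball c ρ)) (hinj : InjOn f (Metric.ball c ρ))
    (hd0 : ∀ z ∈ Metric.ball c ρ, deriv f z ≠ 0) (hw : w ∉ f '' Metric.ball c ρ) :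
    ρ * ‖deriv f c‖ ≤ 40 * ‖w - f c‖ := by
  set U := Metric.ball c ρ with hUdef
  have hU : IsOpen U := Metric.isOpen_ball
  have hcm : c ∈ U := Metric.mem_ball_self hρ
  have himg := isOpen_image_of_deriv_ne_zero hU hf hd0
  -- Replacing `w` by the omitted value nearest to `f c` puts the whole disc of radius `d` about `f
  -- c` inside the image.
  obtain ⟨w', hw', hdist⟩ := himg.isClosed_compl.exists_infDist_eq_dist ⟨w, hw⟩ (f c)
  set d := ‖w' - f c‖ with hd
  have hdw : d ≤ ‖w - f c‖ := by
    rw [hd, ← dist_eq_norm, ← dist_eq_norm, dist_comm, ← hdist, dist_comm w]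
    exact Metric.infDist_le_dist_of_mem hw
  have hne : ∀ z ∈ U, f z - w' ≠ 0 := fun z hz h => hw' ⟨z, hz, sub_eq_zero.1 h⟩
  have hc0 : f c - w' ≠ 0 := hne c hcm
  have hd0' : 0 < d := by rw [hd, norm_pos_iff, ← neg_sub, neg_ne_zero]; exact hc0
  have hballsub : Metric.ball (f c) d ⊆ f '' U := by
    intro v hv
    by_contra hv'
    have h1 := Metric.infDist_le_dist_of_mem (x := f c) (s := (f '' U)ᶜ) hv'
    rw [hdist, dist_comm, dist_eq_norm, dist_comm] at h1
    rw [Metric.mem_ball] at hv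
    linarith
  set S : ℂ → ℂ := fun z => (f z - w') / (f c - w') with hSdef
  have hSd : DifferentiableOn ℂ S U := (hf.sub_const w').div_const _
  obtain ⟨F, hF2, hFc, hFd⟩ := exists_sqrt_on_ball hρ hSd
    (fun z hz => div_ne_zero (hne z hz) hc0) (div_self hc0)
  have hS1 : ∀ z, ‖S z - 1‖ = ‖f z - f c‖ / d := by
    intro z
    have : S z - 1 = (f z - f c) / (f c - w') := by
      simp only [hSdef]; field_simp; ring
    rw [this, norm_div, hd, norm_sub_rev w']
  -- the component of `F` near `c` takes values in the right half-plane
  set g := Function.invFunOn f U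
  set N := g '' Metric.ball (f c) d with hN
  have hNpc : IsPreconnected N := by
    refine (convex_ball (f c) d).isPreconnected.image g fun v hv => ?_
    exact (hasDerivAt_invFunOn hU hf hd0 hinj (hballsub hv)).continuousAt.continuousWithinAt
  have hNU : N ⊆ U := by
    rintro _ ⟨v, hv, rfl⟩
    exact Function.invFunOn_mem (hballsub hv)
  have hmemN : ∀ z ∈ U, ‖S z - 1‖ < 1 → z ∈ N := by
    intro z hz h
    rw [hS1, div_lt_one hd0'] at h
    exact ⟨f z, by rwa [Metric.mem_ball, dist_eq_norm], invFunOn_apply_image hinj hz⟩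
  have hFre : ∀ z ∈ N, (F z).re ≠ 0 := by
    intro z hz h0
    have h1 : ‖S z - 1‖ < 1 := by
      obtain ⟨v, hv, rfl⟩ := hz
      have : f (g v) = v := Function.invFunOn_eq (hballsub hv)
      rw [hS1, div_lt_one hd0', this]
      rwa [Metric.mem_ball, dist_eq_norm] at hv
    have h2 := (Complex.abs_re_le_norm _).trans_lt h1
    rw [← hF2 z (hNU hz), pow_two] at h2
    simp [h0] at h2
    rw [abs_lt] at h2
    nlinarith [h2.1, mul_self_nonneg (F z).im]
  have hFpos : ∀ z ∈ N, 0 < (F z).re := by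
    intro z hz
    by_contra hneg
    have hcN : c ∈ N := hmemN c hcm (by rw [hS1]; simp)
    have hcont : ContinuousOn (fun z => (F z).re) N := fun v hv =>
      (Complex.continuous_re.continuousAt.comp
        (hFd v (hNU hv)).continuousAt).continuousWithinAt
    obtain ⟨v, hv, hv0⟩ := hNpc.intermediate_value hz hcN hcont
      (show (0 : ℝ) ∈ Icc (F z).re (F c).re from ⟨not_lt.1 hneg, by simp [hFc]⟩)
    exact hFre v hv hv0
  -- A value of `F` within `2/5` of `-1` would give `‖S z - 1‖ < (2/5) * (12/5) < 1`. Injectivity of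
  -- `f` then places `z` in `N`, where `F` has positive real part, which is impossible near `-1`.
  have homit : ∀ z ∈ U, (2 / 5 : ℝ) ≤ ‖F z + 1‖ := by
    intro z hz
    by_contra hlt
    push Not at hlt
    have h1 : ‖S z - 1‖ < 1 := by
      have h2 : S z - 1 = (F z + 1) * ((F z + 1) - 2) := by rw [← hF2 z hz]; ring
      have h3 : ‖(F z + 1) - 2‖ ≤ 12 / 5 := by
        refine (norm_sub_le _ _).trans ?_
        have : ‖(2 : ℂ)‖ = 2 := by simp
        linarith
      rw [h2, norm_mul]
      nlinarith [norm_nonneg (F z + 1), norm_nonneg ((F z + 1) - 2)]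
    have h2 := hFpos z (hmemN z hz h1)
    have h3 := (Complex.re_le_norm (F z + 1)).trans_lt hlt
    simp at h3
    linarith
  have hF1 : ∀ z ∈ U, F z + 1 ≠ 0 := fun z hz h => by
    have := homit z hz
    rw [h, norm_zero] at this
    norm_num at this
  have hQd : ∀ z ∈ U, HasDerivAt (fun z => (F z + 1)⁻¹)
      (-(F z * (deriv S z / S z / 2)) / (F z + 1) ^ 2) z := fun z hz =>
    ((hFd z hz).add_const 1).inv (hF1 z hz)
  -- The bounded function `1 / (F + 1)` has derivative of modulus `‖deriv f c‖ / (8 d)` at `c`.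
  -- Cauchy's bound is `(5/2) / (ρ/2) = 5 / ρ`, whence the constant `40`.
  have hcauchy := Complex.norm_deriv_le_of_forall_mem_sphere_norm_le (c := c) (R := ρ / 2)
    (f := fun z => (F z + 1)⁻¹) (C := 5 / 2) (by positivity) ?_ ?_
  · have hSc : deriv S c = deriv f c / (f c - w') := by
      simp only [hSdef]
      rw [deriv_div_const, deriv_sub_const]
    have hScc : S c = 1 := div_self hc0
    have h2 : -((1 : ℂ) * (deriv f c / (f c - w') / 1 / 2)) / (1 + 1) ^ 2
        = -(deriv f c / (f c - w') / 8) := by ring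
    rw [(hQd c hcm).deriv, hFc, hScc, hSc, h2, norm_neg, norm_div, norm_div, norm_sub_rev,
      ← hd] at hcauchy
    have h3 : ‖(8 : ℂ)‖ = 8 := by simp
    rw [h3, div_div, div_le_div_iff₀ (by positivity) (by positivity)] at hcauchy
    nlinarith
  · refine DifferentiableOn.diffContOnCl ?_
    rw [closure_ball _ (by positivity)]
    intro z hz
    exact (hQd z (Metric.closedBall_subset_ball (by linarith) hz)).differentiableAt
      |>.differentiableWithinAt
  · intro z hz
    have hzU : z ∈ U := Metric.sphere_subset_closedBall.trans
      (Metric.closedBall_subset_ball (by linarith)) hz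
    rw [norm_inv]
    have := homit z hzU
    have h5 : (5 / 2 : ℝ) = (2 / 5 : ℝ)⁻¹ := by norm_num
    rw [h5]
    exact inv_anti₀ (by norm_num) this


/-! ### The cubic and the error-control coefficient -/

theorem eval_cubic (a z : ℂ) : (cubic a).eval z = (z - a) * (z - 1) * (z + 1) := by
  simp only [cubic, Polynomial.eval_mul, Polynomial.eval_sub, Polynomial.eval_X,
    Polynomial.eval_C, Polynomial.eval_pow, Polynomial.eval_one]
  ring

theorem eval_derivative_cubic (a z : ℂ) : (cubic a).derivative.eval z =
    (z - 1) * (z + 1) + (z - a) * (z + 1) + (z - a) * (z - 1) := by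
  simp [cubic]
  ring

theorem eval_derivative_derivative_cubic (a z : ℂ) : (cubic a).derivative.derivative.eval z =
    2 * ((z - a) + (z - 1) + (z + 1)) := by
  simp [cubic]
  ring

theorem hasDerivAt_cubic (a z : ℂ) :
    HasDerivAt (fun z => (cubic a).eval z) ((cubic a).derivative.eval z) z :=
  (cubic a).hasDerivAt z

theorem eval_cubic_eq_zero_iff {a z : ℂ} : (cubic a).eval z = 0 ↔ z ∈ turningPoints a := by
  rw [eval_cubic, mul_eq_zero, mul_eq_zero, sub_eq_zero, sub_eq_zero, ← eq_neg_iff_add_eq_zero]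
  simp only [turningPoints, mem_insert_iff, mem_singleton_iff]
  tauto

theorem eval_derivative_cubic_ne_zero {a t : ℂ} (h1 : a ≠ 1) (h2 : a ≠ -1)
    (ht : (cubic a).eval t = 0) : (cubic a).derivative.eval t ≠ 0 := by
  rw [eval_cubic_eq_zero_iff] at ht
  rw [eval_derivative_cubic]
  rcases ht with rfl | rfl | ht
  · have : (-1 : ℂ) - a ≠ 0 := sub_ne_zero.2 h2.symm
    simpa using ⟨this, by norm_num⟩
  · have : (1 : ℂ) - a ≠ 0 := sub_ne_zero.2 h1.symm
    norm_num
    exact this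
  · rw [mem_singleton_iff] at ht
    subst ht
    have h3 : t - 1 ≠ 0 := sub_ne_zero.2 h1
    have h4 : t + 1 ≠ 0 := by
      rw [← sub_neg_eq_add]; exact sub_ne_zero.2 h2
    simpa using ⟨h3, h4⟩

/-- The coefficient `5/16 · p_a'² / p_a³ - p_a'' / (4 p_a²)`. -/
noncomputable def errorCoeff (a z : ℂ) : ℂ :=
  (5 / 16 : ℂ) * ((cubic a).derivative.eval z ^ 2 / (cubic a).eval z ^ 3)
      - (cubic a).derivative.derivative.eval z / (4 * (cubic a).eval z ^ 2)

theorem errorDensity_eq (a z : ℂ) :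
    errorDensity a z = ‖errorCoeff a z‖ * Real.sqrt ‖(cubic a).eval z‖ := rfl

/-- In terms of the reciprocals of `z - a`, `z - 1`, `z + 1` the coefficient is a homogeneous
polynomial of degree five. The numerical factor obtained is `(5/16) * 9 + (1/2) * 3 = 69/16 ≤ 5`. -/
theorem norm_errorCoeff_le {a z : ℂ} {δ : ℝ} (hδ : 0 < δ)
    (h : ∀ t ∈ turningPoints a, δ ≤ dist z t) : ‖errorCoeff a z‖ ≤ 5 / δ ^ 5 := by
  have ha : δ ≤ ‖z - a‖ := by rw [← dist_eq_norm]; exact h a (by simp [turningPoints])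
  have h1 : δ ≤ ‖z - 1‖ := by rw [← dist_eq_norm]; exact h 1 (by simp [turningPoints])
  have h2 : δ ≤ ‖z + 1‖ := by
    rw [← sub_neg_eq_add, ← dist_eq_norm]; exact h (-1) (by simp [turningPoints])
  rw [errorCoeff, eval_cubic, eval_derivative_cubic, eval_derivative_derivative_cubic]
  set u := z - a
  set v := z - 1
  set w := z + 1
  have hu : u ≠ 0 := norm_pos_iff.1 (hδ.trans_le ha)
  have hv : v ≠ 0 := norm_pos_iff.1 (hδ.trans_le h1)
  have hw : w ≠ 0 := norm_pos_iff.1 (hδ.trans_le h2)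
  have hu' : ‖u⁻¹‖ ≤ δ⁻¹ := by rw [norm_inv]; exact inv_anti₀ hδ ha
  have hv' : ‖v⁻¹‖ ≤ δ⁻¹ := by rw [norm_inv]; exact inv_anti₀ hδ h1
  have hw' : ‖w⁻¹‖ ≤ δ⁻¹ := by rw [norm_inv]; exact inv_anti₀ hδ h2
  have e : (5 / 16 : ℂ) * ((v * w + u * w + u * v) ^ 2 / (u * v * w) ^ 3)
      - 2 * (u + v + w) / (4 * (u * v * w) ^ 2)
      = (5 / 16 : ℂ) * ((u⁻¹ + v⁻¹ + w⁻¹) ^ 2 * (u⁻¹ * v⁻¹ * w⁻¹))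
        - (1 / 2 : ℂ) * ((v⁻¹ * w⁻¹ + u⁻¹ * w⁻¹ + u⁻¹ * v⁻¹) * (u⁻¹ * v⁻¹ * w⁻¹)) := by
    field_simp
    ring
  have hprod : ‖u⁻¹ * v⁻¹ * w⁻¹‖ ≤ δ⁻¹ * δ⁻¹ * δ⁻¹ := by
    rw [norm_mul, norm_mul]; gcongr
  have hsum : ‖u⁻¹ + v⁻¹ + w⁻¹‖ ≤ δ⁻¹ + δ⁻¹ + δ⁻¹ :=
    (norm_add₃_le).trans (by gcongr)
  have hsum2 : ‖v⁻¹ * w⁻¹ + u⁻¹ * w⁻¹ + u⁻¹ * v⁻¹‖ ≤ δ⁻¹ * δ⁻¹ + δ⁻¹ * δ⁻¹ + δ⁻¹ * δ⁻¹ := by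
    refine (norm_add₃_le).trans ?_
    rw [norm_mul, norm_mul, norm_mul]; gcongr
  rw [e]
  refine (norm_sub_le _ _).trans ?_
  have n1 : ‖(5 / 16 : ℂ)‖ = 5 / 16 := by norm_num
  have n2 : ‖(1 / 2 : ℂ)‖ = 1 / 2 := by norm_num
  rw [norm_mul, norm_mul (_ ^ 2), norm_mul (1 / 2 : ℂ), norm_mul (_ + _), n1, n2, norm_pow]
  calc _ ≤ 5 / 16 * ((δ⁻¹ + δ⁻¹ + δ⁻¹) ^ 2 * (δ⁻¹ * δ⁻¹ * δ⁻¹))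
        + 1 / 2 * ((δ⁻¹ * δ⁻¹ + δ⁻¹ * δ⁻¹ + δ⁻¹ * δ⁻¹) * (δ⁻¹ * δ⁻¹ * δ⁻¹)) := by
        gcongr
    _ = 69 / 16 / δ ^ 5 := by field_simp; ring
    _ ≤ _ := by gcongr; norm_num

/-- Beyond this radius the cubic is comparable to `z³`. -/
noncomputable def farRadius (a : ℂ) : ℝ := 24 * (1 + ‖a‖)

theorem one_le_farRadius (a : ℂ) : 1 ≤ farRadius a := by
  have := norm_nonneg a
  rw [farRadius]; linarith

section Far

variable {a z : ℂ}

theorem norm_turningPoint_le {t : ℂ} (ht : t ∈ turningPoints a) : ‖t‖ ≤ 1 + ‖a‖ := by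
  have := norm_nonneg a
  rcases ht with rfl | rfl | ht
  · simp
  · simp
  · rw [mem_singleton_iff] at ht
    rw [ht]; linarith

theorem norm_turningPoint_le_of_far (hz : farRadius a ≤ ‖z‖) {t : ℂ} (ht : t ∈ turningPoints a) :
    ‖t‖ ≤ ‖z‖ / 24 := by
  have := norm_turningPoint_le ht
  rw [farRadius] at hz
  linarith

theorem half_norm_le_of_far (hz : farRadius a ≤ ‖z‖) {t : ℂ} (ht : t ∈ turningPoints a) :
    ‖z‖ / 2 ≤ ‖z - t‖ := by
  have h1 := norm_turningPoint_le_of_far hz ht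
  have h2 := norm_sub_norm_le z t
  have := norm_nonneg z
  linarith

theorem norm_errorCoeff_le_of_far (hz : farRadius a ≤ ‖z‖) :
    ‖errorCoeff a z‖ ≤ 160 / ‖z‖ ^ 5 := by
  have h0 : 0 < ‖z‖ := by linarith [one_le_farRadius a]
  refine (norm_errorCoeff_le (δ := ‖z‖ / 2) (by positivity) fun t ht => ?_).trans_eq ?_
  · rw [dist_eq_norm]; exact half_norm_le_of_far hz ht
  · field_simp; norm_num

/-- The difference is half the sum of `t / (z - t)` over the turning points, each term being at most
`1/12`. The closeness to `3/2` enters the convexity computation in `sq_le_add_of_far`. -/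
theorem norm_logDeriv_cubic_sub_le (hz : farRadius a ≤ ‖z‖) :
    ‖z * (cubic a).derivative.eval z / (2 * (cubic a).eval z) - 3 / 2‖ ≤ 1 / 8 := by
  have h0 : 0 < ‖z‖ := by linarith [one_le_farRadius a]
  have ht : ∀ t ∈ turningPoints a, ‖t / (z - t)‖ ≤ 1 / 12 := by
    intro t ht
    have h1 := half_norm_le_of_far hz ht
    have h2 := norm_turningPoint_le_of_far hz ht
    rw [norm_div, div_le_iff₀ (by linarith)]
    linarith
  have hne : ∀ t ∈ turningPoints a, z - t ≠ 0 := fun t ht => by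
    have h1 := half_norm_le_of_far hz ht
    rw [← norm_pos_iff]; linarith
  have ma : a ∈ turningPoints a := by simp [turningPoints]
  have m1 : 1 ∈ turningPoints a := by simp [turningPoints]
  have m2 : -1 ∈ turningPoints a := by simp [turningPoints]
  have na := hne a ma
  have n1 := hne 1 m1
  have n2 := hne (-1) m2
  have e : z * (cubic a).derivative.eval z / (2 * (cubic a).eval z) - 3 / 2
      = (1 / 2) * (a / (z - a) + 1 / (z - 1) + (-1) / (z - -1)) := by
    rw [sub_neg_eq_add] at n2
    rw [eval_cubic, eval_derivative_cubic, sub_neg_eq_add]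
    field_simp
    ring
  rw [e, norm_mul]
  have := norm_add₃_le (a := a / (z - a)) (b := 1 / (z - 1)) (c := (-1) / (z - -1))
  have n : ‖(1 / 2 : ℂ)‖ = 1 / 2 := by norm_num
  rw [n]
  linarith [ht a ma, ht 1 m1, ht (-1) m2]

theorem norm_cubic_le_of_far (hz : farRadius a ≤ ‖z‖) :
    ‖(cubic a).eval z‖ ≤ 2 * ‖z‖ ^ 3 := by
  have hb : ∀ t ∈ turningPoints a, ‖z - t‖ ≤ 25 / 24 * ‖z‖ := fun t ht => by
    have h2 := norm_turningPoint_le_of_far hz ht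
    have := norm_sub_le z t
    linarith
  rw [eval_cubic, norm_mul, norm_mul]
  have h1 := hb a (by simp [turningPoints])
  have h2 := hb 1 (by simp [turningPoints])
  have h3 := hb (-1) (by simp [turningPoints])
  rw [sub_neg_eq_add] at h3
  calc _ ≤ (25 / 24 * ‖z‖) * (25 / 24 * ‖z‖) * (25 / 24 * ‖z‖) := by gcongr
    _ = (25 / 24) ^ 3 * ‖z‖ ^ 3 := by ring
    _ ≤ _ := by gcongr; norm_num

end Far

/-! ### Growth of the inverse of `h` -/

/-- An integral bound for functions growing quadratically between any two points. -/
theorem lintegral_inv_le {S : Set ℝ} (hS : MeasurableSet S) {M : ℝ → ℝ} (h1 : ∀ s ∈ S, 1 ≤ M s)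
    (h2 : ∀ s ∈ S, ∀ s' ∈ S, 5 / 4 * (s - s') ^ 2 ≤ M s + M s') :
    ∫⁻ s in S, ENNReal.ofReal (1 / M s) ≤ ENNReal.ofReal (4 * Real.pi) := by
  rcases S.eq_empty_or_nonempty with rfl | hne
  · simp
  have hne' : (M '' S).Nonempty := hne.image M
  have hbdd : BddBelow (M '' S) := ⟨1, by rintro _ ⟨s, hs, rfl⟩; exact h1 s hs⟩
  have hinf : 1 ≤ sInf (M '' S) := le_csInf hne' (by rintro _ ⟨s, hs, rfl⟩; exact h1 s hs)
  -- The infimum of `M` need not be attained; a point within a factor two of it is enough. It gives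
  -- `5/4 * (s - s₀) ^ 2 ≤ 3 * M s`, so `1 + (s - s₀) ^ 2 ≤ 17/5 * M s`.
  obtain ⟨_, ⟨s₀, hs₀, rfl⟩, hlt⟩ := exists_lt_of_csInf_lt hne'
    (show sInf (M '' S) < 2 * sInf (M '' S) by linarith)
  have hb : ∀ s ∈ S, 1 / M s ≤ 4 * (1 + (s - s₀) ^ 2)⁻¹ := by
    intro s hs
    have h3 := h2 s hs s₀ hs₀
    have h4 : sInf (M '' S) ≤ M s := csInf_le hbdd ⟨s, hs, rfl⟩
    have h5 := h1 s hs
    rw [← div_eq_mul_inv, div_le_div_iff₀ (by linarith) (by positivity)]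
    nlinarith [sq_nonneg (s - s₀)]
  calc ∫⁻ s in S, ENNReal.ofReal (1 / M s)
      ≤ ∫⁻ s in S, ENNReal.ofReal (4 * (1 + (s - s₀) ^ 2)⁻¹) :=
        setLIntegral_mono' hS fun s hs => ENNReal.ofReal_le_ofReal (hb s hs)
    _ ≤ ∫⁻ s, ENNReal.ofReal (4 * (1 + (s - s₀) ^ 2)⁻¹) := setLIntegral_le_lintegral _ _
    _ = ∫⁻ s, ENNReal.ofReal (4 * (1 + s ^ 2)⁻¹) :=
        lintegral_sub_right_eq_self (fun s => ENNReal.ofReal (4 * (1 + s ^ 2)⁻¹)) s₀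
    _ = ENNReal.ofReal (4 * Real.pi) := by
        rw [← ofReal_integral_eq_lintegral_ofReal (integrable_inv_one_add_sq.const_mul 4)
          (Eventually.of_forall fun s => by positivity), integral_const_mul,
          integral_univ_inv_one_add_sq]


namespace IsCanonicalBranch

variable {a : ℂ} {θ : ℝ} {D : Set ℂ} {h : ℂ → ℂ}

/-- At a zero of `p_a` in `D` the derivative `h'` vanishes, and differentiating `(h')² = e^{2iθ}
p_a` forces `p_a' = 0` there as well. This contradicts simplicity of the zeros. -/
theorem cubic_ne_zero (hb : IsCanonicalBranch a θ D h) (h1 : a ≠ 1) (h2 : a ≠ -1) :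
    ∀ z ∈ D, (cubic a).eval z ≠ 0 := by
  intro z hz hp
  have hd1 : HasDerivAt (fun z => deriv h z ^ 2) (2 * deriv h z * deriv (deriv h) z) z := by
    have := ((hb.differentiableOn.deriv hb.isOpen).differentiableAt
      (hb.isOpen.mem_nhds hz)).hasDerivAt.fun_pow 2
    simpa using this
  have hd2 := (hasDerivAt_cubic a z).const_mul (Complex.exp (Complex.I * θ) ^ 2)
  have heq : (fun z => deriv h z ^ 2) =ᶠ[𝓝 z]
      fun z => Complex.exp (Complex.I * θ) ^ 2 * (cubic a).eval z := by
    filter_upwards [hb.isOpen.mem_nhds hz] with w hw using hb.deriv_sq w hw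
  have h3 := (hd2.congr_of_eventuallyEq heq).unique hd1
  have h4 : deriv h z = 0 := by
    have := hb.deriv_sq z hz
    rw [hp, mul_zero] at this
    exact pow_eq_zero_iff two_ne_zero |>.1 this
  rw [h4, mul_zero, zero_mul] at h3
  exact (mul_ne_zero (pow_ne_zero _ (Complex.exp_ne_zero _))
    (eval_derivative_cubic_ne_zero h1 h2 hp)) h3

variable (hb : IsCanonicalBranch a θ D h) (hp : ∀ z ∈ D, (cubic a).eval z ≠ 0)
include hb hp

theorem deriv_ne_zero : ∀ z ∈ D, deriv h z ≠ 0 := by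
  intro z hz h0
  have := hb.deriv_sq z hz
  rw [h0, zero_pow two_ne_zero] at this
  exact (mul_ne_zero (pow_ne_zero 2 (Complex.exp_ne_zero _)) (hp z hz)) this.symm

omit hp in
theorem norm_deriv_sq {z : ℂ} (hz : z ∈ D) : ‖deriv h z‖ ^ 2 = ‖(cubic a).eval z‖ := by
  rw [← norm_pow, hb.deriv_sq z hz, norm_mul, norm_pow, mul_comm Complex.I,
    Complex.norm_exp_ofReal_mul_I]
  simp

omit hp in
theorem norm_deriv {z : ℂ} (hz : z ∈ D) : ‖deriv h z‖ = Real.sqrt ‖(cubic a).eval z‖ := by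
  rw [← hb.norm_deriv_sq hz, Real.sqrt_sq (norm_nonneg _)]

omit hp in
theorem hasDerivAt {z : ℂ} (hz : z ∈ D) : HasDerivAt h (deriv h z) z :=
  (hb.differentiableOn.differentiableAt (hb.isOpen.mem_nhds hz)).hasDerivAt

theorem hasDerivAt_deriv {z : ℂ} (hz : z ∈ D) : HasDerivAt (deriv h)
    (deriv h z * ((cubic a).derivative.eval z / (2 * (cubic a).eval z))) z := by
  have hd0 := ((hb.differentiableOn.deriv hb.isOpen).differentiableAt
      (hb.isOpen.mem_nhds hz)).hasDerivAt
  have hd1 : HasDerivAt (fun z => deriv h z ^ 2) (2 * deriv h z * deriv (deriv h) z) z := by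
    simpa using hd0.fun_pow 2
  have hd2 := (hasDerivAt_cubic a z).const_mul (Complex.exp (Complex.I * θ) ^ 2)
  have heq : (fun z => deriv h z ^ 2) =ᶠ[𝓝 z]
      fun z => Complex.exp (Complex.I * θ) ^ 2 * (cubic a).eval z := by
    filter_upwards [hb.isOpen.mem_nhds hz] with w hw using hb.deriv_sq w hw
  have h3 := (hd2.congr_of_eventuallyEq heq).unique hd1
  refine hd0.congr_deriv ?_
  have h4 := hb.deriv_ne_zero hp z hz
  have h5 := hp z hz
  have h6 := hb.deriv_sq z hz
  have h7 : Complex.exp (Complex.I * θ) ^ 2 = deriv h z ^ 2 / (cubic a).eval z := by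
    rw [h6]; field_simp
  rw [h7] at h3
  have h8 : 2 * deriv h z * deriv (deriv h) z = 2 * deriv h z *
      (deriv h z * ((cubic a).derivative.eval z / (2 * (cubic a).eval z))) := by
    rw [← h3]; field_simp
  exact mul_left_cancel₀ (mul_ne_zero two_ne_zero h4) h8

theorem isOpen_image : IsOpen (h '' D) :=
  isOpen_image_of_deriv_ne_zero hb.isOpen hb.differentiableOn (hb.deriv_ne_zero hp)

omit hb hp in
theorem inv_mem {ζ : ℂ} (hζ : ζ ∈ h '' D) : Function.invFunOn h D ζ ∈ D :=
  Function.invFunOn_mem hζ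

omit hb hp in
theorem apply_inv {ζ : ℂ} (hζ : ζ ∈ h '' D) : h (Function.invFunOn h D ζ) = ζ :=
  Function.invFunOn_eq hζ

omit hp in
theorem inv_apply {z : ℂ} (hz : z ∈ D) : Function.invFunOn h D (h z) = z :=
  invFunOn_apply_image hb.injOn hz

theorem hasDerivAt_inv {ζ : ℂ} (hζ : ζ ∈ h '' D) :
    HasDerivAt (Function.invFunOn h D) (deriv h (Function.invFunOn h D ζ))⁻¹ ζ :=
  hasDerivAt_invFunOn hb.isOpen hb.differentiableOn (hb.deriv_ne_zero hp) hb.injOn hζ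

theorem koebe {ζ w : ℂ} {ρ : ℝ} (hρ : 0 < ρ) (hball : Metric.ball ζ ρ ⊆ h '' D)
    (hw : w ∉ Function.invFunOn h D '' Metric.ball ζ ρ) :
    ρ ≤ 40 * ‖w - Function.invFunOn h D ζ‖ * ‖deriv h (Function.invFunOn h D ζ)‖ := by
  set g := Function.invFunOn h D
  have hd : ∀ ξ ∈ Metric.ball ζ ρ, HasDerivAt g (deriv h (g ξ))⁻¹ ξ := fun ξ hξ =>
    hb.hasDerivAt_inv hp (hball hξ)
  have hne : ∀ ξ ∈ Metric.ball ζ ρ, deriv h (g ξ) ≠ 0 := fun ξ hξ =>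
    hb.deriv_ne_zero hp _ (inv_mem (hball hξ))
  have hζ : ζ ∈ Metric.ball ζ ρ := Metric.mem_ball_self hρ
  have h1 := koebe_weak hρ (fun ξ hξ => (hd ξ hξ).differentiableAt.differentiableWithinAt)
    (fun ξ hξ ξ' hξ' heq => by
      rw [← apply_inv (hball hξ), ← apply_inv (hball hξ')]
      exact congrArg h heq)
    (fun ξ hξ => by rw [(hd ξ hξ).deriv]; exact inv_ne_zero (hne ξ hξ)) hw
  rw [(hd ζ hζ).deriv, norm_inv, ← div_eq_mul_inv,
    div_le_iff₀ (norm_pos_iff.2 (hne ζ hζ))] at h1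
  exact h1

/-- For small `ε`, points of `D` at distance at least `ε` from the cuts in the `h`-plane are at
distance at least `ε` from the turning points. -/
theorem exists_dist_turningPoint : ∃ ε₀ : ℝ, 0 < ε₀ ∧ ∀ ε, 0 < ε → ε < ε₀ →
    ∀ ζ, Metric.ball ζ ε ⊆ h '' D → ∀ t ∈ turningPoints a,
      ε ≤ dist (Function.invFunOn h D ζ) t := by
  set B : ℝ := (2 * ‖a‖ + 3) ^ 2 with hB
  have ha := norm_nonneg a
  have hB1 : 1 ≤ B := by rw [hB]; nlinarith
  -- `B` bounds the product of the two factors of `p_a` other than `z - t`. If `‖z - t‖ < ε`,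
  -- Koebe's inequality with `‖h' z‖ ^ 2 = ‖p_a z‖ ≤ ‖z - t‖ * B` gives `ε² ≤ 1600 B ε³`.
  refine ⟨1 / (1600 * B), by positivity, fun ε hε hε' ζ hball t ht => ?_⟩
  by_contra hlt
  push Not at hlt
  have hε1 : 1600 * B * ε < 1 := by
    rw [lt_div_iff₀ (by positivity)] at hε'; linarith
  have hζ : ζ ∈ h '' D := hball (Metric.mem_ball_self hε)
  set z := Function.invFunOn h D ζ
  have hz : z ∈ D := inv_mem hζ
  have htD : t ∉ Function.invFunOn h D '' Metric.ball ζ ε := by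
    rintro ⟨ξ, hξ, rfl⟩
    exact hp _ (inv_mem (hball hξ)) (eval_cubic_eq_zero_iff.2 ht)
  have hk := hb.koebe hp hε hball htD
  rw [dist_eq_norm] at hlt
  rw [norm_sub_rev] at hk
  have hε2 : ε ≤ 1 := by nlinarith
  have hzn : ‖z‖ ≤ ‖a‖ + 2 := by
    have h1 := norm_turningPoint_le ht
    have h2 := norm_le_norm_add_norm_sub t z
    rw [norm_sub_rev] at h2
    linarith
  have hza : ‖z - a‖ ≤ 2 * ‖a‖ + 3 := (norm_sub_le _ _).trans (by linarith)
  have hz1 : ‖z - 1‖ ≤ 2 * ‖a‖ + 3 := (norm_sub_le _ _).trans (by simp; linarith)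
  have hz2 : ‖z + 1‖ ≤ 2 * ‖a‖ + 3 := (norm_add_le _ _).trans (by simp; linarith)
  have hpz : ‖(cubic a).eval z‖ ≤ ‖z - t‖ * B := by
    rw [eval_cubic, norm_mul, norm_mul, hB]
    rcases ht with rfl | rfl | ht
    · rw [sub_neg_eq_add]
      calc _ ≤ (2 * ‖a‖ + 3) * (2 * ‖a‖ + 3) * ‖z + 1‖ := by gcongr
        _ = _ := by ring
    · calc _ ≤ (2 * ‖a‖ + 3) * ‖z - 1‖ * (2 * ‖a‖ + 3) := by gcongr
        _ = _ := by ring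
    · rw [mem_singleton_iff] at ht
      subst ht
      calc _ ≤ ‖z - t‖ * (2 * ‖t‖ + 3) * (2 * ‖t‖ + 3) := by gcongr
        _ = _ := by ring
  rw [← hb.norm_deriv_sq hz] at hpz
  have h5 : ε ^ 2 ≤ (40 * ‖z - t‖ * ‖deriv h z‖) ^ 2 := by gcongr
  have h6 : (40 * ‖z - t‖ * ‖deriv h z‖) ^ 2 ≤ 1600 * ε ^ 2 * (ε * B) := by
    calc _ = 1600 * ‖z - t‖ ^ 2 * ‖deriv h z‖ ^ 2 := by ring
      _ ≤ 1600 * ε ^ 2 * (ε * B) := by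
        gcongr
        exact hpz.trans (by gcongr)
  have h7 : ε ^ 2 * (1600 * B * ε) < ε ^ 2 * 1 := by gcongr
  linarith

/-- The inverse function tends to infinity along the points whose `ε`-balls avoid the cuts. -/
theorem exists_norm_le_of_norm_inv_le {ε : ℝ} (hε : 0 < ε) (R : ℝ) : ∃ Y : ℝ, 0 ≤ Y ∧
    ∀ ζ, Metric.ball ζ ε ⊆ h '' D → ‖Function.invFunOn h D ζ‖ ≤ R → ‖ζ‖ ≤ Y := by
  set g := Function.invFunOn h D
  set A : Set ℂ := {ζ | Metric.ball ζ ε ⊆ h '' D ∧ ‖g ζ‖ ≤ R} with hA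
  obtain ⟨P, hP0, hP⟩ : ∃ P : ℝ, 0 < P ∧ ∀ ζ ∈ A, ‖deriv h (g ζ)‖ ≤ P := by
    obtain ⟨P, hP⟩ := (isCompact_closedBall (0 : ℂ) R).exists_bound_of_continuousOn
      (f := fun z => (cubic a).eval z) (by fun_prop)
    refine ⟨Real.sqrt (max P 1), by positivity, fun ζ hζ => ?_⟩
    rw [hb.norm_deriv (inv_mem (hζ.1 (Metric.mem_ball_self hε)))]
    refine Real.sqrt_le_sqrt ((hP _ ?_).trans (le_max_left _ _))
    simpa using hζ.2
  -- If `ζ'` were farther than `ε` from `ζ`, injectivity would make `g ζ'` a value omitted on the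
  -- disc about `ζ`, and Koebe would keep `g ζ'` away from `g ζ`. A finite cover of the disc of
  -- radius `R` therefore splits `A` into finitely many bounded pieces.
  have hsep : ∀ ζ ∈ A, ∀ ζ' ∈ A, dist (g ζ) (g ζ') < ε / (40 * P) → dist ζ ζ' ≤ ε := by
    intro ζ hζ ζ' hζ' hlt
    by_contra hfar
    push Not at hfar
    have hnot : g ζ' ∉ g '' Metric.ball ζ ε := by
      rintro ⟨ξ, hξ, heq⟩
      have h1 := congrArg h heq
      rw [apply_inv (hζ.1 hξ), apply_inv (hζ'.1 (Metric.mem_ball_self hε))] at h1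
      rw [h1, Metric.mem_ball, dist_comm] at hξ
      linarith
    have hk := hb.koebe hp hε hζ.1 hnot
    rw [lt_div_iff₀ (by positivity), dist_eq_norm, norm_sub_rev] at hlt
    have : 40 * ‖g ζ' - g ζ‖ * ‖deriv h (g ζ)‖ ≤ 40 * ‖g ζ' - g ζ‖ * P := by
      gcongr; exact hP ζ hζ
    linarith
  have hbdd : Bornology.IsBounded A := by
    obtain ⟨t, -, htfin, ht⟩ := (isCompact_closedBall (0 : ℂ) R).finite_cover_balls
      (show 0 < ε / (40 * P) / 2 by positivity)
    have hcov : A ⊆ ⋃ x ∈ t, {ζ ∈ A | dist (g ζ) x < ε / (40 * P) / 2} := by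
      intro ζ hζ
      have h1 : g ζ ∈ Metric.closedBall (0 : ℂ) R := by simpa using hζ.2
      have h2 := ht h1
      simp only [mem_iUnion, Metric.mem_ball] at h2 ⊢
      obtain ⟨x, hx, hx'⟩ := h2
      exact ⟨x, hx, hζ, hx'⟩
    refine Bornology.IsBounded.subset ((Bornology.isBounded_biUnion htfin).2 fun x _ => ?_) hcov
    rw [Metric.isBounded_iff]
    refine ⟨ε, fun ζ hζ ζ' hζ' => hsep ζ hζ.1 ζ' hζ'.1 ?_⟩
    have := dist_triangle_right (g ζ) (g ζ') x
    linarith [hζ.2, hζ'.2]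
  obtain ⟨Y, hY⟩ := hbdd.exists_norm_le
  exact ⟨max Y 0, le_max_right _ _, fun ζ h1 h2 => (hY ζ ⟨h1, h2⟩).trans (le_max_left _ _)⟩

/-- Quadratic growth of `|g|⁵` along segments on which `g` is large, where `g` is the inverse
of `h`. -/
theorem sq_le_add_of_far {ζ v : ℂ} (hv : ‖v‖ = 1) {s₁ s₂ : ℝ} (hs : s₁ ≤ s₂)
    (hmem : ∀ s ∈ Icc s₁ s₂, ζ + s * v ∈ h '' D)
    (hfar : ∀ s ∈ Icc s₁ s₂, farRadius a ≤ ‖Function.invFunOn h D (ζ + s * v)‖) :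
    5 / 4 * (s₁ - s₂) ^ 2 ≤ ‖Function.invFunOn h D (ζ + s₁ * v)‖ ^ 5
      + ‖Function.invFunOn h D (ζ + s₂ * v)‖ ^ 5 := by
  set g := Function.invFunOn h D
  set G : ℝ → ℂ := fun s => g (ζ + s * v) with hG
  have hG0 : ∀ s ∈ Icc s₁ s₂, 0 < ‖G s‖ := fun s hs =>
    (zero_lt_one.trans_le (one_le_farRadius a)).trans_le (hfar s hs)
  have hGD : ∀ s ∈ Icc s₁ s₂, G s ∈ D := fun s hs => inv_mem (hmem s hs)
  have hGd : ∀ s ∈ Icc s₁ s₂, HasDerivAt G (v / deriv h (G s)) s := by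
    intro s hs
    have h1 := hb.hasDerivAt_inv hp (hmem s hs)
    have h2 : HasDerivAt (fun s : ℝ => ζ + s * v) v s := by
      simpa using ((Complex.ofRealCLM.hasDerivAt (x := s)).mul_const v).const_add ζ
    have h3 := h1.comp s h2
    refine h3.congr_deriv ?_
    rw [div_eq_inv_mul]
  -- `A = G' / G` is the logarithmic derivative along the line. The power five is natural because
  -- `h` behaves like `z^{5/2}` at infinity, so that `|G|⁵` is comparable to a square.
  set A : ℝ → ℂ := fun s => v / (deriv h (G s) * G s) with hAdef
  have hM : ∀ s ∈ Icc s₁ s₂, HasDerivAt (fun s => ‖G s‖ ^ 5) (5 * (‖G s‖ ^ 5 * (A s).re)) s := by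
    intro s hs
    have h1 := (hGd s hs).norm_sq
    have hn : (‖G s‖ ^ 2) ≠ 0 := (pow_pos (hG0 s hs) 2).ne'
    have h2 := (h1.sqrt hn).pow 5
    have e1 : (fun s => √(‖G s‖ ^ 2)) ^ 5 = fun s => ‖G s‖ ^ 5 := by
      funext s
      simp
    rw [e1] at h2
    refine h2.congr_deriv ?_
    rw [Real.sqrt_sq (norm_nonneg _)]
    have e2 : v / deriv h (G s) = A s * G s := by
      have h3 : G s ≠ 0 := norm_pos_iff.1 (hG0 s hs)
      have h4 := hb.deriv_ne_zero hp _ (hGD s hs)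
      simp only [hAdef]
      field_simp
    have e3 : inner ℝ (G s) (v / deriv h (G s)) = ‖G s‖ ^ 2 * (A s).re := by
      rw [e2, Complex.inner, mul_assoc, Complex.mul_conj, Complex.normSq_eq_norm_sq,
        Complex.re_mul_ofReal, mul_comm]
    rw [e3]
    have := (hG0 s hs).ne'
    push_cast
    field_simp
  have hAd : ∀ s ∈ Icc s₁ s₂, HasDerivAt A (-(A s ^ 2 *
      (G s * (cubic a).derivative.eval (G s) / (2 * (cubic a).eval (G s)) + 1))) s := by
    intro s hs
    have h3 : G s ≠ 0 := norm_pos_iff.1 (hG0 s hs)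
    have h4 := hb.deriv_ne_zero hp _ (hGD s hs)
    have h5 := hp _ (hGD s hs)
    have h1 := ((hb.hasDerivAt_deriv hp (hGD s hs)).mul (hasDerivAt_id (G s))).comp s (hGd s hs)
    have h2 := (hasDerivAt_const s v).div h1 (mul_ne_zero h4 h3)
    refine h2.congr_deriv ?_
    simp only [hAdef, Function.comp, Pi.mul_apply, id]
    field_simp
    ring
  have hM2 : ∀ s ∈ Icc s₁ s₂, HasDerivAt (fun s => 5 * (‖G s‖ ^ 5 * (A s).re) - 5 * s)
      (5 * (5 * (‖G s‖ ^ 5 * (A s).re) * (A s).re + ‖G s‖ ^ 5 * (-(A s ^ 2 *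
      (G s * (cubic a).derivative.eval (G s) / (2 * (cubic a).eval (G s)) + 1))).re) - 5) s := by
    intro s hs
    have h1 : HasDerivAt (fun s => (A s).re) _ s :=
      Complex.reCLM.hasFDerivAt.comp_hasDerivAt s (hAd s hs)
    have h2 := (((hM s hs).mul h1).const_mul 5).sub ((hasDerivAt_id s).const_mul 5)
    refine h2.congr_deriv ?_
    simp
  -- With `A = α + iβ`, the second derivative of `‖G‖ ^ 5` is at least `5 (5/2 - 1/8) ‖G‖⁵ (α² +
  -- β²)`. Here `‖G‖⁵ ‖A‖² = ‖G‖³ / ‖p_a(G)‖ ≥ 1/2`, so it exceeds `5`, the second derivative of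
  -- `5/2 * s ^ 2`.
  have hpos : ∀ s ∈ Icc s₁ s₂, 0 ≤ 5 * (5 * (‖G s‖ ^ 5 * (A s).re) * (A s).re + ‖G s‖ ^ 5 *
      (-(A s ^ 2 * (G s * (cubic a).derivative.eval (G s) / (2 * (cubic a).eval (G s)) + 1))).re)
        - 5 := by
    intro s hs
    set η := G s * (cubic a).derivative.eval (G s) / (2 * (cubic a).eval (G s)) - 3 / 2 with hη
    have hη1 : ‖η‖ ≤ 1 / 8 := norm_logDeriv_cubic_sub_le (hfar s hs)
    have e1 : G s * (cubic a).derivative.eval (G s) / (2 * (cubic a).eval (G s)) + 1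
        = 5 / 2 + η := by rw [hη]; ring
    have e2 : (-(A s ^ 2 * (5 / 2 + η))).re
        = -(5 / 2) * ((A s).re ^ 2 - (A s).im ^ 2) - (A s ^ 2 * η).re := by
      rw [mul_add, neg_add, Complex.add_re, Complex.neg_re, Complex.neg_re, pow_two]
      simp
      ring
    have h3 : (A s ^ 2 * η).re ≤ 1 / 8 * ((A s).re ^ 2 + (A s).im ^ 2) := by
      refine (Complex.re_le_norm _).trans ?_
      rw [norm_mul, norm_pow, Complex.sq_norm, Complex.normSq_apply]
      calc _ ≤ ((A s).re * (A s).re + (A s).im * (A s).im) * (1 / 8) := by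
            gcongr
            nlinarith [mul_self_nonneg (A s).re, mul_self_nonneg (A s).im]
        _ = _ := by ring
    have h4 : ‖A s‖ ^ 2 * ‖G s‖ ^ 5 = ‖G s‖ ^ 3 / ‖(cubic a).eval (G s)‖ := by
      simp only [hAdef]
      rw [norm_div, norm_mul, hv, div_pow, mul_pow, hb.norm_deriv_sq (hGD s hs)]
      have := (hG0 s hs).ne'
      have := norm_ne_zero_iff.2 (hp _ (hGD s hs))
      field_simp
    have h5 : 1 / 2 ≤ ‖A s‖ ^ 2 * ‖G s‖ ^ 5 := by
      rw [h4, div_le_div_iff₀ two_pos (norm_pos_iff.2 (hp _ (hGD s hs)))]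
      linarith [norm_cubic_le_of_far (hfar s hs)]
    rw [Complex.sq_norm, Complex.normSq_apply] at h5
    rw [e1, e2]
    have h6 : (0 : ℝ) ≤ ‖G s‖ ^ 5 := by positivity
    set M := ‖G s‖ ^ 5
    set α := (A s).re
    set β := (A s).im
    have h7 : 0 ≤ M * (1 / 8 * (α ^ 2 + β ^ 2) - (A s ^ 2 * η).re) :=
      mul_nonneg h6 (by linarith)
    nlinarith [mul_nonneg h6 (sq_nonneg β), mul_nonneg h6 (sq_nonneg α)]
  have hconv : ConvexOn ℝ (Icc s₁ s₂) fun s => ‖G s‖ ^ 5 - 5 / 2 * s ^ 2 := by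
    refine convexOn_of_hasDerivWithinAt2_nonneg (convex_Icc _ _)
      (f' := fun s => 5 * (‖G s‖ ^ 5 * (A s).re) - 5 * s) ?_ (fun s hs => ?_)
      (fun s hs => (hM2 s (interior_subset hs)).hasDerivWithinAt)
      fun s hs => hpos s (interior_subset hs)
    · exact fun s hs => ((hM s hs).continuousAt.sub (by fun_prop)).continuousWithinAt
    · refine (((hM s (interior_subset hs)).sub
        ((hasDerivAt_pow 2 s).const_mul (5 / 2))).congr_deriv ?_).hasDerivWithinAt
      push_cast
      ring
  -- Midpoint convexity, with the nonnegative value of `‖G‖ ^ 5` at the midpoint discarded, is the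
  -- desired inequality.
  have hmid := hconv.2 (left_mem_Icc.2 hs) (right_mem_Icc.2 hs) (show (0 : ℝ) ≤ 1 / 2 by norm_num)
    (show (0 : ℝ) ≤ 1 / 2 by norm_num) (by norm_num)
  simp only [smul_eq_mul] at hmid
  have h0 : 0 ≤ ‖G (1 / 2 * s₁ + 1 / 2 * s₂)‖ ^ 5 := by positivity
  change 5 / 4 * (s₁ - s₂) ^ 2 ≤ ‖G s₁‖ ^ 5 + ‖G s₂‖ ^ 5
  nlinarith

end IsCanonicalBranch


/-! ### Error-control integrals over straight lines -/

/-- The points whose `ε`-balls lie in `G`. -/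
def ballInterior (G : Set ℂ) (ε : ℝ) : Set ℂ := {ζ | Metric.ball ζ ε ⊆ G}

theorem mem_of_mem_ballInterior {G : Set ℂ} {ε : ℝ} (hε : 0 < ε) {ζ : ℂ}
    (hζ : ζ ∈ ballInterior G ε) : ζ ∈ G := hζ (Metric.mem_ball_self hε)

theorem abs_sub_le_norm_line (ζ : ℂ) {v : ℂ} (hv : ‖v‖ = 1) (s : ℝ) :
    |s - -(ζ * (starRingEnd ℂ) v).re| ≤ ‖ζ + s * v‖ := by
  have h1 : ζ + s * v = v * (s + ζ * (starRingEnd ℂ) v) := by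
    have : v * (starRingEnd ℂ) v = 1 := by
      rw [Complex.mul_conj, Complex.normSq_eq_norm_sq, hv]; simp
    linear_combination (-ζ) * this
  rw [h1, norm_mul, hv, one_mul]
  refine le_trans (le_of_eq ?_) (Complex.abs_re_le_norm _)
  rw [Complex.add_re, Complex.ofReal_re, sub_neg_eq_add]

namespace IsCanonicalBranch

variable {a : ℂ} {θ : ℝ} {D : Set ℂ} {h : ℂ → ℂ}
variable (hb : IsCanonicalBranch a θ D h) (hp : ∀ z ∈ D, (cubic a).eval z ≠ 0)
include hb hp

/-- The error-control integrals over straight lines in the `h`-plane are uniformly bounded. -/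
theorem exists_lintegral_line_le {ε : ℝ} (hε : 0 < ε)
    (hdist : ∀ ζ ∈ ballInterior (h '' D) ε, ∀ t ∈ turningPoints a,
      ε ≤ dist (Function.invFunOn h D ζ) t) :
    ∃ K : ENNReal, K ≠ ⊤ ∧ ∀ (ζ v : ℂ) (J : Set ℝ), ‖v‖ = 1 → J.OrdConnected →
      (∀ s ∈ J, ζ + s * v ∈ ballInterior (h '' D) ε) →
      ∫⁻ s in J, ENNReal.ofReal ‖errorCoeff a (Function.invFunOn h D (ζ + s * v))‖ ≤ K := by
  set g := Function.invFunOn h D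
  obtain ⟨Y, hY0, hY⟩ := hb.exists_norm_le_of_norm_inv_le hp hε (farRadius a)
  set K₁ := ENNReal.ofReal 160 * ENNReal.ofReal (4 * Real.pi)
  set K₂ := ENNReal.ofReal (5 / ε ^ 5) * ENNReal.ofReal (2 * Y)
  refine ⟨K₂ + (K₁ + K₁), by simp [K₁, K₂, ENNReal.mul_eq_top], fun ζ v J hv hJ hmem => ?_⟩
  -- `s₀` is the parameter of the foot of the perpendicular from the origin. Outside the window `|s
  -- - s₀| ≤ Y` the inverse is large and quadratic growth applies; inside it the coefficient is at
  -- most `5 / ε ^ 5` and the length at most `2 * Y`.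
  set s₀ := -(ζ * (starRingEnd ℂ) v).re
  have far : ∀ J' : Set ℝ, J'.OrdConnected → J' ⊆ J → (∀ s ∈ J', Y < |s - s₀|) →
      ∫⁻ s in J', ENNReal.ofReal ‖errorCoeff a (g (ζ + s * v))‖ ≤ K₁ := by
    intro J' hJ' hsub hfar
    have hfar' : ∀ s ∈ J', farRadius a ≤ ‖g (ζ + s * v)‖ := by
      intro s hs
      by_contra hlt
      push Not at hlt
      have h1 := hY _ (hmem s (hsub hs)) hlt.le
      linarith [abs_sub_le_norm_line ζ hv s, hfar s hs]
    have hquad : ∀ s ∈ J', ∀ s' ∈ J', s ≤ s' → 5 / 4 * (s - s') ^ 2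
        ≤ ‖g (ζ + s * v)‖ ^ 5 + ‖g (ζ + s' * v)‖ ^ 5 := fun s hs s' hs' hle =>
      hb.sq_le_add_of_far hp hv hle
        (fun u hu => mem_of_mem_ballInterior hε (hmem u (hsub (hJ'.out hs hs' hu))))
        (fun u hu => hfar' u (hJ'.out hs hs' hu))
    have h1 := lintegral_inv_le hJ'.measurableSet (M := fun s => ‖g (ζ + s * v)‖ ^ 5)
      (fun s hs => one_le_pow₀ ((one_le_farRadius a).trans (hfar' s hs)))
      (fun s hs s' hs' => by
        rcases le_total s s' with hle | hle
        · exact hquad s hs s' hs' hle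
        · have := hquad s' hs' s hs hle
          linarith [show (s - s') ^ 2 = (s' - s) ^ 2 by ring])
    calc _ ≤ ∫⁻ s in J', ENNReal.ofReal 160 * ENNReal.ofReal (1 / ‖g (ζ + s * v)‖ ^ 5) := by
          refine setLIntegral_mono' hJ'.measurableSet fun s hs => ?_
          rw [← ENNReal.ofReal_mul (by norm_num), mul_one_div]
          exact ENNReal.ofReal_le_ofReal (norm_errorCoeff_le_of_far (hfar' s hs))
      _ ≤ _ := by
          rw [lintegral_const_mul' _ _ ENNReal.ofReal_ne_top]
          exact mul_le_mul' le_rfl h1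
  have near : ∫⁻ s in J ∩ Icc (s₀ - Y) (s₀ + Y),
      ENNReal.ofReal ‖errorCoeff a (g (ζ + s * v))‖ ≤ K₂ := by
    calc _ ≤ ∫⁻ _ in J ∩ Icc (s₀ - Y) (s₀ + Y), ENNReal.ofReal (5 / ε ^ 5) := by
          refine setLIntegral_mono' (hJ.measurableSet.inter measurableSet_Icc) fun s hs => ?_
          exact ENNReal.ofReal_le_ofReal (norm_errorCoeff_le hε (hdist _ (hmem s hs.1)))
      _ ≤ K₂ := by
          rw [setLIntegral_const]
          refine mul_le_mul' le_rfl ?_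
          refine (measure_mono inter_subset_right).trans_eq ?_
          rw [Real.volume_Icc]; congr 1; ring
  have hcov : J ⊆ (J ∩ Icc (s₀ - Y) (s₀ + Y)) ∪ ((J ∩ Iio (s₀ - Y)) ∪ (J ∩ Ioi (s₀ + Y))) := by
    intro s hs
    by_cases h1 : s < s₀ - Y
    · exact Or.inr (Or.inl ⟨hs, h1⟩)
    by_cases h2 : s₀ + Y < s
    · exact Or.inr (Or.inr ⟨hs, h2⟩)
    · exact Or.inl ⟨hs, not_lt.1 h1, not_lt.1 h2⟩
  calc _ ≤ _ := lintegral_mono_set hcov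
    _ ≤ _ := lintegral_union_le _ _ _
    _ ≤ K₂ + (K₁ + K₁) := by
      refine add_le_add near ((lintegral_union_le _ _ _).trans (add_le_add ?_ ?_))
      · refine far _ (hJ.inter ordConnected_Iio) inter_subset_left fun s hs => ?_
        have : s < s₀ - Y := hs.2
        rw [lt_abs]; right; linarith
      · refine far _ (hJ.inter ordConnected_Ioi) inter_subset_left fun s hs => ?_
        have : s₀ + Y < s := hs.2
        rw [lt_abs]; left; linarith

/-- Quadratic decay of the error-control coefficient in a right half-plane. -/
theorem exists_errorCoeff_le_rightHalfPlane (hG : rightHalfPlane 0 ⊆ h '' D) :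
    ∃ x₀ C₀ : ℝ, 0 < x₀ ∧ 0 ≤ C₀ ∧ ∀ ζ ∈ rightHalfPlane x₀,
      ‖errorCoeff a (Function.invFunOn h D ζ)‖ ≤ C₀ / ‖ζ‖ ^ 2 := by
  set g := Function.invFunOn h D
  obtain ⟨Y, hY0, hY⟩ := hb.exists_norm_le_of_norm_inv_le hp one_pos (farRadius a)
  have hfar : ∀ ζ ∈ rightHalfPlane (Y + 1), farRadius a ≤ ‖g ζ‖ := by
    intro ζ hζ
    have hζ' : Y + 1 < ζ.re := hζ
    by_contra hlt
    push Not at hlt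
    have h1 := hY ζ (fun w hw => hG ?_) hlt.le
    · linarith [Complex.re_le_norm ζ]
    · have h2 := (Complex.abs_re_le_norm (w - ζ)).trans_lt (by simpa [dist_eq_norm] using hw)
      rw [Complex.sub_re, abs_lt] at h2
      change 0 < w.re
      linarith [h2.1]
  -- Quadratic growth is applied on the segment from this fixed point to `ζ`, which stays in the
  -- convex half-plane; `B` absorbs the contributions of `ζ₀`.
  set ζ₀ : ℂ := ((Y + 2 : ℝ) : ℂ) with hζ₀
  have hζ₀m : ζ₀ ∈ rightHalfPlane (Y + 1) := by
    change Y + 1 < ζ₀.re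
    rw [hζ₀, Complex.ofReal_re]; linarith
  set B := 8 / 5 + 8 / 5 * ‖g ζ₀‖ ^ 5 + 2 * ‖ζ₀‖ ^ 2 with hB
  refine ⟨Y + 1, 160 * B, by linarith, by positivity, fun ζ hζ => ?_⟩
  have hζ' : Y + 1 < ζ.re := hζ
  have hζ0 : 0 < ‖ζ‖ := by linarith [Complex.re_le_norm ζ]
  have h1 : 1 ≤ ‖g ζ‖ ^ 5 := one_le_pow₀ ((one_le_farRadius a).trans (hfar ζ hζ))
  have hquad : 5 / 4 * ‖ζ - ζ₀‖ ^ 2 ≤ ‖g ζ₀‖ ^ 5 + ‖g ζ‖ ^ 5 := by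
    rcases eq_or_ne ζ ζ₀ with rfl | hne
    · simp
    have hn : (‖ζ - ζ₀‖ : ℂ) ≠ 0 := by simpa using sub_ne_zero.2 hne
    have hline : ∀ s ∈ Icc (0 : ℝ) ‖ζ - ζ₀‖,
        ζ₀ + s * ((ζ - ζ₀) / ‖ζ - ζ₀‖) ∈ rightHalfPlane (Y + 1) := by
      intro s hs
      have hn' : 0 < ‖ζ - ζ₀‖ := norm_pos_iff.2 (sub_ne_zero.2 hne)
      have := (convex_rightHalfPlane (Y + 1)).add_smul_sub_mem hζ₀m hζ
        (t := s / ‖ζ - ζ₀‖) ⟨div_nonneg hs.1 hn'.le, (div_le_one hn').2 hs.2⟩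
      convert this using 2
      rw [Complex.real_smul]
      push_cast
      ring
    have := hb.sq_le_add_of_far hp (ζ := ζ₀) (v := (ζ - ζ₀) / ‖ζ - ζ₀‖) (s₁ := 0)
      (s₂ := ‖ζ - ζ₀‖) (by rw [norm_div, Complex.norm_real, norm_norm, div_self (by simpa using hn)])
      (norm_nonneg _) (fun s hs => hG (by
        have : Y + 1 < _ := hline s hs
        exact (by linarith : (0 : ℝ) < _))) (fun s hs => hfar _ (hline s hs))
    rw [mul_div_cancel₀ _ hn] at this
    simpa using this
  have h2 : ‖ζ‖ ^ 2 ≤ B * ‖g ζ‖ ^ 5 := by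
    have h3 : ‖ζ‖ ≤ ‖ζ - ζ₀‖ + ‖ζ₀‖ := by simpa using norm_add_le (ζ - ζ₀) ζ₀
    have h4 : ‖ζ‖ ^ 2 ≤ 2 * ‖ζ - ζ₀‖ ^ 2 + 2 * ‖ζ₀‖ ^ 2 := by
      nlinarith [sq_nonneg (‖ζ - ζ₀‖ - ‖ζ₀‖), norm_nonneg ζ]
    have h5 : 0 ≤ ‖g ζ₀‖ ^ 5 := by positivity
    rw [hB]
    nlinarith [sq_nonneg ‖ζ₀‖]
  refine (norm_errorCoeff_le_of_far (hfar ζ hζ)).trans ?_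
  rw [div_le_div_iff₀ (by linarith) (by positivity)]
  nlinarith

omit hb hp in
theorem inv_mem_trimmed {ε : ℝ} (hε : 0 < ε)
    (hdist : ∀ ζ ∈ ballInterior (h '' D) ε, ∀ t ∈ turningPoints a,
      ε ≤ dist (Function.invFunOn h D ζ) t) {ζ : ℂ} (hζ : ζ ∈ ballInterior (h '' D) ε) :
    Function.invFunOn h D ζ ∈ trimmed a D h ε := by
  have h1 := mem_of_mem_ballInterior hε hζ
  refine ⟨inv_mem h1, fun w hw => ?_, hdist ζ hζ⟩
  rw [apply_inv h1]
  by_contra hlt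
  push Not at hlt
  exact hw (hζ (by rwa [Metric.mem_ball, dist_comm]))

theorem exists_lipschitz_line {ζ v : ℂ} {T : ℝ}
    (hmem : ∀ s ∈ Icc (0 : ℝ) T, ζ + s * v ∈ h '' D) :
    ∃ K : NNReal, LipschitzOnWith K (fun s : ℝ => Function.invFunOn h D (ζ + s * v))
      (Icc 0 T) := by
  have hg : DifferentiableOn ℂ (Function.invFunOn h D) (h '' D) := fun ξ hξ =>
    (hb.hasDerivAt_inv hp hξ).differentiableAt.differentiableWithinAt
  have hc : ContDiffOn ℝ 1 (fun s : ℝ => Function.invFunOn h D (ζ + s * v)) (Icc 0 T) := by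
    refine ((hg.contDiffOn (n := 1) (hb.isOpen_image hp)).restrict_scalars ℝ).comp ?_ hmem
    exact (contDiff_const.add (Complex.ofRealCLM.contDiff.mul contDiff_const)).contDiffOn
  exact hc.exists_lipschitzOnWith (by decide) (convex_Icc _ _) isCompact_Icc

omit hb hp in
theorem hasDerivAt_line (ζ v : ℂ) (s : ℝ) : HasDerivAt (fun s : ℝ => ζ + s * v) v s := by
  simpa using ((Complex.ofRealCLM.hasDerivAt (x := s)).mul_const v).const_add ζ

/-- The factor `√|p_a| = |h'|` cancels the derivative of the inverse, so the density becomes `|V|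
|dζ|`. Only the germ of `γ` at `s` matters, which allows glued paths. -/
theorem errorDensity_line {ζ v : ℂ} (hv : ‖v‖ = 1) {s : ℝ} (hs : ζ + s * v ∈ h '' D) {γ : ℝ → ℂ}
    (hγ : γ =ᶠ[𝓝 s] fun s : ℝ => Function.invFunOn h D (ζ + s * v)) :
    errorDensity a (γ s) * ‖deriv γ s‖
      = ‖errorCoeff a (Function.invFunOn h D (ζ + s * v))‖ := by
  have h1 := (hb.hasDerivAt_inv hp hs).comp s (hasDerivAt_line ζ v s)
  have h2 : deriv γ s = _ := (h1.congr_of_eventuallyEq hγ).deriv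
  have h3 := hb.deriv_ne_zero hp _ (inv_mem hs)
  rw [h2, hγ.self_of_nhds, errorDensity_eq, ← hb.norm_deriv (inv_mem hs), norm_mul, norm_inv, hv]
  have := norm_ne_zero_iff.2 h3
  field_simp

end IsCanonicalBranch


/-! ### Axis-parallel paths avoiding vertical cuts -/

theorem mem_ballInterior_compl_iff {cuts : Finset (ℂ × Bool)} {ε : ℝ} {ζ : ℂ} :
    ζ ∈ ballInterior (⋃ c ∈ cuts, verticalCut c.1 c.2)ᶜ ε ↔
      ∀ c ∈ cuts, ∀ w ∈ verticalCut c.1 c.2, ε ≤ dist ζ w := by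
  constructor
  · intro hζ c hc w hw
    by_contra hlt
    push Not at hlt
    have := hζ (show w ∈ Metric.ball ζ ε by rwa [Metric.mem_ball, dist_comm])
    exact this (mem_iUnion₂.2 ⟨c, hc, hw⟩)
  · intro hζ w hw hmem
    obtain ⟨c, hc, hwc⟩ := mem_iUnion₂.1 hmem
    have := hζ c hc w hwc
    rw [Metric.mem_ball, dist_comm] at hw
    linarith

theorem abs_re_sub_le_dist (z w : ℂ) : |z.re - w.re| ≤ dist z w := by
  rw [dist_eq_norm, ← Complex.sub_re]; exact Complex.abs_re_le_norm _

theorem abs_im_sub_le_dist (z w : ℂ) : |z.im - w.im| ≤ dist z w := by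
  rw [dist_eq_norm, ← Complex.sub_im]; exact Complex.abs_im_le_norm _

/-- On a vertical segment the distance to a vertical cut is at least its minimum at the two
endpoints. -/
theorem le_dist_verticalCut_of_mem_segment {b : ℂ} {up : Bool} {ε x y₁ y₂ y : ℝ}
    (h₁ : ∀ w ∈ verticalCut b up, ε ≤ dist (⟨x, y₁⟩ : ℂ) w)
    (h₂ : ∀ w ∈ verticalCut b up, ε ≤ dist (⟨x, y₂⟩ : ℂ) w) (hy : y ∈ uIcc y₁ y₂) :
    ∀ w ∈ verticalCut b up, ε ≤ dist (⟨x, y⟩ : ℂ) w := by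
  -- An upward cut is mapped into itself by upward translations, so only the upper endpoint of the
  -- segment matters for it; a downward cut needs only the lower one.
  have key : ∀ y', (∀ w ∈ verticalCut b up, ε ≤ dist (⟨x, y'⟩ : ℂ) w) →
      (if up then y ≤ y' else y' ≤ y) → ∀ w ∈ verticalCut b up, ε ≤ dist (⟨x, y⟩ : ℂ) w := by
    intro y' h hle w hw
    have hw' : w + ⟨0, y' - y⟩ ∈ verticalCut b up := by
      refine ⟨by simpa using hw.1, ?_⟩
      have := hw.2
      cases up <;> simp at this hle ⊢ <;> linarith
    refine (h _ hw').trans_eq ?_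
    rw [dist_eq_norm, dist_eq_norm]
    congr 1
    apply Complex.ext
    · simp
    · simp; ring
  rw [mem_uIcc] at hy
  cases up
  · rcases hy with hy | hy
    · exact key y₁ h₁ (by simpa using hy.1)
    · exact key y₂ h₂ (by simpa using hy.1)
  · rcases hy with hy | hy
    · exact key y₂ h₂ (by simpa using hy.2)
    · exact key y₁ h₁ (by simpa using hy.2)

/-- Induction along axis-parallel paths running to the right through the gaps of the cuts: `y x`
is the height at which the column of cuts with real part `x` is crossed. -/
theorem columns_induction {cuts : Finset (ℂ × Bool)} {ε : ℝ} {y : ℝ → ℝ}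
    (hsep : ∀ c ∈ cuts, ∀ c' ∈ cuts, c.1.re ≠ c'.1.re → 2 * ε ≤ |c.1.re - c'.1.re|)
    (hy : ∀ c ∈ cuts, ∀ w ∈ verticalCut c.1 c.2, ε ≤ |y c.1.re - w.im|) {Q : ℕ → ℂ → Prop}
    (hray : ∀ ζ : ℂ, (∀ s : ℝ, 0 ≤ s →
      ζ + s * 1 ∈ ballInterior (⋃ c ∈ cuts, verticalCut c.1 c.2)ᶜ ε) → Q 0 ζ)
    (hstep : ∀ (n : ℕ) (ζ v : ℂ) (l : ℝ), ‖v‖ = 1 → 0 ≤ v.re → 0 ≤ l → (∀ s ∈ Icc 0 l,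
      ζ + s * v ∈ ballInterior (⋃ c ∈ cuts, verticalCut c.1 c.2)ᶜ ε) → Q n (ζ + l * v) →
      Q (n + 1) ζ) (n : ℕ) :
    ∀ ζ ∈ ballInterior (⋃ c ∈ cuts, verticalCut c.1 c.2)ᶜ ε,
      ((cuts.image fun c => c.1.re).filter fun x => ζ.re - ε < x).card = n → Q (2 * n) ζ := by
  -- `n` counts the columns still ahead. A column at `x ≤ ζ.re - ε` is already at distance at least
  -- `ε` from everything to the right of `ζ`. Each remaining column costs two sides: a vertical one
  -- to the height of its gap and a horizontal one to real part `x + ε`, the first at which it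
  -- counts as passed.
  induction n with
  | zero =>
    intro ζ _ hcard
    rw [Finset.card_eq_zero, Finset.filter_eq_empty_iff] at hcard
    refine hray ζ fun s hs => mem_ballInterior_compl_iff.2 fun c hc w hw => ?_
    have h1 := hcard (Finset.mem_image_of_mem (fun c => c.1.re) hc)
    push Not at h1
    refine le_trans ?_ (abs_re_sub_le_dist _ _)
    refine le_trans ?_ (le_abs_self _)
    rw [hw.1]
    simp
    linarith
  | succ n ih =>
    intro ζ hζ hcard
    rw [mem_ballInterior_compl_iff] at hζ
    set X := cuts.image fun c => c.1.re with hX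
    set Z := X.filter fun x => ζ.re - ε < x with hZ
    have hne : Z.Nonempty := by rw [← Finset.card_pos]; omega
    set x := Z.min' hne with hx
    have hxZ : x ∈ Z := Finset.min'_mem _ _
    have hxX : x ∈ X := (Finset.mem_filter.1 hxZ).1
    have hxζ : ζ.re - ε < x := (Finset.mem_filter.1 hxZ).2
    obtain ⟨c₀, hc₀, hc₀x⟩ := Finset.mem_image.1 hxX
    -- Until real part `x + ε` is reached, the other columns are harmless: those behind by the
    -- choice of `x` as next column, those ahead by the separation `2 * ε`.
    have hother : ∀ c ∈ cuts, c.1.re ≠ x → ∀ u : ℂ, ζ.re ≤ u.re → u.re ≤ x + ε →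
        ∀ w ∈ verticalCut c.1 c.2, ε ≤ dist u w := by
      intro c hc hcx u hu1 hu2 w hw
      refine le_trans ?_ (abs_re_sub_le_dist _ _)
      rw [hw.1]
      by_cases h1 : c.1.re ≤ ζ.re - ε
      · exact le_trans (by linarith) (le_abs_self _)
      · have h2 : x ≤ c.1.re := Finset.min'_le _ _
          (Finset.mem_filter.2 ⟨Finset.mem_image_of_mem _ hc, not_le.1 h1⟩)
        have h3 := hsep c hc c₀ hc₀ (by rw [hc₀x]; exact hcx)
        rw [hc₀x, abs_of_nonneg (by linarith)] at h3
        exact le_trans (by linarith) (neg_le_abs _)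
    have hgap : ∀ c ∈ cuts, c.1.re = x → ∀ u : ℂ, u.im = y x →
        ∀ w ∈ verticalCut c.1 c.2, ε ≤ dist u w := by
      intro c hc hcx u hu w hw
      refine le_trans ?_ (abs_im_sub_le_dist _ _)
      rw [hu, ← hcx]
      exact hy c hc w hw
    have hnew : ((⟨x + ε, y x⟩ : ℂ)) ∈ ballInterior (⋃ c ∈ cuts, verticalCut c.1 c.2)ᶜ ε := by
      refine mem_ballInterior_compl_iff.2 fun c hc => ?_
      by_cases hcx : c.1.re = x
      · exact hgap c hc hcx _ rfl
      · exact hother c hc hcx _ (by simp; linarith) (by simp)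
    have hQ0 : Q (2 * n) ⟨x + ε, y x⟩ := by
      refine ih _ hnew ?_
      have : (X.filter fun x' => (⟨x + ε, y x⟩ : ℂ).re - ε < x') = Z.erase x := by
        ext x'
        simp only [Finset.mem_filter, Finset.mem_erase, hZ, add_sub_cancel_right]
        constructor
        · rintro ⟨h1, h2⟩
          exact ⟨h2.ne', h1, by linarith⟩
        · rintro ⟨h1, h2, h3⟩
          exact ⟨h2, lt_of_le_of_ne
            (Finset.min'_le _ _ (Finset.mem_filter.2 ⟨h2, h3⟩)) (Ne.symm h1)⟩
      rw [this, Finset.card_erase_of_mem hxZ]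
      omega
    have hQ1 : Q (2 * n + 1) ⟨ζ.re, y x⟩ := by
      refine hstep _ _ 1 (x + ε - ζ.re) (by simp) (by simp) (by linarith) (fun s hs => ?_) ?_
      · refine mem_ballInterior_compl_iff.2 fun c hc => ?_
        by_cases hcx : c.1.re = x
        · exact hgap c hc hcx _ (by simp)
        · exact hother c hc hcx _ (by simpa using hs.1) (by simp; linarith [hs.2])
      · convert hQ0 using 1
        apply Complex.ext <;> simp
    have hvert : ∀ y' ∈ uIcc ζ.im (y x),
        (⟨ζ.re, y'⟩ : ℂ) ∈ ballInterior (⋃ c ∈ cuts, verticalCut c.1 c.2)ᶜ ε := by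
      intro y' hy'
      refine mem_ballInterior_compl_iff.2 fun c hc => ?_
      by_cases hcx : c.1.re = x
      · exact le_dist_verticalCut_of_mem_segment (hζ c hc) (hgap c hc hcx _ rfl) hy'
      · exact hother c hc hcx _ le_rfl (by simp; linarith)
    change Q (2 * n + 1 + 1) ζ
    rcases le_total ζ.im (y x) with hle | hle
    · refine hstep _ _ Complex.I (y x - ζ.im) (by simp) (by simp) (by linarith) (fun s hs => ?_) ?_
      · convert hvert (ζ.im + s) ?_ using 1
        · apply Complex.ext <;> simp
        · rw [uIcc_of_le hle]; exact ⟨by linarith [hs.1], by linarith [hs.2]⟩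
      · convert hQ1 using 1
        apply Complex.ext <;> simp
    · refine hstep _ _ (-Complex.I) (ζ.im - y x) (by simp) (by simp) (by linarith)
        (fun s hs => ?_) ?_
      · convert hvert (ζ.im - s) ?_ using 1
        · apply Complex.ext <;> simp [sub_eq_add_neg]
        · rw [uIcc_of_ge hle]; exact ⟨by linarith [hs.2], by linarith [hs.1]⟩
      · convert hQ1 using 1
        apply Complex.ext <;> simp

theorem isClosed_verticalCut (b : ℂ) (up : Bool) : IsClosed (verticalCut b up) := by
  have hre : IsClosed {w : ℂ | w.re = b.re} := isClosed_eq Complex.continuous_re continuous_const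
  cases up
  · have : verticalCut b false = {w | w.re = b.re} ∩ {w | w.im ≤ b.im} := by
      ext; simp [verticalCut]
    rw [this]
    exact hre.inter (isClosed_le Complex.continuous_im continuous_const)
  · have : verticalCut b true = {w | w.re = b.re} ∩ {w | b.im ≤ w.im} := by
      ext; simp [verticalCut]
    rw [this]
    exact hre.inter (isClosed_le continuous_const Complex.continuous_im)

/-- If the plane with finitely many vertical cuts is connected, then no vertical line is covered
by the cuts. -/
theorem exists_gap {cuts : Finset (ℂ × Bool)}
    (hconn : IsPreconnected (⋃ c ∈ cuts, verticalCut c.1 c.2)ᶜ) (x : ℝ) :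
    ∃ y : ℝ, (⟨x, y⟩ : ℂ) ∈ (⋃ c ∈ cuts, verticalCut c.1 c.2)ᶜ := by
  set X := cuts.image fun c => c.1.re with hX
  have hmem : ∀ u : ℝ, u ∉ X → (⟨u, 0⟩ : ℂ) ∈ (⋃ c ∈ cuts, verticalCut c.1 c.2)ᶜ := by
    intro u hu hmem
    obtain ⟨c, hc, hw⟩ := mem_iUnion₂.1 hmem
    exact hu (Finset.mem_image.2 ⟨c, hc, hw.1.symm⟩)
  obtain ⟨M, hM⟩ := X.bddAbove
  obtain ⟨m, hm⟩ := X.bddBelow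
  have h1 := hmem (max x M + 1) fun hc => by
    have := hM (Finset.mem_coe.2 hc)
    linarith [le_max_right x M]
  have h2 := hmem (min x m - 1) fun hc => by
    have := hm (Finset.mem_coe.2 hc)
    linarith [min_le_right x m]
  -- Points to the left and to the right of every column and of `x` belong to the complement, so its
  -- connectedness makes `Re` attain the value `x` on it.
  obtain ⟨w, hw, hwx⟩ := hconn.intermediate_value h2 h1 Complex.continuous_re.continuousOn
    (show x ∈ Icc _ _ from
      ⟨by linarith [min_le_left x m], by linarith [le_max_left x M]⟩)
  exact ⟨w.im, by rwa [← hwx, Complex.eta]⟩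

/-- The geometric hypotheses of `columns_induction` hold for small `ε`. -/
theorem exists_crossing_heights {cuts : Finset (ℂ × Bool)}
    (hconn : IsPreconnected (⋃ c ∈ cuts, verticalCut c.1 c.2)ᶜ) :
    ∃ y : ℝ → ℝ, ∀ᶠ ε in 𝓝[>] (0 : ℝ),
      (∀ c ∈ cuts, ∀ c' ∈ cuts, c.1.re ≠ c'.1.re → 2 * ε ≤ |c.1.re - c'.1.re|) ∧
      ∀ c ∈ cuts, ∀ w ∈ verticalCut c.1 c.2, ε ≤ |y c.1.re - w.im| := by
  choose y hy using exists_gap hconn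
  have hopen : IsOpen (⋃ c ∈ cuts, verticalCut c.1 c.2)ᶜ :=
    (cuts.finite_toSet.isClosed_biUnion fun c _ => isClosed_verticalCut c.1 c.2).isOpen_compl
  have hsmall : ∀ δ : ℝ, 0 < δ → ∀ᶠ ε in 𝓝[>] (0 : ℝ), ε ≤ δ := fun δ hδ =>
    mem_nhdsWithin_of_mem_nhds (Iic_mem_nhds hδ)
  refine ⟨y, Filter.Eventually.and ?_ ?_⟩
  · refine (Filter.eventually_all_finset cuts).2 fun c _ =>
      (Filter.eventually_all_finset cuts).2 fun c' _ => ?_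
    by_cases heq : c.1.re = c'.1.re
    · exact Eventually.of_forall fun ε h => absurd heq h
    · have : 0 < |c.1.re - c'.1.re| / 2 := by
        have := abs_pos.2 (sub_ne_zero.2 heq)
        positivity
      filter_upwards [hsmall _ this] with ε hε _
      linarith
  · refine (Filter.eventually_all_finset cuts).2 fun c hc => ?_
    obtain ⟨δ, hδ, hball⟩ := Metric.isOpen_iff.1 hopen _ (hy c.1.re)
    filter_upwards [hsmall δ hδ] with ε hε w hw
    by_contra hlt
    push Not at hlt
    have hwb : w ∈ Metric.ball (⟨c.1.re, y c.1.re⟩ : ℂ) δ := by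
      rw [Metric.mem_ball, dist_comm, Complex.dist_of_re_eq (by simpa using hw.1.symm), Real.dist_eq]
      linarith
    exact hball hwb (mem_iUnion₂.2 ⟨c, hc, hw⟩)


/-! ### Construction of infinite canonical paths -/

theorem lipschitzOnWith_glue {f g : ℝ → ℂ} {l T : ℝ} {K₁ K₂ : NNReal}
    (hf : LipschitzOnWith K₁ f (Icc 0 l)) (hg : LipschitzOnWith K₂ g (Icc 0 (T - l)))
    (hfg : f l = g 0) (hl : 0 ≤ l) :
    LipschitzOnWith (max K₁ K₂) (fun t => if t ≤ l then f t else g (t - l)) (Icc 0 T) := by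
  set γ : ℝ → ℂ := fun t => if t ≤ l then f t else g (t - l) with hγ
  have key : ∀ s ∈ Icc 0 T, ∀ t ∈ Icc 0 T, s ≤ t → dist (γ s) (γ t) ≤ max (K₁ : ℝ) K₂ * (t - s) := by
    intro s hs t ht hst
    have hm1 : (K₁ : ℝ) ≤ max (K₁ : ℝ) K₂ := le_max_left _ _
    have hm2 : (K₂ : ℝ) ≤ max (K₁ : ℝ) K₂ := le_max_right _ _
    by_cases h1 : t ≤ l
    · have h2 := hf.dist_le_mul s ⟨hs.1, hst.trans h1⟩ t ⟨ht.1, h1⟩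
      rw [Real.dist_eq, abs_sub_comm, abs_of_nonneg (by linarith)] at h2
      simp only [hγ, if_pos h1, if_pos (hst.trans h1)]
      exact h2.trans (mul_le_mul_of_nonneg_right hm1 (by linarith))
    · push Not at h1
      by_cases h3 : s ≤ l
      · have h4 := hf.dist_le_mul s ⟨hs.1, h3⟩ l ⟨hl, le_rfl⟩
        have h5 := hg.dist_le_mul 0 ⟨le_rfl, by linarith [ht.2]⟩ (t - l)
          ⟨by linarith, by linarith [ht.2]⟩
        rw [Real.dist_eq, abs_sub_comm, abs_of_nonneg (by linarith)] at h4 h5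
        simp only [hγ, if_pos h3, if_neg (not_le.2 h1)]
        have h6 := dist_triangle (f s) (f l) (g (t - l))
        rw [hfg] at h6 h4
        nlinarith [mul_le_mul_of_nonneg_right hm1 (sub_nonneg.2 h3),
          mul_le_mul_of_nonneg_right hm2 (sub_nonneg.2 h1.le)]
      · push Not at h3
        have h5 := hg.dist_le_mul (s - l) ⟨by linarith, by linarith [hs.2]⟩ (t - l)
          ⟨by linarith, by linarith [ht.2]⟩
        rw [Real.dist_eq, abs_sub_comm, abs_of_nonneg (by linarith)] at h5
        simp only [hγ, if_neg (not_le.2 h1), if_neg (not_le.2 h3)]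
        refine h5.trans ?_
        rw [show t - l - (s - l) = t - s by ring]
        exact mul_le_mul_of_nonneg_right hm2 (by linarith)
  refine LipschitzOnWith.of_dist_le_mul fun s hs t ht => ?_
  rw [NNReal.coe_max, Real.dist_eq]
  rcases le_total s t with hst | hst
  · rw [abs_sub_comm, abs_of_nonneg (by linarith)]
    exact key s hs t ht hst
  · rw [abs_of_nonneg (by linarith), dist_comm]
    exact key t ht s hs hst

namespace IsCanonicalBranch

variable {a : ℂ} {θ : ℝ} {D : Set ℂ} {h : ℂ → ℂ}
variable (hb : IsCanonicalBranch a θ D h) (hp : ∀ z ∈ D, (cubic a).eval z ≠ 0)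
include hb hp

/-- A horizontal ray is an infinite canonical path. -/
theorem exists_path_ray {ε : ℝ} {K : ENNReal} (hε : 0 < ε)
    (hdist : ∀ ζ ∈ ballInterior (h '' D) ε, ∀ t ∈ turningPoints a,
      ε ≤ dist (Function.invFunOn h D ζ) t)
    (hK : ∀ (ζ v : ℂ) (J : Set ℝ), ‖v‖ = 1 → J.OrdConnected →
      (∀ s ∈ J, ζ + s * v ∈ ballInterior (h '' D) ε) →
      ∫⁻ s in J, ENNReal.ofReal ‖errorCoeff a (Function.invFunOn h D (ζ + s * v))‖ ≤ K)
    {ζ : ℂ} (hmem : ∀ s : ℝ, 0 ≤ s → ζ + s * 1 ∈ ballInterior (h '' D) ε) :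
    ∃ γ, IsInfiniteCanonicalPath a D h ε γ ∧ γ 0 = Function.invFunOn h D ζ ∧
      errorIntegral a γ ≤ K := by
  set g := Function.invFunOn h D
  have hG : ∀ s : ℝ, 0 ≤ s → ζ + s * 1 ∈ h '' D := fun s hs =>
    mem_of_mem_ballInterior hε (hmem s hs)
  have hre : ∀ s : ℝ, 0 ≤ s → (h (g (ζ + s * 1))).re = ζ.re + s := fun s hs => by
    rw [apply_inv (hG s hs)]; simp
  refine ⟨fun s => g (ζ + s * 1), ⟨fun T => ?_, fun t ht => ?_, fun s hs t ht hst => ?_, ?_, ?_⟩,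
    by simp, ?_⟩
  · exact hb.exists_lipschitz_line hp fun s hs => hG s hs.1
  · exact inv_mem_trimmed hε hdist (hmem t ht)
  · have hs' : (0 : ℝ) ≤ s := hs
    have ht' : (0 : ℝ) ≤ t := ht
    simp only
    rw [hre s hs', hre t ht']
    linarith
  · refine (tendsto_atTop_add_const_left _ ζ.re tendsto_id).congr' ?_
    filter_upwards [eventually_ge_atTop 0] with s hs
    exact (hre s hs).symm
  · refine tendsto_atTop.2 fun R => ?_
    obtain ⟨Y, -, hY⟩ := hb.exists_norm_le_of_norm_inv_le hp hε R
    filter_upwards [eventually_gt_atTop (Y - ζ.re), eventually_ge_atTop 0] with s hs hs0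
    by_contra hlt
    push Not at hlt
    have h1 := hY _ (hmem s hs0) hlt.le
    have h2 := Complex.re_le_norm (ζ + s * 1)
    simp at h2 h1
    linarith
  · rw [errorIntegral]
    refine le_trans (le_of_eq ?_) (hK ζ 1 (Ioi 0) (by simp) ordConnected_Ioi
      fun s hs => hmem s (le_of_lt hs))
    refine setLIntegral_congr_fun measurableSet_Ioi fun s hs => ?_
    rw [hb.errorDensity_line hp (by simp) (hG s (le_of_lt hs)) (EventuallyEq.refl _ _)]

/-- A straight segment can be prepended to an infinite canonical path. -/
theorem exists_path_prepend {ε : ℝ} {K K' : ENNReal} (hε : 0 < ε)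
    (hdist : ∀ ζ ∈ ballInterior (h '' D) ε, ∀ t ∈ turningPoints a,
      ε ≤ dist (Function.invFunOn h D ζ) t)
    (hK : ∀ (ζ v : ℂ) (J : Set ℝ), ‖v‖ = 1 → J.OrdConnected →
      (∀ s ∈ J, ζ + s * v ∈ ballInterior (h '' D) ε) →
      ∫⁻ s in J, ENNReal.ofReal ‖errorCoeff a (Function.invFunOn h D (ζ + s * v))‖ ≤ K)
    {ζ v : ℂ} {l : ℝ} (hv : ‖v‖ = 1) (hvre : 0 ≤ v.re) (hl : 0 ≤ l)
    (hmem : ∀ s ∈ Icc 0 l, ζ + s * v ∈ ballInterior (h '' D) ε)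
    (hpath : ∃ γ, IsInfiniteCanonicalPath a D h ε γ ∧
      γ 0 = Function.invFunOn h D (ζ + l * v) ∧ errorIntegral a γ ≤ K') :
    ∃ γ, IsInfiniteCanonicalPath a D h ε γ ∧ γ 0 = Function.invFunOn h D ζ ∧
      errorIntegral a γ ≤ K + K' := by
  set g := Function.invFunOn h D
  obtain ⟨γ₁, hγ₁, hγ₁0, hγ₁K⟩ := hpath
  have hG : ∀ s ∈ Icc 0 l, ζ + s * v ∈ h '' D := fun s hs =>
    mem_of_mem_ballInterior hε (hmem s hs)
  have hre : ∀ s ∈ Icc 0 l, (h (g (ζ + s * v))).re = ζ.re + s * v.re := fun s hs => by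
    rw [apply_inv (hG s hs)]; simp
  set γ : ℝ → ℂ := fun t => if t ≤ l then g (ζ + t * v) else γ₁ (t - l) with hγ
  have hγle : ∀ t, t ≤ l → γ t = g (ζ + t * v) := fun t ht => if_pos ht
  have hγgt : ∀ t, l < t → γ t = γ₁ (t - l) := fun t ht => if_neg (not_le.2 ht)
  refine ⟨γ, ⟨fun T => ?_, fun t ht => ?_, fun s hs t ht hst => ?_, ?_, ?_⟩,
    by rw [hγle 0 hl]; simp, ?_⟩
  · obtain ⟨K₁, hK₁⟩ := hb.exists_lipschitz_line hp hG
    obtain ⟨K₂, hK₂⟩ := hγ₁.lipschitz (T - l)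
    exact ⟨_, lipschitzOnWith_glue hK₁ hK₂ hγ₁0.symm hl⟩
  · rcases le_or_gt t l with h1 | h1
    · rw [hγle t h1]
      exact inv_mem_trimmed hε hdist (hmem t ⟨ht, h1⟩)
    · rw [hγgt t h1]
      exact hγ₁.mem _ (by linarith)
  · have hs' : (0 : ℝ) ≤ s := hs
    have ht' : (0 : ℝ) ≤ t := ht
    simp only
    rcases le_or_gt t l with h1 | h1
    · rw [hγle t h1, hγle s (hst.trans h1), hre t ⟨ht', h1⟩, hre s ⟨hs', hst.trans h1⟩]
      gcongr
    · have hmono := hγ₁.monotone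
      rw [hγgt t h1]
      rcases le_or_gt s l with h2 | h2
      · rw [hγle s h2, hre s ⟨hs', h2⟩]
        have h3 := hmono (self_mem_Ici (a := (0 : ℝ))) (show t - l ∈ Ici 0 from by
          change 0 ≤ t - l; linarith) (by linarith)
        simp only at h3
        rw [hγ₁0, hre l ⟨hl, le_rfl⟩] at h3
        refine le_trans ?_ h3
        gcongr
      · rw [hγgt s h2]
        exact hmono (show s - l ∈ Ici 0 from by change 0 ≤ s - l; linarith)
          (show t - l ∈ Ici 0 from by change 0 ≤ t - l; linarith) (by linarith)
  · refine (hγ₁.tendsto_re.comp (tendsto_atTop_add_const_right _ (-l) tendsto_id)).congr' ?_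
    filter_upwards [eventually_gt_atTop l] with t ht
    rw [hγgt t ht]
    simp [sub_eq_add_neg]
  · refine (hγ₁.tendsto_infty.comp (tendsto_atTop_add_const_right _ (-l) tendsto_id)).congr' ?_
    filter_upwards [eventually_gt_atTop l] with t ht
    rw [hγgt t ht]
    simp [sub_eq_add_neg]
  · have hunion : Ioi (0 : ℝ) = Ioc 0 l ∪ Ioi l := (Ioc_union_Ioi_eq_Ioi hl).symm
    rw [errorIntegral, hunion]
    refine (lintegral_union_le _ _ _).trans (add_le_add ?_ ?_)
    -- The junction is a null set; away from it the glued path coincides locally with one of its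
    -- pieces, and so do the derivatives.
    · rw [← restrict_Ioo_eq_restrict_Ioc]
      refine le_trans (le_of_eq ?_) (hK ζ v (Ioo 0 l) hv ordConnected_Ioo
        fun s hs => hmem s (Ioo_subset_Icc_self hs))
      refine setLIntegral_congr_fun measurableSet_Ioo fun s hs => ?_
      rw [hb.errorDensity_line hp hv (hG s (Ioo_subset_Icc_self hs))]
      filter_upwards [Iio_mem_nhds hs.2] with t ht using hγle t (le_of_lt ht)
    · refine le_trans (le_of_eq ?_) hγ₁K
      have hpre : (fun t : ℝ => t - l) ⁻¹' Ioi 0 = Ioi l := by ext; simp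
      rw [errorIntegral, ← (measurePreserving_sub_right volume l).setLIntegral_comp_preimage_emb
        (measurableEmbedding_subRight l) _ (Ioi 0), hpre]
      refine setLIntegral_congr_fun measurableSet_Ioi fun s hs => ?_
      have hev : γ =ᶠ[𝓝 s] fun t => γ₁ (t - l) := by
        filter_upwards [Ioi_mem_nhds hs] with t ht using hγgt t ht
      rw [hev.deriv_eq, hev.self_of_nhds, deriv_comp_sub_const]

omit hp in
theorem isPreconnected_image : IsPreconnected (h '' D) :=
  hb.isConnected.isPreconnected.image h hb.differentiableOn.continuousOn

/-- For small `ε`, infinite canonical paths with uniformly bounded error-control integrals start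
at all points of `D_ε`. -/
theorem exists_paths : ∃ ε₀ : ℝ, 0 < ε₀ ∧ ∀ ε : ℝ, 0 < ε → ε < ε₀ →
    ∃ Γ : Set (ℝ → ℂ), (∀ γ ∈ Γ, IsInfiniteCanonicalPath a D h ε γ) ∧
      (∀ z ∈ trimmed a D h ε, ∃ γ ∈ Γ, γ 0 = z) ∧ errorSup a Γ < ⊤ := by
  obtain ⟨cuts, hcuts⟩ := hb.image_eq
  obtain ⟨y, hy⟩ := exists_crossing_heights (hcuts ▸ hb.isPreconnected_image)
  obtain ⟨ε₁, hε₁, hε₁y⟩ := mem_nhdsGT_iff_exists_Ioo_subset.1 hy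
  obtain ⟨ε₂, hε₂, hdist⟩ := hb.exists_dist_turningPoint hp
  refine ⟨min ε₁ ε₂, lt_min hε₁ hε₂, fun ε hε hlt => ?_⟩
  obtain ⟨hsep, hgap⟩ := hε₁y ⟨hε, hlt.trans_le (min_le_left _ _)⟩
  have hdist' := hdist ε hε (hlt.trans_le (min_le_right _ _))
  obtain ⟨K, hKtop, hK⟩ := hb.exists_lintegral_line_le hp hε hdist'
  have hind := columns_induction (cuts := cuts) hsep hgap
    (Q := fun n ζ => ∃ γ, IsInfiniteCanonicalPath a D h ε γ ∧ γ 0 = Function.invFunOn h D ζ ∧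
      errorIntegral a γ ≤ (n + 1) * K)
    (fun ζ hζ => by
      simpa using hb.exists_path_ray hp hε hdist' hK (hcuts ▸ hζ))
    (fun n ζ v l hv hvre hl hmem hQ => by
      have := hb.exists_path_prepend hp hε hdist' hK hv hvre hl (hcuts ▸ hmem) hQ
      refine this.imp fun γ hγ => ⟨hγ.1, hγ.2.1, hγ.2.2.trans_eq ?_⟩
      push_cast
      ring)
  -- At most `N` columns lie ahead of any point, so `2 * N` sides and a final ray suffice, whatever
  -- the starting point.
  set N := (cuts.image fun c => c.1.re).card
  refine ⟨{γ | IsInfiniteCanonicalPath a D h ε γ ∧ errorIntegral a γ ≤ (2 * N + 1) * K},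
    fun γ hγ => hγ.1, fun z hz => ?_, ?_⟩
  · have hzball : h z ∈ ballInterior (h '' D) ε := by
      intro w hw
      by_contra hnot
      have := hz.2.1 w hnot
      rw [Metric.mem_ball, dist_comm] at hw
      linarith
    obtain ⟨γ, h1, h2, h3⟩ := hind _ (h z) (hcuts ▸ hzball) rfl
    rw [hb.inv_apply hz.1] at h2
    refine ⟨γ, ⟨h1, h3.trans ?_⟩, h2⟩
    refine mul_le_mul' (add_le_add ?_ le_rfl) le_rfl
    exact_mod_cast Nat.mul_le_mul_left 2 (Finset.card_filter_le _ _)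
  · refine lt_of_le_of_lt (iSup₂_le fun γ hγ => hγ.2) ?_
    exact ENNReal.mul_lt_top (by finiteness) hKtop.lt_top

end IsCanonicalBranch


/-! ### Wronskians and dominant solutions in a half-plane -/

section HalfPlane

variable {V W X Φ Ξ : ℂ → ℂ} {r x₁ : ℝ}

/-- Abel's identity: the terms with `V` cancel in the derivative of the Wronskian, leaving `2 r`
times the Wronskian. -/
theorem exists_wronskian_eq
    (hW : ∀ ζ ∈ rightHalfPlane x₁, HasDerivAt W (X ζ) ζ)
    (hX : ∀ ζ ∈ rightHalfPlane x₁, HasDerivAt X (2 * r * X ζ + V ζ * W ζ) ζ)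
    (hΦ : ∀ ζ ∈ rightHalfPlane x₁, HasDerivAt Φ (Ξ ζ) ζ)
    (hΞ : ∀ ζ ∈ rightHalfPlane x₁, HasDerivAt Ξ (2 * r * Ξ ζ + V ζ * Φ ζ) ζ) :
    ∃ c : ℂ, ∀ ζ ∈ rightHalfPlane x₁, Ξ ζ * W ζ - Φ ζ * X ζ = c * Complex.exp (2 * r * ζ) := by
  set f : ℂ → ℂ := fun ζ => (Ξ ζ * W ζ - Φ ζ * X ζ) * Complex.exp (-(2 * r * ζ)) with hf
  have hd : ∀ ζ ∈ rightHalfPlane x₁, HasDerivAt f 0 ζ := by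
    intro ζ hζ
    have he : HasDerivAt (fun ζ : ℂ => Complex.exp (-(2 * r * ζ)))
        (Complex.exp (-(2 * r * ζ)) * -(2 * r)) ζ := by
      simpa using (((hasDerivAt_id ζ).const_mul (2 * r : ℂ)).neg).cexp
    refine ((((hΞ ζ hζ).mul (hW ζ hζ)).sub ((hΦ ζ hζ).mul (hX ζ hζ))).mul he).congr_deriv ?_
    simp only [Pi.sub_apply, Pi.mul_apply]
    ring
  set ζ₁ : ℂ := ((x₁ + 1 : ℝ) : ℂ)
  have hζ₁ : ζ₁ ∈ rightHalfPlane x₁ := by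
    change x₁ < ζ₁.re
    simp [ζ₁]
  refine ⟨f ζ₁, fun ζ hζ => ?_⟩
  have h1 := (isOpen_rightHalfPlane x₁).is_const_of_deriv_eq_zero
    (convex_rightHalfPlane x₁).isPreconnected
    (fun z hz => (hd z hz).differentiableAt.differentiableWithinAt)
    (fun z hz => (hd z hz).deriv) hζ hζ₁
  rw [← h1, hf]
  simp only
  rw [mul_assoc, ← Complex.exp_add]
  simp

theorem eq_const_mul_of_wronskian_eq_zero
    (hW : ∀ ζ ∈ rightHalfPlane x₁, HasDerivAt W (X ζ) ζ)
    (hW0 : ∀ ζ ∈ rightHalfPlane x₁, W ζ ≠ 0)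
    (hΦ : ∀ ζ ∈ rightHalfPlane x₁, HasDerivAt Φ (Ξ ζ) ζ)
    (h0 : ∀ ζ ∈ rightHalfPlane x₁, Ξ ζ * W ζ - Φ ζ * X ζ = 0) {ζ₁ : ℂ}
    (hζ₁ : ζ₁ ∈ rightHalfPlane x₁) :
    ∀ ζ ∈ rightHalfPlane x₁, Φ ζ = Φ ζ₁ / W ζ₁ * W ζ := by
  intro ζ hζ
  have hd : ∀ ζ ∈ rightHalfPlane x₁, HasDerivAt (fun ζ => Φ ζ / W ζ) 0 ζ := by
    intro ζ hζ
    refine ((hΦ ζ hζ).div (hW ζ hζ) (hW0 ζ hζ)).congr_deriv ?_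
    rw [h0 ζ hζ, zero_div]
  have h1 := (isOpen_rightHalfPlane x₁).is_const_of_deriv_eq_zero
    (convex_rightHalfPlane x₁).isPreconnected
    (fun z hz => (hd z hz).differentiableAt.differentiableWithinAt)
    (fun z hz => (hd z hz).deriv) hζ hζ₁
  rw [← h1, div_mul_cancel₀ _ (hW0 ζ hζ)]

/-- Mean value inequality along a straight line. -/
theorem norm_sub_le_of_line {P P' : ℂ → ℂ} {ζ v : ℂ} {l : ℝ} {B B' : ℝ → ℝ} (hl : 0 ≤ l)
    (hP : ∀ s ∈ Icc 0 l, HasDerivAt P (P' (ζ + s * v)) (ζ + s * v))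
    (hB : ∀ s, HasDerivAt B (B' s) s)
    (hbound : ∀ s ∈ Icc 0 l, ‖P' (ζ + s * v) * v‖ ≤ B' s) :
    ‖P (ζ + l * v) - P ζ‖ ≤ B l - B 0 := by
  have hd : ∀ s ∈ Icc 0 l, HasDerivAt (fun s : ℝ => P (ζ + s * v) - P ζ)
      (P' (ζ + s * v) * v) s := fun s hs =>
    ((hP s hs).comp s (IsCanonicalBranch.hasDerivAt_line ζ v s)).sub_const _
  exact image_norm_le_of_norm_deriv_right_le_deriv_boundary
    (f := fun s : ℝ => P (ζ + s * v) - P ζ) (B := fun s => B s - B 0)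
    (fun s hs => (hd s hs).continuousAt.continuousWithinAt)
    (fun s hs => (hd s (Ico_subset_Icc_self hs)).hasDerivWithinAt) (by simp)
    (fun s => (hB s).sub_const _) (fun s hs => hbound s (Ico_subset_Icc_self hs))
    (right_mem_Icc.2 hl)

/-- A solution with nonzero Wronskian against the recessive one blows up as `Re ζ → ∞`. -/
theorem exists_lt_norm_of_wronskian_ne_zero {C : ℝ} {c : ℂ} (hr : 0 < r) (hx₁ : 0 < x₁)
    (hC : 0 ≤ C) (hc : c ≠ 0)
    (hW : ∀ ζ ∈ rightHalfPlane x₁, HasDerivAt W (X ζ) ζ)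
    (hW1 : ∀ ζ ∈ rightHalfPlane x₁, ‖W ζ - 1‖ ≤ 1 / 2)
    (hXb : ∀ ζ ∈ rightHalfPlane x₁, ‖X ζ‖ ≤ C / ‖ζ‖ ^ 2)
    (hΦ : ∀ ζ ∈ rightHalfPlane x₁, HasDerivAt Φ (Ξ ζ) ζ)
    (hwr : ∀ ζ ∈ rightHalfPlane x₁, Ξ ζ * W ζ - Φ ζ * X ζ = c * Complex.exp (2 * r * ζ))
    (B : ℝ) : ∃ R : ℝ, ∀ ζ : ℂ, R < ζ.re → ζ ∈ rightHalfPlane x₁ ∧ B < ‖Φ ζ‖ := by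
  have hWlow : ∀ ζ ∈ rightHalfPlane x₁, 1 / 2 ≤ ‖W ζ‖ := fun ζ hζ => by
    have h1 := norm_sub_norm_le (1 : ℂ) (1 - W ζ)
    rw [norm_sub_rev (1 : ℂ) (W ζ)] at h1
    simp at h1
    linarith [hW1 ζ hζ]
  have hWup : ∀ ζ ∈ rightHalfPlane x₁, ‖W ζ‖ ≤ 3 / 2 := fun ζ hζ => by
    have h1 := norm_add_le (W ζ - 1) 1
    simp at h1
    linarith [hW1 ζ hζ]
  have hW0 : ∀ ζ ∈ rightHalfPlane x₁, W ζ ≠ 0 := fun ζ hζ =>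
    norm_pos_iff.1 (by linarith [hWlow ζ hζ])
  have hc' : 0 < ‖c‖ := norm_pos_iff.2 hc
  have hrC : (r : ℂ) ≠ 0 := by exact_mod_cast hr.ne'
  -- The derivative of `Φ / W` is `c e^{2rζ} / W²`. Integration by parts splits off the main term,
  -- and the remainder `P` has a derivative carrying the extra small factor `X`.
  set P : ℂ → ℂ := fun ζ => Φ ζ / W ζ - c / (2 * r) * (Complex.exp (2 * r * ζ) / W ζ ^ 2) with hPdef
  set P' : ℂ → ℂ := fun ζ => c / r * (Complex.exp (2 * r * ζ) * X ζ / W ζ ^ 3) with hP'def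
  have hP : ∀ ζ ∈ rightHalfPlane x₁, HasDerivAt P (P' ζ) ζ := by
    intro ζ hζ
    have he : HasDerivAt (fun ζ : ℂ => Complex.exp (2 * r * ζ))
        (Complex.exp (2 * r * ζ) * (2 * r)) ζ := by
      simpa using ((hasDerivAt_id ζ).const_mul (2 * r : ℂ)).cexp
    have h1 := ((hΦ ζ hζ).div (hW ζ hζ) (hW0 ζ hζ)).sub
      ((he.div ((hW ζ hζ).pow 2) (pow_ne_zero 2 (hW0 ζ hζ))).const_mul (c / (2 * r)))
    refine h1.congr_deriv ?_
    rw [hwr ζ hζ]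
    have := hW0 ζ hζ
    simp only [hP'def, Pi.pow_apply]
    field_simp
    push_cast
    ring
  have hexp : ∀ ζ : ℂ, ‖Complex.exp (2 * r * ζ)‖ = Real.exp (2 * r * ζ.re) := fun ζ => by
    rw [Complex.norm_exp]; simp
  have hP'b : ∀ ζ ∈ rightHalfPlane x₁,
      ‖P' ζ‖ ≤ 8 * ‖c‖ * C / r * (Real.exp (2 * r * ζ.re) / ‖ζ‖ ^ 2) := by
    intro ζ hζ
    have h1 : (1 / 8 : ℝ) ≤ ‖W ζ‖ ^ 3 := by
      have := pow_le_pow_left₀ (by norm_num) (hWlow ζ hζ) 3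
      linarith
    simp only [hP'def]
    rw [norm_mul, norm_div, norm_div, norm_mul, hexp, norm_pow, Complex.norm_real,
      Real.norm_of_nonneg hr.le]
    calc _ ≤ ‖c‖ / r * (Real.exp (2 * r * ζ.re) * (C / ‖ζ‖ ^ 2) / (1 / 8)) := by
          gcongr
          exact hXb ζ hζ
      _ = _ := by ring
  -- To the right of `x₂ ≥ 1` one has `‖ζ‖² ≥ 72 C / r`, which lowers the bound on `P'` to `‖c‖ / 9`
  -- times the exponential.
  set x₂ := x₁ + 1 + 72 * C / r with hx₂
  have hCr : 0 ≤ 72 * C / r := by positivity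
  have hx₂1 : 1 ≤ x₂ := by linarith
  have hmem : ∀ ζ : ℂ, x₂ ≤ ζ.re → ζ ∈ rightHalfPlane x₁ := fun ζ hζ => by
    change x₁ < ζ.re; linarith
  have hP'b2 : ∀ ζ : ℂ, x₂ ≤ ζ.re → ‖P' ζ‖ ≤ ‖c‖ / 9 * Real.exp (2 * r * ζ.re) := by
    intro ζ hζ
    refine (hP'b ζ (hmem ζ hζ)).trans ?_
    have h1 : x₂ ≤ ‖ζ‖ := hζ.trans (Complex.re_le_norm ζ)
    have h2 : 72 * C / r ≤ ‖ζ‖ ^ 2 := by nlinarith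
    rw [div_le_iff₀ hr] at h2
    have h3 : 0 < ‖ζ‖ ^ 2 := pow_pos (by linarith) 2
    rw [mul_div_assoc', div_le_iff₀ h3, div_mul_eq_mul_div, div_le_iff₀ hr]
    nlinarith [mul_pos hc' (Real.exp_pos (2 * r * ζ.re))]
  -- the vertical line `Re ζ = x₂`
  set K₁ := 8 * ‖c‖ * C / r * Real.exp (2 * r * x₂) with hK₁
  have hK₁0 : 0 ≤ K₁ := by positivity
  have hvert : ∀ v : ℂ, v.re = 0 → v.im ^ 2 = 1 → ∀ l : ℝ, 0 ≤ l →
      ‖P ((x₂ : ℂ) + l * v) - P x₂‖ ≤ K₁ * Real.arctan l - K₁ * Real.arctan 0 := by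
    intro v hv0 hv1 l hl
    have hvn : ‖v‖ = 1 := by
      have : ‖v‖ ^ 2 = 1 := by rw [Complex.sq_norm, Complex.normSq_apply, hv0, ← hv1]; ring
      exact (pow_eq_one_iff_of_nonneg (norm_nonneg v) two_ne_zero).1 this
    refine norm_sub_le_of_line (B := fun s => K₁ * Real.arctan s)
      (B' := fun s => K₁ * (1 / (1 + s ^ 2))) (P' := P') hl (fun s _ => hP _ (hmem _ ?_))
      (fun s => (Real.hasDerivAt_arctan s).const_mul K₁) fun s _ => ?_
    · simp [hv0]
    · rw [norm_mul, hvn, mul_one]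
      have hre : ((x₂ : ℂ) + s * v).re = x₂ := by simp [hv0]
      refine (hP'b _ (hmem _ hre.ge)).trans ?_
      have h1 : 1 + s ^ 2 ≤ ‖(x₂ : ℂ) + s * v‖ ^ 2 := by
        rw [Complex.sq_norm, Complex.normSq_apply, hre]
        simp only [Complex.add_im, Complex.ofReal_im, Complex.mul_im, Complex.ofReal_re]
        nlinarith [mul_self_nonneg s, mul_self_nonneg (s * v.im)]
      rw [hre]
      calc _ ≤ 8 * ‖c‖ * C / r * (Real.exp (2 * r * x₂) / (1 + s ^ 2)) := by gcongr
        _ = K₁ * (1 / (1 + s ^ 2)) := by rw [hK₁]; ring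
  set K₃ := ‖P x₂‖ + K₁ * (Real.pi / 2) with hK₃
  have hline : ∀ η : ℝ, ‖P ((x₂ : ℂ) + η * Complex.I)‖ ≤ K₃ := by
    intro η
    have h1 : ∀ v : ℂ, v.re = 0 → v.im ^ 2 = 1 → ∀ l : ℝ, 0 ≤ l →
        ‖P ((x₂ : ℂ) + l * v)‖ ≤ K₃ := by
      intro v hv0 hv1 l hl
      have h2 := hvert v hv0 hv1 l hl
      rw [Real.arctan_zero, mul_zero, sub_zero] at h2
      have h3 := norm_sub_norm_le (P ((x₂ : ℂ) + l * v)) (P x₂)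
      have h4 : K₁ * Real.arctan l ≤ K₁ * (Real.pi / 2) := by
        gcongr; exact (Real.arctan_lt_pi_div_two l).le
      linarith
    rcases le_total 0 η with h | h
    · exact h1 Complex.I (by simp) (by simp) η h
    · simpa using h1 (-Complex.I) (by simp) (by simp) (-η) (by linarith)
  have hPb : ∀ ζ : ℂ, x₂ ≤ ζ.re →
      ‖P ζ‖ ≤ K₃ + ‖c‖ / (18 * r) * Real.exp (2 * r * ζ.re) := by
    intro ζ hζ
    have h1 := norm_sub_le_of_line (P := P) (P' := P') (ζ := (x₂ : ℂ) + ζ.im * Complex.I) (v := 1)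
      (l := ζ.re - x₂) (B := fun s => ‖c‖ / (18 * r) * Real.exp (2 * r * (x₂ + s)))
      (B' := fun s => ‖c‖ / 9 * Real.exp (2 * r * (x₂ + s))) (by linarith)
      (fun s hs => hP _ (hmem _ (by simpa using hs.1))) (fun s => ?_) (fun s hs => ?_)
    · have e1 : (x₂ : ℂ) + ζ.im * Complex.I + ((ζ.re - x₂ : ℝ) : ℂ) * 1 = ζ := by
        apply Complex.ext <;> simp
      rw [e1] at h1
      simp only [add_sub_cancel] at h1
      have h2 := norm_sub_norm_le (P ζ) (P ((x₂ : ℂ) + ζ.im * Complex.I))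
      have h3 : 0 ≤ ‖c‖ / (18 * r) * Real.exp (2 * r * (x₂ + 0)) := by positivity
      linarith [hline ζ.im]
    · have := ((((hasDerivAt_id s).const_add x₂).const_mul (2 * r)).exp).const_mul (‖c‖ / (18 * r))
      refine this.congr_deriv ?_
      simp only [id, mul_one]
      field_simp
      norm_num
    · rw [mul_one]
      refine (hP'b2 _ (by simpa using hs.1)).trans_eq ?_
      simp
  -- In units of `‖c‖ / (18 r) e^{2 r Re ζ}` the main term is at least `4`, since `‖W‖ ≤ 3/2`, and
  -- `P` is at most `1` up to `K₃`. The remaining `3` is halved on multiplying by `‖W‖ ≥ 1/2`.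
  have hE : ∀ ζ : ℂ, x₂ ≤ ζ.re →
      ‖c‖ / (12 * r) * Real.exp (2 * r * ζ.re) - K₃ / 2 ≤ ‖Φ ζ‖ := by
    intro ζ hζ
    have hζm := hmem ζ hζ
    have e1 : c / (2 * r) * (Complex.exp (2 * r * ζ) / W ζ ^ 2) = Φ ζ / W ζ - P ζ := by
      simp only [hPdef]; ring
    have h1 := norm_sub_le (Φ ζ / W ζ) (P ζ)
    rw [← e1, norm_mul, norm_div, norm_div, norm_div, hexp, norm_pow, norm_mul, Complex.norm_real,
      Real.norm_of_nonneg hr.le, Complex.norm_ofNat] at h1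
    have hWl := hWlow ζ hζm
    have hWu := hWup ζ hζm
    have h2 : ‖c‖ / (2 * r) * (4 / 9 * Real.exp (2 * r * ζ.re)) ≤
        ‖c‖ / (2 * r) * (Real.exp (2 * r * ζ.re) / ‖W ζ‖ ^ 2) := by
      gcongr
      rw [le_div_iff₀ (by positivity)]
      have : ‖W ζ‖ ^ 2 ≤ 9 / 4 := by nlinarith
      nlinarith [Real.exp_pos (2 * r * ζ.re)]
    have h3 : ‖Φ ζ‖ / ‖W ζ‖ ≤ 2 * ‖Φ ζ‖ := by
      rw [div_le_iff₀ (by linarith)]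
      nlinarith [norm_nonneg (Φ ζ)]
    have h4 := hPb ζ hζ
    have e2 : ‖c‖ / (2 * r) * (4 / 9 * Real.exp (2 * r * ζ.re))
        = 4 * (‖c‖ / (18 * r) * Real.exp (2 * r * ζ.re)) := by field_simp; norm_num
    have e3 : ‖c‖ / (12 * r) * Real.exp (2 * r * ζ.re)
        = 3 / 2 * (‖c‖ / (18 * r) * Real.exp (2 * r * ζ.re)) := by field_simp; norm_num
    rw [e3]
    linarith
  have hlim : Tendsto (fun x : ℝ => ‖c‖ / (12 * r) * Real.exp (2 * r * x) - K₃ / 2) atTop atTop := by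
    refine tendsto_atTop_add_const_right _ _ (Tendsto.const_mul_atTop (by positivity) ?_)
    exact Real.tendsto_exp_atTop.comp (tendsto_id.const_mul_atTop (by positivity))
  obtain ⟨R, hR⟩ := (hlim.eventually_gt_atTop B).exists_forall_of_atTop
  refine ⟨max R x₂, fun ζ hζ => ?_⟩
  have h1 : x₂ ≤ ζ.re := (le_max_right _ _).trans hζ.le
  exact ⟨hmem ζ h1, (hR _ ((le_max_left _ _).trans hζ.le)).trans_le (hE ζ h1)⟩

end HalfPlane


/-! ### The Liouville transformation -/

/-- The potential `V` in the Liouville normal form `W'' - 2 r W' = V W`. -/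
noncomputable def potential (a : ℂ) (θ : ℝ) (z : ℂ) : ℂ :=
  -(Complex.exp (Complex.I * θ) ^ 2)⁻¹ * errorCoeff a z

theorem norm_potential (a : ℂ) (θ : ℝ) (z : ℂ) : ‖potential a θ z‖ = ‖errorCoeff a z‖ := by
  rw [potential, norm_mul, norm_neg, norm_inv, norm_pow, mul_comm Complex.I,
    Complex.norm_exp_ofReal_mul_I]
  simp

theorem differentiableAt_potential {a z : ℂ} (θ : ℝ) (hz : (cubic a).eval z ≠ 0) :
    DifferentiableAt ℂ (potential a θ) z := by
  unfold potential errorCoeff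
  have h1 : DifferentiableAt ℂ (fun z => (cubic a).eval z) z := (cubic a).differentiableAt
  have h2 : DifferentiableAt ℂ (fun z => (cubic a).derivative.eval z) z :=
    (cubic a).derivative.differentiableAt
  have h3 : DifferentiableAt ℂ (fun z => (cubic a).derivative.derivative.eval z) z :=
    (cubic a).derivative.derivative.differentiableAt
  refine DifferentiableAt.const_mul (DifferentiableAt.sub (DifferentiableAt.const_mul
    ((h2.pow 2).div (h1.pow 3) (pow_ne_zero 3 hz)) _) (h3.div ((h1.pow 2).const_mul 4) ?_)) _
  exact mul_ne_zero (by norm_num) (pow_ne_zero 2 hz)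

/-- The amplitude `W = p_a^{1/4} e^{r h} y`. -/
noncomputable def amplitude (q h : ℂ → ℂ) (r : ℝ) (y : ℂ → ℂ) (z : ℂ) : ℂ :=
  q z * Complex.exp (r * h z) * y z

/-- The derivative of the amplitude with respect to `h`, in terms of `y` and `y'`. -/
noncomputable def amplitudeDeriv (a : ℂ) (q h : ℂ → ℂ) (r : ℝ) (y y' : ℂ → ℂ) (z : ℂ) : ℂ :=
  q z * Complex.exp (r * h z) *
    (((cubic a).derivative.eval z / (4 * (cubic a).eval z) / deriv h z + r) * y z
      + y' z / deriv h z)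

theorem IsSolution.hasDerivAt {a μ : ℂ} {y : ℂ → ℂ} (hy : IsSolution a μ y) (z : ℂ) :
    HasDerivAt y (deriv y z) z ∧ HasDerivAt (deriv y) (μ ^ 2 * (cubic a).eval z * y z) z := by
  refine ⟨(hy.1 z).hasDerivAt, ?_⟩
  have h1 : DifferentiableAt ℂ (deriv y) z :=
    (hy.1.differentiableOn.deriv isOpen_univ).differentiableAt univ_mem
  refine h1.hasDerivAt.congr_deriv ?_
  have := hy.2 z
  linear_combination -this

theorem isSolution_of_hasDerivAt {a μ : ℂ} {y y' : ℂ → ℂ} (h1 : ∀ z, HasDerivAt y (y' z) z)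
    (h2 : ∀ z, HasDerivAt y' (μ ^ 2 * (cubic a).eval z * y z) z) : IsSolution a μ y := by
  have e : deriv y = y' := funext fun z => (h1 z).deriv
  refine ⟨fun z => (h1 z).differentiableAt, fun z => ?_⟩
  rw [e, (h2 z).deriv]
  ring

namespace IsCanonicalBranch

variable {a : ℂ} {θ : ℝ} {D : Set ℂ} {h : ℂ → ℂ}
variable (hb : IsCanonicalBranch a θ D h) (hp : ∀ z ∈ D, (cubic a).eval z ≠ 0)
include hb hp

section Transform

variable {q : ℂ → ℂ} (hq : DifferentiableOn ℂ q D) (hq4 : ∀ z ∈ D, q z ^ 4 = (cubic a).eval z)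
include hq hq4

omit hb hq in
theorem root_ne_zero {z : ℂ} (hz : z ∈ D) : q z ≠ 0 := fun h0 => by
  have := hq4 z hz
  rw [h0, zero_pow (by norm_num)] at this
  exact hp z hz this.symm

theorem hasDerivAt_root {z : ℂ} (hz : z ∈ D) :
    HasDerivAt q (q z * ((cubic a).derivative.eval z / (4 * (cubic a).eval z))) z := by
  have hd := (hq.differentiableAt (hb.isOpen.mem_nhds hz)).hasDerivAt
  have h1 := hd.fun_pow 4
  have h2 : (fun z => q z ^ 4) =ᶠ[𝓝 z] fun z => (cubic a).eval z := by
    filter_upwards [hb.isOpen.mem_nhds hz] with w hw using hq4 w hw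
  have h3 := ((hasDerivAt_cubic a z).congr_of_eventuallyEq h2).unique h1
  have hq0 := root_ne_zero hp hq4 hz
  refine hd.congr_deriv ?_
  rw [h3, ← hq4 z hz]
  push_cast
  field_simp

theorem hasDerivAt_amplitude {r : ℝ} {y y' : ℂ → ℂ} (hy : ∀ z, HasDerivAt y (y' z) z) {z : ℂ}
    (hz : z ∈ D) :
    HasDerivAt (amplitude q h r y) (deriv h z * amplitudeDeriv a q h r y y' z) z := by
  have h1 := hb.hasDerivAt_root hp hq hq4 hz
  have h2 := ((hb.hasDerivAt hz).const_mul (r : ℂ)).cexp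
  refine ((h1.mul h2).mul (hy z)).congr_deriv ?_
  have := hb.deriv_ne_zero hp z hz
  have := hp z hz
  simp only [amplitudeDeriv, Pi.mul_apply]
  field_simp

/-- This is the Liouville normal form as a first-order system in `z`: the fourth root removes every
first-order term except `2 r`, and its second derivative produces the potential. The factor `h'`
records that differentiation is with respect to `h`. -/
theorem hasDerivAt_amplitudeDeriv {r : ℝ} {y y' : ℂ → ℂ} (hy : ∀ z, HasDerivAt y (y' z) z)
    (hy' : ∀ z, HasDerivAt y'
      ((r * Complex.exp (Complex.I * θ)) ^ 2 * (cubic a).eval z * y z) z) {z : ℂ} (hz : z ∈ D) :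
    HasDerivAt (amplitudeDeriv a q h r y y') (deriv h z *
      (2 * r * amplitudeDeriv a q h r y y' z + potential a θ z * amplitude q h r y z)) z := by
  have h1 := hb.hasDerivAt_root hp hq hq4 hz
  have h2 := ((hb.hasDerivAt hz).const_mul (r : ℂ)).cexp
  have h3 := hb.hasDerivAt_deriv hp hz
  have hs0 := hb.deriv_ne_zero hp z hz
  have hp0 := hp z hz
  have h4 : HasDerivAt (fun z => (cubic a).derivative.eval z)
      ((cubic a).derivative.derivative.eval z) z := (cubic a).derivative.hasDerivAt z
  have h5 := (((h4.div ((hasDerivAt_cubic a z).const_mul 4)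
    (mul_ne_zero (by norm_num) hp0)).div h3 hs0).add_const (r : ℂ)).mul (hy z)
  have h6 := (h1.mul h2).mul (h5.add ((hy' z).div h3 hs0))
  refine h6.congr_deriv ?_
  have hs := hb.deriv_sq z hz
  have he : Complex.exp (Complex.I * θ) ^ 2 = deriv h z ^ 2 / (cubic a).eval z := by
    rw [hs]; field_simp
  simp only [amplitudeDeriv, amplitude, potential, errorCoeff, Pi.mul_apply, Pi.add_apply,
    Pi.div_apply]
  rw [mul_pow (r : ℂ), he]
  field_simp
  ring

end Transform

/-! ### A priori estimate along canonical paths -/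

omit hp in
/-- A priori estimate for the amplitude along an infinite canonical path. -/
theorem norm_sub_one_le_of_path {W X : ℂ → ℂ} {r x₁ C : ℝ} (hr : 0 < r)
    (hW : ∀ z ∈ D, HasDerivAt W (deriv h z * X z) z)
    (hX : ∀ z ∈ D, HasDerivAt X (deriv h z * (2 * r * X z + potential a θ z * W z)) z)
    (hWb : ∀ z ∈ D, x₁ < (h z).re → ‖W z - 1‖ ≤ C / (h z).re)
    (hXb : ∀ z ∈ D, x₁ < (h z).re → ‖X z‖ ≤ C / (h z).re)
    {ε : ℝ} {γ : ℝ → ℂ} (hγ : IsInfiniteCanonicalPath a D h ε γ)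
    (hint : errorIntegral a γ < ENNReal.ofReal r) {t : ℝ} (ht : 0 ≤ t) :
    ‖W (γ t) - 1‖ ≤ (errorIntegral a γ).toReal / (r - (errorIntegral a γ).toReal) := by
  set ρ := (errorIntegral a γ).toReal with hρ
  have htop : errorIntegral a γ ≠ ⊤ := (hint.trans ENNReal.ofReal_lt_top).ne
  have hρr : ρ < r := by
    rw [hρ]
    exact (ENNReal.toReal_lt_of_lt_ofReal hint)
  have hρ0 : 0 ≤ ρ := ENNReal.toReal_nonneg
  have hD : ∀ s, 0 ≤ s → γ s ∈ D := fun s hs => (hγ.mem s hs).1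
  have hγc : ContinuousOn γ (Ici 0) := by
    intro s hs
    obtain ⟨K, hK⟩ := hγ.lipschitz (s + 1)
    have hs' : (0 : ℝ) ≤ s := hs
    refine (hK.continuousOn s ⟨hs', by linarith⟩).mono_of_mem_nhdsWithin ?_
    rw [mem_nhdsWithin]
    exact ⟨Iio (s + 1), isOpen_Iio, by simp, fun u hu => ⟨hu.2, le_of_lt hu.1⟩⟩
  have hquot : Tendsto (fun s => C / (h (γ s)).re) atTop (𝓝 0) :=
    tendsto_const_nhds.div_atTop hγ.tendsto_re
  have hWlim : Tendsto (fun s => ‖W (γ s) - 1‖) atTop (𝓝 0) := by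
    refine squeeze_zero' (Eventually.of_forall fun s => norm_nonneg _) ?_ hquot
    filter_upwards [hγ.tendsto_re.eventually_gt_atTop x₁, eventually_ge_atTop 0] with s hs hs0
    exact hWb _ (hD s hs0) hs
  have hXlim : Tendsto (fun s => ‖X (γ s)‖) atTop (𝓝 0) := by
    refine squeeze_zero' (Eventually.of_forall fun s => norm_nonneg _) ?_ hquot
    filter_upwards [hγ.tendsto_re.eventually_gt_atTop x₁, eventually_ge_atTop 0] with s hs hs0
    exact hXb _ (hD s hs0) hs
  have hWc : ContinuousOn (fun s => ‖W (γ s) - 1‖) (Ici 0) := by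
    have hWD : ContinuousOn W D := fun z hz => (hW z hz).continuousAt.continuousWithinAt
    exact ((hWD.comp hγc fun s hs => hD s hs).sub continuousOn_const).norm
  -- Finiteness of the supremum must be known beforehand, because `M` is later absorbed into the
  -- left side.
  obtain ⟨M₀, hM₀⟩ : ∃ M₀, ∀ s, 0 ≤ s → ‖W (γ s) - 1‖ ≤ M₀ := by
    obtain ⟨T, hT⟩ := (hWlim.eventually_le_const zero_lt_one).exists_forall_of_atTop
    obtain ⟨M₁, hM₁⟩ := isCompact_Icc.exists_bound_of_continuousOn
      (hWc.mono (Icc_subset_Ici_self : Icc 0 T ⊆ Ici 0))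
    refine ⟨max 1 M₁, fun s hs => ?_⟩
    rcases le_total s T with h1 | h1
    · have := hM₁ s ⟨hs, h1⟩
      rw [norm_norm] at this
      exact this.trans (le_max_right _ _)
    · exact (hT s h1).trans (le_max_left _ _)
  set S : Set ℝ := (fun s => ‖W (γ s) - 1‖) '' Ici 0 with hS
  have hSb : BddAbove S := ⟨M₀, by rintro _ ⟨s, hs, rfl⟩; exact hM₀ s hs⟩
  set M := sSup S with hM
  have hMle : ∀ s, 0 ≤ s → ‖W (γ s) - 1‖ ≤ M := fun s hs => le_csSup hSb ⟨s, hs, rfl⟩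
  have hM0 : 0 ≤ M := (norm_nonneg _).trans (hMle 0 le_rfl)
  have hclaim : ∀ t, 0 ≤ t → ‖W (γ t) - 1‖ ≤ (1 + M) / r * ρ := by
    intro t ht
    -- `k` is the variation-of-constants kernel, vanishing at `γ t`. Since `1 - 2 r k` equals the
    -- exponential, the terms with `X` cancel in the derivative of `W - k X` and only `V W` is left.
    set k : ℂ → ℂ := fun z => (1 - Complex.exp (2 * r * (h (γ t) - h z))) / (2 * r) with hk
    have hrC : (r : ℂ) ≠ 0 := by exact_mod_cast hr.ne'
    have hkb : ∀ s, t ≤ s → ‖k (γ s)‖ ≤ 1 / r := by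
      intro s hs
      have hmono : (h (γ t)).re ≤ (h (γ s)).re := hγ.monotone ht (ht.trans hs) hs
      have h1 : ‖Complex.exp (2 * r * (h (γ t) - h (γ s)))‖ ≤ 1 := by
        rw [Complex.norm_exp, Real.exp_le_one_iff]
        simp
        nlinarith
      have h2 := norm_sub_le (1 : ℂ) (Complex.exp (2 * r * (h (γ t) - h (γ s))))
      rw [norm_one] at h2
      simp only [hk]
      rw [norm_div, norm_mul, Complex.norm_ofNat, Complex.norm_real, Real.norm_of_nonneg hr.le,
        div_le_div_iff₀ (by positivity) hr]
      nlinarith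
    have hΨ : ∀ z ∈ D, HasDerivAt (fun z => W z - k z * X z)
        (-(k z * (deriv h z * (potential a θ z * W z)))) z := by
      intro z hz
      have hkd : HasDerivAt k (deriv h z * Complex.exp (2 * r * (h (γ t) - h z))) z := by
        have := ((((hb.hasDerivAt hz).const_sub (h (γ t))).const_mul (2 * r : ℂ)).cexp.const_sub
          1).div_const (2 * r : ℂ)
        refine this.congr_deriv ?_
        field_simp
      refine ((hW z hz).sub (hkd.mul (hX z hz))).congr_deriv ?_
      simp only [hk]
      field_simp
      ring
    have hbound : ∀ T, t ≤ T → ‖(W (γ T) - k (γ T) * X (γ T)) - W (γ t)‖ ≤ (1 + M) / r * ρ := by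
      intro T hT
      obtain ⟨K, hK⟩ := hγ.lipschitz T
      have h1 := enorm_sub_le_lintegral_comp hb.isOpen hΨ hT
        (hK.mono (Icc_subset_Icc_left ht)) (fun s hs => hD s (ht.trans hs.1))
      have hkt : k (γ t) = 0 := by simp [hk]
      simp only [hkt, zero_mul, sub_zero] at h1
      have h2 : ∫⁻ s in Ioo t T, ‖-(k (γ s) * (deriv h (γ s) * (potential a θ (γ s) * W (γ s))))
          * deriv γ s‖ₑ ≤ ENNReal.ofReal ((1 + M) / r) * errorIntegral a γ := by
        rw [errorIntegral, ← lintegral_const_mul' _ _ ENNReal.ofReal_ne_top]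
        refine le_trans (setLIntegral_mono' measurableSet_Ioo fun s hs => ?_)
          (lintegral_mono_set fun s hs => ht.trans_lt hs.1)
        have hs0 : 0 ≤ s := ht.trans hs.1.le
        rw [← ofReal_norm, ← ENNReal.ofReal_mul (by positivity)]
        refine ENNReal.ofReal_le_ofReal ?_
        have hWs : ‖W (γ s)‖ ≤ 1 + M := by
          have := norm_add_le (W (γ s) - 1) 1
          rw [sub_add_cancel, norm_one] at this
          linarith [hMle s hs0]
        rw [norm_mul, norm_neg, norm_mul, norm_mul, norm_mul, norm_potential, errorDensity_eq,
          ← hb.norm_deriv (hD s hs0)]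
        calc _ ≤ 1 / r * (‖deriv h (γ s)‖ * (‖errorCoeff a (γ s)‖ * (1 + M))) * ‖deriv γ s‖ := by
              gcongr
              exact hkb s hs.1.le
          _ = _ := by ring
      have h3 := h1.trans h2
      rw [← ENNReal.ofReal_toReal htop, ← ENNReal.ofReal_mul (by positivity),
        ← ofReal_norm] at h3
      exact (ENNReal.ofReal_le_ofReal_iff (by positivity)).1 h3
    -- At the far end of the path `W → 1`, while `X → 0` and `k` stays bounded.
    have hlim : Tendsto (fun T => ‖(W (γ T) - k (γ T) * X (γ T)) - W (γ t)‖) atTop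
        (𝓝 ‖((1 : ℂ) - 0) - W (γ t)‖) := by
      refine ((Tendsto.sub ?_ ?_).sub_const _).norm
      · exact tendsto_iff_norm_sub_tendsto_zero.2 hWlim
      · refine squeeze_zero_norm' ?_ (by simpa using hXlim.const_mul (1 / r))
        filter_upwards [eventually_ge_atTop t] with s hs
        rw [norm_mul]
        gcongr
        exact (hkb s hs).trans_eq (one_div r)
    rw [norm_sub_rev]
    have := le_of_tendsto hlim ((eventually_ge_atTop t).mono hbound)
    simpa using this
  have hMle2 : M ≤ (1 + M) / r * ρ :=
    csSup_le ⟨_, ⟨0, self_mem_Ici, rfl⟩⟩ (by rintro _ ⟨s, hs, rfl⟩; exact hclaim s hs)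
  refine (hMle t ht).trans ?_
  rw [le_div_iff₀ (by linarith)]
  rw [div_mul_eq_mul_div, le_div_iff₀ hr] at hMle2
  linarith

end IsCanonicalBranch


/-! ### The entire recessive solution -/

namespace IsCanonicalBranch

variable {a : ℂ} {θ : ℝ} {D : Set ℂ} {h : ℂ → ℂ}
variable (hb : IsCanonicalBranch a θ D h) (hp : ∀ z ∈ D, (cubic a).eval z ≠ 0)
include hb hp

/-- Pulling a system on `D` back to the `h`-plane. -/
theorem hasDerivAt_pullback {F F' : ℂ → ℂ} (hF : ∀ z ∈ D, HasDerivAt F (deriv h z * F' z) z)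
    {ζ : ℂ} (hζ : ζ ∈ h '' D) :
    HasDerivAt (fun ζ => F (Function.invFunOn h D ζ)) (F' (Function.invFunOn h D ζ)) ζ := by
  have h1 := (hF _ (inv_mem hζ)).comp ζ (hb.hasDerivAt_inv hp hζ)
  refine h1.congr_deriv ?_
  have := hb.deriv_ne_zero hp _ (inv_mem hζ)
  field_simp

/-- Existence of the WKB solution, together with its recessive amplitude in a half-plane. -/
theorem exists_recessive_solution {q : ℂ → ℂ} (hq : DifferentiableOn ℂ q D)
    (hq4 : ∀ z ∈ D, q z ^ 4 = (cubic a).eval z) (hG : rightHalfPlane 0 ⊆ h '' D) {r : ℝ}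
    (hr : 0 < r) :
    ∃ (y y' : ℂ → ℂ) (x₁ C : ℝ), 0 < x₁ ∧ 0 ≤ C ∧ (∀ z, HasDerivAt y (y' z) z) ∧
      (∀ z, HasDerivAt y'
        ((r * Complex.exp (Complex.I * θ)) ^ 2 * (cubic a).eval z * y z) z) ∧
      ∀ ζ ∈ rightHalfPlane x₁,
        ‖amplitude q h r y (Function.invFunOn h D ζ) - 1‖ ≤ 1 / 2 ∧
        ‖amplitude q h r y (Function.invFunOn h D ζ) - 1‖ ≤ C / ζ.re ∧
        ‖amplitudeDeriv a q h r y y' (Function.invFunOn h D ζ)‖ ≤ C / ‖ζ‖ ^ 2 := by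
  set g := Function.invFunOn h D
  obtain ⟨x₀, C₀, hx₀, hC₀, hVb⟩ := hb.exists_errorCoeff_le_rightHalfPlane hp hG
  have hsub : ∀ {x : ℝ}, 0 ≤ x → rightHalfPlane x ⊆ h '' D := fun hx ζ hζ =>
    hG (hx.trans_lt hζ)
  obtain ⟨x₁, C, W, X, hx₁, hC, hW, hX, hW1, hWC, hXC⟩ := exists_recessive
    (V := fun ζ => potential a θ (g ζ)) hr hx₀ hC₀
    (fun ζ hζ => by
      have hζ' := hsub hx₀.le hζ
      exact ((differentiableAt_potential θ (hp _ (inv_mem hζ'))).comp ζ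
        (hb.hasDerivAt_inv hp hζ').differentiableAt).differentiableWithinAt)
    (fun ζ hζ => by rw [norm_potential]; exact hVb ζ hζ)
  have hx₁0 : 0 < x₁ := hx₀.trans_le hx₁
  have hW0 : ∀ ζ ∈ rightHalfPlane x₁, W ζ ≠ 0 := by
    intro ζ hζ h0
    have := hW1 ζ hζ
    rw [h0] at this
    norm_num at this
  set ζ₁ : ℂ := ((x₁ + 1 : ℝ) : ℂ)
  have hζ₁ : ζ₁ ∈ rightHalfPlane x₁ := by
    change x₁ < ζ₁.re
    simp [ζ₁]
  have hζ₁D := hsub hx₁0.le hζ₁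
  set z₁ := g ζ₁
  have hz₁ : z₁ ∈ D := inv_mem hζ₁D
  have hq0 := root_ne_zero hp hq4 hz₁
  have hs0 := hb.deriv_ne_zero hp z₁ hz₁
  set A := q z₁ * Complex.exp (r * h z₁)
  have hA0 : A ≠ 0 := mul_ne_zero hq0 (Complex.exp_ne_zero _)
  set k := (cubic a).derivative.eval z₁ / (4 * (cubic a).eval z₁) / deriv h z₁ + r
  -- The Cauchy data at `z₁` make the amplitude and its derivative agree with `W` and `X` at `ζ₁`.
  -- The Wronskian is then zero there, hence everywhere in the half-plane.
  obtain ⟨y, y', hy, hy', hyz, hyz'⟩ := exists_entire_solution a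
    (r * Complex.exp (Complex.I * θ)) z₁ (W ζ₁ / A) (deriv h z₁ * (X ζ₁ / A - k * (W ζ₁ / A)))
  have hΦ : ∀ ζ ∈ rightHalfPlane x₁, HasDerivAt (fun ζ => amplitude q h r y (g ζ))
      (amplitudeDeriv a q h r y y' (g ζ)) ζ := fun ζ hζ =>
    hb.hasDerivAt_pullback hp (fun z hz => hb.hasDerivAt_amplitude hp hq hq4 hy hz)
      (hsub hx₁0.le hζ)
  have hΞ : ∀ ζ ∈ rightHalfPlane x₁, HasDerivAt (fun ζ => amplitudeDeriv a q h r y y' (g ζ))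
      (2 * r * amplitudeDeriv a q h r y y' (g ζ)
        + potential a θ (g ζ) * amplitude q h r y (g ζ)) ζ := fun ζ hζ =>
    hb.hasDerivAt_pullback hp
      (F' := fun z => 2 * r * amplitudeDeriv a q h r y y' z + potential a θ z * amplitude q h r y z)
      (fun z hz => hb.hasDerivAt_amplitudeDeriv hp hq hq4 hy hy' hz) (hsub hx₁0.le hζ)
  obtain ⟨c, hc⟩ := exists_wronskian_eq hW hX hΦ hΞ
  have hΦ1 : amplitude q h r y (g ζ₁) = W ζ₁ := by
    change A * y z₁ = W ζ₁
    rw [hyz]; field_simp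
  have hΞ1 : amplitudeDeriv a q h r y y' (g ζ₁) = X ζ₁ := by
    change A * (k * y z₁ + y' z₁ / deriv h z₁) = X ζ₁
    rw [hyz, hyz']; field_simp; ring
  have hc0 : c = 0 := by
    have := hc ζ₁ hζ₁
    rw [hΦ1, hΞ1, mul_comm, sub_self] at this
    exact (mul_eq_zero.1 this.symm).resolve_right (Complex.exp_ne_zero _)
  have hΦW : ∀ ζ ∈ rightHalfPlane x₁, amplitude q h r y (g ζ) = W ζ := by
    intro ζ hζ
    have := eq_const_mul_of_wronskian_eq_zero hW hW0 hΦ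
      (fun ζ hζ => by rw [hc ζ hζ, hc0, zero_mul]) hζ₁ ζ hζ
    rw [this, hΦ1, div_self (hW0 ζ₁ hζ₁), one_mul]
  have hΞX : ∀ ζ ∈ rightHalfPlane x₁, amplitudeDeriv a q h r y y' (g ζ) = X ζ := by
    intro ζ hζ
    have h1 := hc ζ hζ
    rw [hc0, zero_mul, hΦW ζ hζ, mul_comm (W ζ), ← sub_mul] at h1
    exact sub_eq_zero.1 ((mul_eq_zero.1 h1).resolve_right (hW0 ζ hζ))
  refine ⟨y, y', x₁, C, hx₁0, hC, hy, hy', fun ζ hζ => ?_⟩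
  rw [hΦW ζ hζ, hΞX ζ hζ]
  exact ⟨hW1 ζ hζ, hWC ζ hζ, hXC ζ hζ⟩

end IsCanonicalBranch

end CubicWKB

/-! ### Assembly of the theorem -/

theorem theorem8p1 :
    ∃ c₂ : ℝ, 0 < c₂ ∧
      ∀ (a : ℂ) (θ : ℝ) (D H : Set ℂ) (h : ℂ → ℂ) (z₀ : ℂ) (q : ℂ → ℂ),
        a ≠ 1 → a ≠ -1 → 0 ≤ θ → θ < Real.pi / 2 →
        CubicWKB.IsCanonicalBranch a θ D h →
        CubicWKB.IsBasedHalfPlane a D h H z₀ →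
        -- `q` is a holomorphic branch of the fourth root of `p_a` on `D`
        DifferentiableOn ℂ q D →
        (∀ z ∈ D, q z ^ 4 = (CubicWKB.cubic a).eval z) →
        -- for small `ε`, infinite canonical paths with bounded error-control integrals start at
        -- all points of `D_ε`
        (∃ ε₀ : ℝ, 0 < ε₀ ∧ ∀ ε : ℝ, 0 < ε → ε < ε₀ →
          ∃ Γ : Set (ℝ → ℂ),
            (∀ γ ∈ Γ, CubicWKB.IsInfiniteCanonicalPath a D h ε γ) ∧
            (∀ z ∈ CubicWKB.trimmed a D h ε, ∃ γ ∈ Γ, γ 0 = z) ∧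
            CubicWKB.errorSup a Γ < ⊤) ∧
        -- the WKB solution for `λ = r e^{iθ}`
        (∀ r : ℝ, 0 < r →
          ∃ y₂ φ₂ : ℂ → ℂ,
            CubicWKB.IsSolution a (r * Complex.exp (Complex.I * θ)) y₂ ∧
            (∃ z, y₂ z ≠ 0) ∧
            DifferentiableOn ℂ φ₂ D ∧
            (∀ z ∈ D, y₂ z = (q z)⁻¹ * Complex.exp (-(r * h z)) * (1 + φ₂ z)) ∧
            (∀ (ε : ℝ) (Γ : Set (ℝ → ℂ)), 0 < ε →
              (∀ γ ∈ Γ, CubicWKB.IsInfiniteCanonicalPath a D h ε γ) →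
              CubicWKB.errorSup a Γ < ENNReal.ofReal r →
              ∀ γ ∈ Γ, ∀ t : ℝ, 0 ≤ t →
                ‖φ₂ (γ t)‖ ≤ c₂ * ((CubicWKB.errorSup a Γ).toReal /
                  (r - (CubicWKB.errorSup a Γ).toReal))) ∧
            -- uniqueness up to a constant multiple
            (∀ (w φ : ℂ → ℂ) (ε : ℝ) (γ : ℝ → ℂ) (C : ℝ),
              CubicWKB.IsSolution a (r * Complex.exp (Complex.I * θ)) w →
              (∀ z ∈ D, w z = (q z)⁻¹ * Complex.exp (-(r * h z)) * (1 + φ z)) →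
              0 < ε → CubicWKB.IsInfiniteCanonicalPath a D h ε γ →
              (∀ t : ℝ, 0 ≤ t → ‖φ (γ t)‖ ≤ C) →
              ∃ k : ℂ, ∀ z, w z = k * y₂ z)) := by
  refine ⟨1, one_pos, fun a θ D H h z₀ q ha1 ha2 _ _ hb hH hq hq4 => ?_⟩
  have hp := hb.cubic_ne_zero ha1 ha2
  refine ⟨hb.exists_paths hp, fun r hr => ?_⟩
  have hG : CubicWKB.rightHalfPlane 0 ⊆ h '' D := fun ζ hζ => by
    have : ζ ∈ h '' H := by rw [hH.image_eq]; exact hζ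
    exact Set.image_mono hH.subset this
  obtain ⟨y, y', x₁, C₁, hx₁, hC₁, hy, hy', hrec⟩ :=
    hb.exists_recessive_solution hp hq hq4 hG hr
  have hsub : CubicWKB.rightHalfPlane x₁ ⊆ h '' D := fun ζ hζ => hG (hx₁.trans hζ)
  have hW : ∀ z ∈ D, HasDerivAt (CubicWKB.amplitude q h r y)
      (deriv h z * CubicWKB.amplitudeDeriv a q h r y y' z) z := fun z hz =>
    hb.hasDerivAt_amplitude hp hq hq4 hy hz
  have hX : ∀ z ∈ D, HasDerivAt (CubicWKB.amplitudeDeriv a q h r y y') (deriv h z *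
      (2 * r * CubicWKB.amplitudeDeriv a q h r y y' z
        + CubicWKB.potential a θ z * CubicWKB.amplitude q h r y z)) z := fun z hz =>
    hb.hasDerivAt_amplitudeDeriv hp hq hq4 hy hy' hz
  have hrecD : ∀ z ∈ D, x₁ < (h z).re →
      ‖CubicWKB.amplitude q h r y z - 1‖ ≤ 1 / 2 ∧
      ‖CubicWKB.amplitude q h r y z - 1‖ ≤ C₁ / (h z).re ∧
      ‖CubicWKB.amplitudeDeriv a q h r y y' z‖ ≤ C₁ / ‖h z‖ ^ 2 := fun z hz hre => by
    have := hrec (h z) hre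
    rwa [hb.inv_apply hz] at this
  have hamp : ∀ (w φ : ℂ → ℂ), ∀ z ∈ D,
      w z = (q z)⁻¹ * Complex.exp (-(r * h z)) * (1 + φ z) ↔
        CubicWKB.amplitude q h r w z = 1 + φ z := by
    intro w φ z hz
    have h1 := CubicWKB.IsCanonicalBranch.root_ne_zero hp hq4 hz
    have h2 := Complex.exp_ne_zero (r * h z)
    rw [CubicWKB.amplitude, Complex.exp_neg]
    constructor
    · intro h3
      rw [h3]; field_simp
    · intro h3
      rw [← h3]; field_simp
  set g := Function.invFunOn h D
  set ζ₁ : ℂ := ((x₁ + 1 : ℝ) : ℂ)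
  have hζ₁ : ζ₁ ∈ CubicWKB.rightHalfPlane x₁ := by
    change x₁ < ζ₁.re
    simp [ζ₁]
  have hz₁ : g ζ₁ ∈ D := CubicWKB.IsCanonicalBranch.inv_mem (hsub hζ₁)
  have hW0 : ∀ ζ ∈ CubicWKB.rightHalfPlane x₁, CubicWKB.amplitude q h r y (g ζ) ≠ 0 := by
    intro ζ hζ h0
    have := (hrec ζ hζ).1
    rw [h0] at this
    norm_num at this
  refine ⟨y, fun z => CubicWKB.amplitude q h r y z - 1, CubicWKB.isSolution_of_hasDerivAt hy hy',
    ⟨g ζ₁, fun h0 => hW0 ζ₁ hζ₁ (by rw [CubicWKB.amplitude, h0, mul_zero])⟩,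
    fun z hz => ((hW z hz).sub_const 1).differentiableAt.differentiableWithinAt,
    fun z hz => (hamp y (fun z => CubicWKB.amplitude q h r y z - 1) z hz).2 (by ring), ?_, ?_⟩
  · intro ε Γ _ hΓ hsup γ hγ t ht
    have hle : CubicWKB.errorIntegral a γ ≤ CubicWKB.errorSup a Γ :=
      le_iSup₂ (f := fun γ (_ : γ ∈ Γ) => CubicWKB.errorIntegral a γ) γ hγ
    -- Past real part `1`, the bound `C₁ / ‖h z‖ ^ 2` is stronger than `C₁ / Re (h z)`.
    have hX' : ∀ z ∈ D, max x₁ 1 < (h z).re →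
        ‖CubicWKB.amplitudeDeriv a q h r y y' z‖ ≤ C₁ / (h z).re := by
      intro z hz hre
      refine (hrecD z hz ((le_max_left _ _).trans_lt hre)).2.2.trans ?_
      have h1 : 1 < (h z).re := (le_max_right _ _).trans_lt hre
      have h2 := Complex.re_le_norm (h z)
      have h3 : (h z).re ≤ ‖h z‖ ^ 2 := by nlinarith
      gcongr
    have hest := hb.norm_sub_one_le_of_path hr hW hX
      (fun z hz hre => (hrecD z hz ((le_max_left x₁ 1).trans_lt hre)).2.1) hX' (hΓ γ hγ)
      (hle.trans_lt hsup) ht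
    refine hest.trans ?_
    rw [one_mul]
    have hlt := ENNReal.toReal_lt_of_lt_ofReal hsup
    have hmono := ENNReal.toReal_mono (hsup.trans ENNReal.ofReal_lt_top).ne hle
    have h0 : 0 < r - (CubicWKB.errorSup a Γ).toReal := by linarith
    gcongr
  · intro w φ ε γ C hw hwφ _ hγ hφ
    have hw' := fun z => hw.hasDerivAt z
    have hΦ : ∀ ζ ∈ CubicWKB.rightHalfPlane x₁,
        HasDerivAt (fun ζ => CubicWKB.amplitude q h r w (g ζ))
        (CubicWKB.amplitudeDeriv a q h r w (deriv w) (g ζ)) ζ := fun ζ hζ =>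
      hb.hasDerivAt_pullback hp
        (fun z hz => hb.hasDerivAt_amplitude hp hq hq4 (fun z => (hw' z).1) hz) (hsub hζ)
    have hΞ : ∀ ζ ∈ CubicWKB.rightHalfPlane x₁,
        HasDerivAt (fun ζ => CubicWKB.amplitudeDeriv a q h r w (deriv w) (g ζ))
        (2 * r * CubicWKB.amplitudeDeriv a q h r w (deriv w) (g ζ)
          + CubicWKB.potential a θ (g ζ) * CubicWKB.amplitude q h r w (g ζ)) ζ := fun ζ hζ =>
      hb.hasDerivAt_pullback hp (F' := fun z => 2 * r * CubicWKB.amplitudeDeriv a q h r w (deriv w) z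
          + CubicWKB.potential a θ z * CubicWKB.amplitude q h r w z)
        (fun z hz => hb.hasDerivAt_amplitudeDeriv hp hq hq4 (fun z => (hw' z).1)
          (fun z => (hw' z).2) hz) (hsub hζ)
    have hW' : ∀ ζ ∈ CubicWKB.rightHalfPlane x₁,
        HasDerivAt (fun ζ => CubicWKB.amplitude q h r y (g ζ))
        (CubicWKB.amplitudeDeriv a q h r y y' (g ζ)) ζ := fun ζ hζ =>
      hb.hasDerivAt_pullback hp hW (hsub hζ)
    have hX' : ∀ ζ ∈ CubicWKB.rightHalfPlane x₁,
        HasDerivAt (fun ζ => CubicWKB.amplitudeDeriv a q h r y y' (g ζ))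
        (2 * r * CubicWKB.amplitudeDeriv a q h r y y' (g ζ)
          + CubicWKB.potential a θ (g ζ) * CubicWKB.amplitude q h r y (g ζ)) ζ := fun ζ hζ =>
      hb.hasDerivAt_pullback hp (F' := fun z => 2 * r * CubicWKB.amplitudeDeriv a q h r y y' z
          + CubicWKB.potential a θ z * CubicWKB.amplitude q h r y z) hX (hsub hζ)
    obtain ⟨c, hc⟩ := CubicWKB.exists_wronskian_eq hW' hX' hΦ hΞ
    -- A nonzero `c` would make the amplitude of `w` exceed `1 + C` at every point with large `Re
    -- ζ`, in particular on the path, where it equals `1 + φ`.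
    have hc0 : c = 0 := by
      by_contra hne
      obtain ⟨R, hR⟩ := CubicWKB.exists_lt_norm_of_wronskian_ne_zero hr hx₁ hC₁ hne hW'
        (fun ζ hζ => (hrec ζ hζ).1) (fun ζ hζ => (hrec ζ hζ).2.2) hΦ hc (1 + C)
      obtain ⟨t, htR, ht0⟩ := ((hγ.tendsto_re.eventually_gt_atTop R).and
        (Filter.eventually_ge_atTop 0)).exists
      have hγD : γ t ∈ D := (hγ.mem t ht0).1
      have h1 := (hR _ htR).2
      rw [show g (h (γ t)) = γ t from hb.inv_apply hγD, (hamp w φ _ hγD).1 (hwφ _ hγD)] at h1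
      have h2 := norm_add_le (1 : ℂ) (φ (γ t))
      rw [norm_one] at h2
      linarith [hφ t ht0]
    have hprop := CubicWKB.eq_const_mul_of_wronskian_eq_zero hW' hW0 hΦ
      (fun ζ hζ => by rw [hc ζ hζ, hc0, zero_mul]) hζ₁
    set k := CubicWKB.amplitude q h r w (g ζ₁) / CubicWKB.amplitude q h r y (g ζ₁)
    refine ⟨k, fun z => ?_⟩
    have hyd : Differentiable ℂ y := fun z => (hy z).differentiableAt
    -- Proportionality of the amplitudes gives that of the solutions near one point; the identity
    -- theorem extends it to the plane.
    have hev : w =ᶠ[nhds (g ζ₁)] fun z => k * y z := by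
      have hre : x₁ < (h (g ζ₁)).re := by
        rw [CubicWKB.IsCanonicalBranch.apply_inv (hsub hζ₁)]; exact hζ₁
      have hnear : ∀ᶠ z in nhds (g ζ₁), x₁ < (h z).re :=
        (Complex.continuous_re.continuousAt.comp (hb.hasDerivAt hz₁).continuousAt).eventually
          (lt_mem_nhds hre)
      filter_upwards [hb.isOpen.mem_nhds hz₁, hnear] with z hzD hzre
      have h1 := hprop (h z) hzre
      rw [show g (h z) = z from hb.inv_apply hzD, CubicWKB.amplitude, CubicWKB.amplitude, mul_left_comm] at h1
      exact mul_left_cancel₀ (mul_ne_zero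
        (CubicWKB.IsCanonicalBranch.root_ne_zero hp hq4 hzD) (Complex.exp_ne_zero _)) h1
    have hwa : AnalyticOnNhd ℂ w Set.univ := fun z _ => hw.1.analyticAt z
    have hya : AnalyticOnNhd ℂ (fun z => k * y z) Set.univ := fun z _ =>
      (hyd.const_mul k).analyticAt z
    exact congrFun (hwa.eq_of_eventuallyEq hya hev) z
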